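/- Let $(M',J,g')$ be a Kähler manifold with Norden metric of dimension $2n+2$, $n\ge 1$: $g'$ is a pseudo-Riemannian metric, $J^2=-\mathrm{id}$, $g'(JX,JY)=-g'(X,Y)$ and $\nabla'J=0$ for the Levi-Civita connection $\nabla'$ of $g'$. Curvature tensors are $R(X,Y)Z=\nabla_X\nabla_YZ-\nabla_Y\nabla_XZ-\nabla_{[X,Y]}Z$, $R(X,Y,Z,U)=g(R(X,Y)Z,U)$. Suppose that $M'$ is of constant totally real sectional curvatures $\nu',\tilde\nu'$, i.e. for functions $\nu',\tilde\nu'$ on $M'$, every point $p'$ and every nondegenerate 2-plane $\alpha'\subset T_{p'}M'$ with $J\alpha'\perp\alpha'$ and basis $x,y$, $$\frac{R'(x,y,y,x)}{\pi'_1(x,y,y,x)}=\nu'(p'),\qquad \frac{R'(x,y,y,Jx)}{\pi'_1(x,y,y,x)}=\tilde\nu'(p'),\qquad \pi_1'(x,y,z,u)=g'(y,z)g'(x,u)-g'(x,z)g'(y,u).$$ Let $M$ be a real time-like hypersurface of $M'$, i.e. a hypersurface with unit normal field $N$, $g'(N,N)=-1$, equipped with $t=\arctan g'(N,JN)\in(-\frac\pi2,\frac\pi2)$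 and the almost contact structure with Norden metric $$\varphi=J+\cos t\,g'(\cdot,JN)\{\cos t\,N-\sin t\,JN\},\quad \xi=\sin t\,N+\cos t\,JN,\quad \eta=\cos t\,g'(\cdot,JN),\quad g=g'|_M .$$ Let $\nabla$ be the Levi-Civita connection of $g$, $F(x,y,z)=g((\nabla_x\varphi)y,z)$, $\theta(z)=g^{ij}F(e_i,e_j,z)$ and $\theta^*(z)=g^{ij}F(e_i,\varphi e_j,z)$, where $e_1,\dots,e_{2n}$ is a basis of $\ker\eta$ and $(g^{ij})$ is the inverse of $(g(e_i,e_j))$. Suppose that $M$ is an $(\mathcal F_4^0\oplus\mathcal F_5^0)$-manifold, i.e. the 1-forms $\theta,\theta^*$ are closed and $$F(x,y,z)=-\tfrac{\theta(\xi)}{2n}\{g(\varphi x,\varphi y)\eta(z)+g(\varphi x,\varphi z)\eta(y)\}-\tfrac{\theta^*(\xi)}{2n}\{g(x,\varphi y)\eta(z)+g(x,\varphi z)\eta(y)\}.$$ Let $K(x,y,z,u)$ be the canonical curvature tensor of $M$, i.e. the curvature tensor, with index lowered by $g$, of the canonical connection $$D_XY=\nabla_XY+\tfrac12\{(\nabla_X\varphi)\varphi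 Y+(\nabla_X\eta)Y\cdot\xi\}-\eta(Y)\nabla_X\xi .$$ Put $$\begin{aligned} \pi_1(x,y,z,u)&=g(y,z)g(x,u)-g(x,z)g(y,u),\\ \pi_2(x,y,z,u)&=g(y,\varphi z)g(x,\varphi u)-g(x,\varphi z)g(y,\varphi u),\\ \pi_3(x,y,z,u)&=-g(y,z)g(x,\varphi u)+g(x,z)g(y,\varphi u)-g(y,\varphi z)g(x,u)+g(x,\varphi z)g(y,u),\\ \pi_4(x,y,z,u)&=\eta(y)\eta(z)g(x,u)-\eta(x)\eta(z)g(y,u)+\eta(x)\eta(u)g(y,z)-\eta(y)\eta(u)g(x,z),\\ \pi_5(x,y,z,u)&=\eta(y)\eta(z)g(x,\varphi u)-\eta(x)\eta(z)g(y,\varphi u)+\eta(x)\eta(u)g(y,\varphi z)-\eta(y)\eta(u)g(x,\varphi z). \end{aligned}$$ Then, at every point of $M$ (with $\nu',\tilde\nu'$ restricted to $M$, and $\xi\theta(\xi)$, $\xi\theta^*(\xi)$ denoting the derivatives of the functions $\theta(\xi)$, $\theta^*(\xi)$ along $\xi$), $$\begin{aligned} K={}&\Big(\nu'+\frac{\theta^*(\xi)^2}{4n^2}\Big)[\pi_1-\pi_2]+\Big(\tilde\nu'-\frac{\theta(\xi)\theta^*(\xi)}{4n^2}\Big)\pi_3\\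 &-\Big(\tilde\nu'\tan t+\frac{dt(\xi)\theta(\xi)}{4n}+\frac{dt(\xi)\theta^*(\xi)}{4n}\tan t-\frac{\xi\theta^*(\xi)}{2n}+\frac{\theta(\xi)^2}{4n^2}\Big)\pi_4\\ &-\Big(\nu'\tan t+\frac{dt(\xi)\theta(\xi)}{4n}\tan t-\frac{dt(\xi)\theta^*(\xi)}{4n}-\frac{\xi\theta(\xi)}{2n}-\frac{\theta(\xi)\theta^*(\xi)}{4n^2}\Big)\pi_5\\ &-\frac{(\theta(\xi)\cos t+\theta^*(\xi)\sin t)^2}{4n^2}[\pi_1-\pi_2-\pi_4]\\ &+\frac{(\theta(\xi)\sin t-\theta^*(\xi)\cos t)(\theta(\xi)\cos t+\theta^*(\xi)\sin t)}{4n^2}[\pi_3+\pi_5]. \end{aligned}$$ -/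

import Mathlib

open scoped Manifold ContDiff Bundle

noncomputable section

namespace NordenGeometry

section Fields

variable (E : Type*) [NormedAddCommGroup E] [NormedSpace ℝ E]
  (M : Type*) [TopologicalSpace M] [ChartedSpace E M]

/-- Vector fields on `M` (no regularity built in). -/
abbrev VField : Type _ := Π p : M, TangentSpace 𝓘(ℝ, E) p

/-- Fields of endomorphisms of the tangent spaces, i.e. tensor fields of type (1,1). -/
abbrev EndField : Type _ :=
  Π p : M, TangentSpace 𝓘(ℝ, E) p →L[ℝ] TangentSpace 𝓘(ℝ, E) p

/-- Fields of covectors, i.e. 1-forms. -/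
abbrev CovField : Type _ := Π p : M, TangentSpace 𝓘(ℝ, E) p →L[ℝ] ℝ

/-- Fields of bilinear forms on the tangent spaces, i.e. tensor fields of type (0,2). -/
abbrev BilinField : Type _ :=
  Π p : M, TangentSpace 𝓘(ℝ, E) p →L[ℝ] TangentSpace 𝓘(ℝ, E) p →L[ℝ] ℝ

end Fields

section PseudoRiemannian

variable {E : Type*} [NormedAddCommGroup E] [NormedSpace ℝ E]
  {M : Type*} [TopologicalSpace M] [ChartedSpace E M] [IsManifold 𝓘(ℝ, E) ∞ M]

/-- The field of bilinear forms `g` is a smooth pseudo-Riemannian metric: symmetric, nondegenerate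
and smooth as a section of the bundle of bilinear forms. -/
structure IsPseudoRiemannianMetric (g : BilinField E M) : Prop where
  symm : ∀ p x y, g p x y = g p y x
  nondegenerate : ∀ p x, (∀ y, g p x y = 0) → x = 0
  smooth : ContMDiff 𝓘(ℝ, E) (𝓘(ℝ, E).prod 𝓘(ℝ, E →L[ℝ] E →L[ℝ] ℝ)) ∞
    (fun p ↦ Bundle.TotalSpace.mk' (E →L[ℝ] E →L[ℝ] ℝ)
      (E := fun p : M ↦ TangentSpace 𝓘(ℝ, E) p →L[ℝ] TangentSpace 𝓘(ℝ, E) p →L[ℝ] ℝ) p (g p))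

/-- The field of endomorphisms `J` is smooth, as a section of the endomorphism bundle. -/
def IsSmoothEndField (J : EndField E M) : Prop :=
  ContMDiff 𝓘(ℝ, E) (𝓘(ℝ, E).prod 𝓘(ℝ, E →L[ℝ] E)) ∞
    (fun p ↦ Bundle.TotalSpace.mk' (E →L[ℝ] E)
      (E := fun p : M ↦ TangentSpace 𝓘(ℝ, E) p →L[ℝ] TangentSpace 𝓘(ℝ, E) p) p (J p))

/-- The vector field `X` is smooth near `p`. -/
def SmoothVFieldAt (X : VField E M) (p : M) : Prop :=
  ContMDiffAt 𝓘(ℝ, E) (𝓘(ℝ, E).prod 𝓘(ℝ, E)) ∞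
    (fun q ↦ Bundle.TotalSpace.mk' E (E := fun q : M ↦ TangentSpace 𝓘(ℝ, E) q) q (X q)) p

/-- The derivative `X(f)(p)` of the function `f` along the vector field `X`. -/
def lieD (X : VField E M) (f : M → ℝ) (p : M) : ℝ := mvfderiv 𝓘(ℝ, E) f p (X p)

/-- The Lie bracket `[X, Y]`. -/
def bracket (X Y : VField E M) : VField E M := VectorField.mlieBracket 𝓘(ℝ, E) X Y

/-- A local vector field extending the tangent vector `x` (smooth near `p`). -/
def ext {p : M} (x : TangentSpace 𝓘(ℝ, E) p) : VField E M := FiberBundle.extend E x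

/-- The right-hand side of the Koszul formula for `2 g(∇_X Y, Z)`. -/
def koszul (g : BilinField E M) (X Y Z : VField E M) (p : M) : ℝ :=
  lieD X (fun q ↦ g q (Y q) (Z q)) p + lieD Y (fun q ↦ g q (X q) (Z q)) p
    - lieD Z (fun q ↦ g q (X q) (Y q)) p
    + g p (bracket X Y p) (Z p) - g p (bracket X Z p) (Y p) - g p (bracket Y Z p) (X p)

/-- The Levi-Civita connection of `g`: `(∇_X Y)(p)` is the vector `w` with
`2 g(w, z) = koszul(X, Y, Z)(p)` for all `z` in the tangent space at `p`, where `Z` extends `z`.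
It exists (the Koszul expression is tensorial in `Z`) and is unique, `g` being nondegenerate. -/
def leviCivita (g : BilinField E M) (X Y : VField E M) : VField E M := fun p ↦
  Classical.epsilon fun w : TangentSpace 𝓘(ℝ, E) p ↦
    ∀ z : TangentSpace 𝓘(ℝ, E) p, 2 * g p w z = koszul g X Y (ext z) p

/-- `(∇_X φ) Y = ∇_X (φ Y) - φ (∇_X Y)` for a (1,1)-tensor field `φ`, with `∇` the Levi-Civita
connection of `g`. -/
def nablaEnd (g : BilinField E M) (φ : Π p : M, TangentSpace 𝓘(ℝ, E) p → TangentSpace 𝓘(ℝ, E) p)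
    (X Y : VField E M) : VField E M := fun p ↦
  leviCivita g X (fun q ↦ φ q (Y q)) p - φ p (leviCivita g X Y p)

/-- `(∇_X η) Y = X(η(Y)) - η(∇_X Y)` for a 1-form `η`. -/
def nablaForm (g : BilinField E M) (η : CovField E M) (X Y : VField E M) (p : M) : ℝ :=
  lieD X (fun q ↦ η q (Y q)) p - η p (leviCivita g X Y p)

/-- The tensor `F(x, y, z) = g((∇_x φ) y, z)`. -/
def tensorF (g : BilinField E M)
    (φ : Π p : M, TangentSpace 𝓘(ℝ, E) p → TangentSpace 𝓘(ℝ, E) p)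
    (p : M) (x y z : TangentSpace 𝓘(ℝ, E) p) : ℝ :=
  g p (nablaEnd g φ (ext x) (ext y) p) z

/-- The (0,4)-curvature tensor of a linear connection `D` (given as `D X Y = D_X Y`), the index
being lowered by `g`: `g(D_X D_Y Z - D_Y D_X Z - D_[X,Y] Z, u)`, for local extensions
`X, Y, Z` of the vectors `x, y, z`. -/
def curvature (g : BilinField E M) (D : VField E M → VField E M → VField E M)
    (p : M) (x y z u : TangentSpace 𝓘(ℝ, E) p) : ℝ :=
  g p (D (ext x) (D (ext y) (ext z)) p - D (ext y) (D (ext x) (ext z)) p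
    - D (bracket (ext x) (ext y)) (ext z) p) u

/-- The 1-form `α` is closed: `dα(X, Y) = X(α(Y)) - Y(α(X)) - α([X, Y])` vanishes at every point,
for all vector fields smooth near that point. -/
def IsClosedForm (α : Π p : M, TangentSpace 𝓘(ℝ, E) p → ℝ) : Prop :=
  ∀ (p : M) (X Y : VField E M), SmoothVFieldAt X p → SmoothVFieldAt Y p →
    lieD X (fun q ↦ α q (Y q)) p - lieD Y (fun q ↦ α q (X q)) p - α p (bracket X Y p) = 0

/-- `π₁(x, y, z, u) = g(y, z) g(x, u) - g(x, z) g(y, u)`. -/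
def pi1 (g : BilinField E M) (p : M) (x y z u : TangentSpace 𝓘(ℝ, E) p) : ℝ :=
  g p y z * g p x u - g p x z * g p y u

end PseudoRiemannian

section Kaehler

variable {E : Type*} [NormedAddCommGroup E] [NormedSpace ℝ E]
  {M : Type*} [TopologicalSpace M] [ChartedSpace E M] [IsManifold 𝓘(ℝ, E) ∞ M]

/-- `(M, J, g)` is a Kähler manifold with Norden metric: `J` is an almost complex structure,
`g(JX, JY) = - g(X, Y)`, and `J` is parallel for the Levi-Civita connection of `g`. -/
structure IsKaehlerNorden (J : EndField E M) (g : BilinField E M) :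
    Prop where
  metric : IsPseudoRiemannianMetric g
  smooth : IsSmoothEndField J
  sq : ∀ p x, J p (J p x) = -x
  norden : ∀ p x y, g p (J p x) (J p y) = - g p x y
  parallel : ∀ p x y z, tensorF g (fun q v ↦ J q v) p x y z = 0

/-- The plane spanned by `x, y` is totally real: `Jα ⊥ α`. -/
def IsTotallyReal (J : EndField E M) (g : BilinField E M) (p : M)
    (x y : TangentSpace 𝓘(ℝ, E) p) : Prop :=
  ∀ v ∈ Submodule.span ℝ {x, y}, ∀ w ∈ Submodule.span ℝ {x, y}, g p (J p v) w = 0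

/-- `(M, J, g)` is of constant totally real sectional curvatures `ν` and `ν'` (functions on `M`):
for each nondegenerate totally real plane with basis `x, y` at each point `p`, the sectional
curvature `R(x,y,y,x)/π₁(x,y,y,x)` is `ν p` and the associated sectional curvature
`R(x,y,y,Jx)/π₁(x,y,y,x)` is `ν' p`. (The plane is nondegenerate with basis `x, y` exactly when
`π₁(x,y,y,x) ≠ 0`.) -/
def HasConstTotallyRealCurvatures (J : EndField E M) (g : BilinField E M) (ν ν' : M → ℝ) : Prop :=
  ∀ (p : M) (x y : TangentSpace 𝓘(ℝ, E) p), pi1 g p x y y x ≠ 0 → IsTotallyReal J g p x y →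
    curvature g (leviCivita g) p x y y x / pi1 g p x y y x = ν p ∧
    curvature g (leviCivita g) p x y y (J p x) / pi1 g p x y y x = ν' p

end Kaehler

section AlmostContact

/-- The structural tensors `(φ, ξ, η, g)` of an almost contact manifold with Norden metric.
This only bundles the data; below it is used for the structure induced on a hypersurface. -/
structure ContactNordenData (E : Type*) [NormedAddCommGroup E] [NormedSpace ℝ E]
    (M : Type*) [TopologicalSpace M] [ChartedSpace E M] where
  φ : Π p : M, TangentSpace 𝓘(ℝ, E) p → TangentSpace 𝓘(ℝ, E) p
  ξ : VField E M
  η : CovField E M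
  g : BilinField E M

namespace ContactNordenData

variable {E : Type*} [NormedAddCommGroup E] [NormedSpace ℝ E]
  {M : Type*} [TopologicalSpace M] [ChartedSpace E M] [IsManifold 𝓘(ℝ, E) ∞ M] (S : ContactNordenData E M)

/-- `F(x, y, z) = g((∇_x φ) y, z)`. -/
def F (p : M) (x y z : TangentSpace 𝓘(ℝ, E) p) : ℝ := tensorF S.g S.φ p x y z

/-- The trace `g^{ij} B(e_i, e_j)` over a basis `e_1, …, e_{2n}` of `ker η` (the orthogonal
complement of `ξ`), where `(g^{ij})` is the inverse of the matrix `(g(e_i, e_j))`. -/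
def hTrace [FiniteDimensional ℝ E] (p : M)
    (B : TangentSpace 𝓘(ℝ, E) p → TangentSpace 𝓘(ℝ, E) p → ℝ) : ℝ :=
  haveI : FiniteDimensional ℝ (TangentSpace 𝓘(ℝ, E) p) := inferInstanceAs (FiniteDimensional ℝ E)
  let e := Module.finBasis ℝ (LinearMap.ker (S.η p : TangentSpace 𝓘(ℝ, E) p →ₗ[ℝ] ℝ))
  ∑ i, ∑ j, (Matrix.of fun k l ↦ S.g p (e k : TangentSpace 𝓘(ℝ, E) p) (e l))⁻¹ i j * B (e i) (e j)

/-- `θ(z) = g^{ij} F(e_i, e_j, z)`. -/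
def θ [FiniteDimensional ℝ E] (p : M) (z : TangentSpace 𝓘(ℝ, E) p) : ℝ :=
  S.hTrace p fun x y ↦ S.F p x y z

/-- `θ*(z) = g^{ij} F(e_i, φ e_j, z)`. -/
def θs [FiniteDimensional ℝ E] (p : M) (z : TangentSpace 𝓘(ℝ, E) p) : ℝ :=
  S.hTrace p fun x y ↦ S.F p x (S.φ p y) z

/-- The function `θ(ξ)`. -/
def θξ [FiniteDimensional ℝ E] (p : M) : ℝ := S.θ p (S.ξ p)

/-- The function `θ*(ξ)`. -/
def θsξ [FiniteDimensional ℝ E] (p : M) : ℝ := S.θs p (S.ξ p)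

/-- The class `𝓕₄ ⊕ 𝓕₅` in dimension `2n+1`: the tensor `F` is the sum of the expressions that
define `𝓕₄` and `𝓕₅`. -/
def IsF4F5 [FiniteDimensional ℝ E] (n : ℕ) : Prop :=
  ∀ (p : M) (x y z : TangentSpace 𝓘(ℝ, E) p),
    S.F p x y z =
      - (S.θξ p / (2 * n)) *
          (S.g p (S.φ p x) (S.φ p y) * S.η p z + S.g p (S.φ p x) (S.φ p z) * S.η p y)
      - (S.θsξ p / (2 * n)) *
          (S.g p x (S.φ p y) * S.η p z + S.g p x (S.φ p z) * S.η p y)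

/-- The class `𝓕₄⁰ ⊕ 𝓕₅⁰`: `𝓕₄ ⊕ 𝓕₅` with closed 1-forms `θ` and `θ*`. -/
structure IsF4F5Closed [FiniteDimensional ℝ E] (n : ℕ) : Prop where
  mem : S.IsF4F5 n
  closed_θ : IsClosedForm S.θ
  closed_θs : IsClosedForm S.θs

/-- The canonical connection
`D_X Y = ∇_X Y + ½ {(∇_X φ) φY + (∇_X η)(Y) ξ} - η(Y) ∇_X ξ`. -/
def canonicalConnection (X Y : VField E M) : VField E M := fun p ↦
  leviCivita S.g X Y p
    + (1 / 2 : ℝ) • (nablaEnd S.g S.φ X (fun q ↦ S.φ q (Y q)) p + nablaForm S.g S.η X Y p • S.ξ p)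
    - S.η p (Y p) • leviCivita S.g X S.ξ p

/-- The canonical curvature tensor `K`, i.e. the curvature tensor of the canonical connection. -/
def K (p : M) (x y z u : TangentSpace 𝓘(ℝ, E) p) : ℝ :=
  curvature S.g S.canonicalConnection p x y z u

variable (p : M) (x y z u : TangentSpace 𝓘(ℝ, E) p)

/-- The essential curvature-like tensor `π₁`. -/
def π₁ : ℝ := pi1 S.g p x y z u

/-- The essential curvature-like tensor `π₂`. -/
def π₂ : ℝ :=
  S.g p y (S.φ p z) * S.g p x (S.φ p u) - S.g p x (S.φ p z) * S.g p y (S.φ p u)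

/-- The essential curvature-like tensor `π₃`. -/
def π₃ : ℝ :=
  - S.g p y z * S.g p x (S.φ p u) + S.g p x z * S.g p y (S.φ p u)
    - S.g p y (S.φ p z) * S.g p x u + S.g p x (S.φ p z) * S.g p y u

/-- The essential curvature-like tensor `π₄`. -/
def π₄ : ℝ :=
  S.η p y * S.η p z * S.g p x u - S.η p x * S.η p z * S.g p y u
    + S.η p x * S.η p u * S.g p y z - S.η p y * S.η p u * S.g p x z

/-- The essential curvature-like tensor `π₅`. -/
def π₅ : ℝ :=
  S.η p y * S.η p z * S.g p x (S.φ p u) - S.η p x * S.η p z * S.g p y (S.φ p u)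
    + S.η p x * S.η p u * S.g p y (S.φ p z) - S.η p y * S.η p u * S.g p x (S.φ p z)

end ContactNordenData

end AlmostContact

section Hypersurface

variable {E E' : Type*} [NormedAddCommGroup E] [NormedSpace ℝ E]
  [NormedAddCommGroup E'] [NormedSpace ℝ E']
  {M M' : Type*} [TopologicalSpace M] [ChartedSpace E M]
  [TopologicalSpace M'] [ChartedSpace E' M'] [IsManifold 𝓘(ℝ, E') ∞ M']

/-- The differential of `f` at `p`. -/
abbrev df (f : M → M') (p : M) :
    TangentSpace 𝓘(ℝ, E) p →L[ℝ] TangentSpace 𝓘(ℝ, E') (f p) :=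
  mfderiv 𝓘(ℝ, E) 𝓘(ℝ, E') f p

/-- `f : M → M'` is a smooth immersed submanifold of `(M', g')` with a smooth time-like unit normal
field `N` along `f`: `g'(N, N) = -1`. -/
structure IsTimelikeHypersurface (g' : BilinField E' M') (f : M → M')
    (N : Π p : M, TangentSpace 𝓘(ℝ, E') (f p)) : Prop where
  smooth : ContMDiff 𝓘(ℝ, E) 𝓘(ℝ, E') ∞ f
  immersion : ∀ p, Function.Injective (df (E := E) (E' := E') f p)
  smooth_normal : ContMDiff 𝓘(ℝ, E) (𝓘(ℝ, E').prod 𝓘(ℝ, E')) ∞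
    (fun p ↦ Bundle.TotalSpace.mk' E' (E := fun q : M' ↦ TangentSpace 𝓘(ℝ, E') q) (f p) (N p))
  normal : ∀ p (x : TangentSpace 𝓘(ℝ, E) p), g' (f p) (N p) (df f p x) = 0
  timelike : ∀ p, g' (f p) (N p) (N p) = -1

/-- The vector tangent to `M` at `p` whose image under the differential of `f` is `w`
(unique for an immersion; used only for `w` in the image). -/
def tangentOf (f : M → M') (p : M) (w : TangentSpace 𝓘(ℝ, E') (f p)) : TangentSpace 𝓘(ℝ, E) p :=
  Classical.epsilon fun x ↦ df f p x = w

/-- The function `t = arctan g'(N, JN)`. -/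
def angle (J : EndField E' M') (g' : BilinField E' M') (f : M → M')
    (N : Π p : M, TangentSpace 𝓘(ℝ, E') (f p)) (p : M) : ℝ :=
  Real.arctan (g' (f p) (N p) (J (f p) (N p)))

/-- The almost contact structure with Norden metric on a real time-like hypersurface:
`φ = J + cos t g'(·, JN) {cos t N - sin t JN}`, `ξ = sin t N + cos t JN`,
`η = cos t g'(·, JN)`, and `g` is the restriction of `g'`. -/
def hypersurfaceStructure (J : EndField E' M') (g' : BilinField E' M') (f : M → M')
    (N : Π p : M, TangentSpace 𝓘(ℝ, E') (f p)) : ContactNordenData E M where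
  φ p x := tangentOf f p
    (J (f p) (df f p x)
      + (Real.cos (angle J g' f N p) * g' (f p) (df f p x) (J (f p) (N p))) •
        (Real.cos (angle J g' f N p) • N p - Real.sin (angle J g' f N p) • J (f p) (N p)))
  ξ p := tangentOf f p
    (Real.sin (angle J g' f N p) • N p + Real.cos (angle J g' f N p) • J (f p) (N p))
  η p := show E →L[ℝ] ℝ from Real.cos (angle J g' f N p) •
    ContinuousLinearMap.comp
      (ContinuousLinearMap.flip (show E' →L[ℝ] E' →L[ℝ] ℝ from g' (f p)) (J (f p) (N p)))
      (show E →L[ℝ] E' from df f p)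
  g p := show E →L[ℝ] E →L[ℝ] ℝ from
    ContinuousLinearMap.bilinearComp (show E' →L[ℝ] E' →L[ℝ] ℝ from g' (f p))
      (show E →L[ℝ] E' from df f p) (show E →L[ℝ] E' from df f p)

end Hypersurface

end NordenGeometry

end

open NordenGeometry

/-!
The statement is local, and everything in it is determined by the metric and the structural
tensors near the base point. The charts at `p` and at `f p` therefore replace `M` by an immersed
hypersurface of an open set of `E'` (`LocalHypersurface`, `IsTimelikeHypersurface.toLocal`), where
covariant derivatives are `cov (christoffel g)` (`vfieldChart_leviCivita`), and curvature is the
commutator of covariant derivatives in constant directions (`ricci_identity`,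
`curvature_eq_of_chart`).

*Ambient curvature.* On a Kähler manifold with Norden metric, `g'` and the curvature tensor are
real parts of a complex bilinear form and of a complex multilinear curvature tensor. A totally
real orthonormal pair is an orthonormal pair of the complex form, and the two totally real
sectional curvatures are, up to sign, the real and imaginary parts of the complex sectional
curvature. As for real space forms, a complex curvature tensor with vanishing
sectional curvatures is zero (`IsKaehlerCurvature.eq_zero`), hence `R' = ν (π₁ - π₂) + ν' π₃`,
with the tensors `πᵢ` formed
from `g'` and `J` (`curv_eq_of_const_totallyReal`).

*Second fundamental form.* Put `a = θ(ξ) / 2n`, `b = θ*(ξ) / 2n` and let `h = -φ²` be the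
projection to `ker η`. In the class `𝓕₄ ⊕ 𝓕₅` one has `∇ξ = a φ + b h` (`cov_ξ`). Differentiating
`ξ = sin t N + cos t JN` expresses `dt` and `∇ξ` through the shape operator `A`
(`deriv_t_and_cov_ξ`), and solving for `A` gives `A = α h + β φ + k η ⊗ ξ` with
`α = -(a cos t + b sin t)`, `β = b cos t - a sin t` and `dt(ξ) = -2 k cos t` (`A_eq`). The Gauss
equation then yields the curvature `R` of `M`.

*Canonical curvature.* In the class `𝓕₄ ⊕ 𝓕₅` the canonical connection is
`∇_X Y + g(∇_X ξ, Y) ξ - η(Y) ∇_X ξ`, and its curvature is the horizontal part of `R` plus a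
quadratic term in `∇ξ` (`g_can_can`). The result is a formula in `ν`, `ν'`, `a`, `b`, `t` alone.
The derivatives of `a` and `b` along `ξ` enter through `R(x, ξ) ξ`, computed once from
`∇ξ = a φ + b h` (`curv_ξ_ξ`) and once from the Gauss equation; the comparison turns
the formula into the asserted one (`canonical_curvature`).
-/

noncomputable section

set_option maxSynthPendingDepth 3

namespace NordenGeometry

/-! ### Connections on an open set of a vector space -/

section Connections

lemma two_le_infty : (2 : WithTop ℕ∞) ≤ ∞ :=
  WithTop.coe_le_coe.2 (le_top : (2 : ℕ∞) ≤ ⊤)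

variable {E F : Type*} [NormedAddCommGroup E] [NormedSpace ℝ E]
  [NormedAddCommGroup F] [NormedSpace ℝ F]

/-- The covariant derivative at `v` in direction `x` of the section `W` of the trivial bundle with
fibre `F` over `E`, for the linear connection with connection form `P`. -/
def cov (P : E → E →L[ℝ] F →L[ℝ] F) (W : E → F) (v x : E) : F :=
  fderiv ℝ W v x + P v x (W v)

/-- The curvature `dP + P ∧ P` of the linear connection with connection form `P`. -/
def curv (P : E → E →L[ℝ] F →L[ℝ] F) (v x y : E) (w : F) : F :=
  fderiv ℝ P v x y w - fderiv ℝ P v y x w + P v x (P v y w) - P v y (P v x w)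

lemma differentiableAt_fderiv_apply {W : E → F} {v : E} (hW : ContDiffAt ℝ ∞ W v)
    (x : E) : DifferentiableAt ℝ (fun v ↦ fderiv ℝ W v x) v := by
  have h1 : ContDiffAt ℝ ∞ (fderiv ℝ W) v := hW.fderiv_right (by simp)
  exact (h1.clm_apply contDiffAt_const).differentiableAt (by simp)

lemma fderiv_apply_fderiv {W : E → F} {v : E} (hW : ContDiffAt ℝ ∞ W v)
    (x y : E) : fderiv ℝ (fun v ↦ fderiv ℝ W v y) v x = fderiv ℝ (fderiv ℝ W) v x y := by
  have h1 : ContDiffAt ℝ ∞ (fderiv ℝ W) v := hW.fderiv_right (by simp)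
  rw [fderiv_clm_apply (h1.differentiableAt (by simp)) (by fun_prop)]
  simp

lemma fderiv_apply_symm {W : E → F} {v : E} (hW : ContDiffAt ℝ ∞ W v)
    (x y : E) : fderiv ℝ (fun v ↦ fderiv ℝ W v y) v x = fderiv ℝ (fun v ↦ fderiv ℝ W v x) v y := by
  rw [fderiv_apply_fderiv hW, fderiv_apply_fderiv hW]
  exact (hW.isSymmSndFDerivAt (by simpa using two_le_infty)).eq x y

lemma contDiffAt_cov {P : E → E →L[ℝ] F →L[ℝ] F} {W : E → F} {v : E} (hP : ContDiffAt ℝ ∞ P v)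
    (hW : ContDiffAt ℝ ∞ W v) (x : E) : ContDiffAt ℝ ∞ (fun v ↦ cov P W v x) v := by
  have h1 : ContDiffAt ℝ ∞ (fderiv ℝ W) v := hW.fderiv_right (by simp)
  unfold cov
  fun_prop

lemma fderiv_clm₂_apply {G : Type*} [NormedAddCommGroup G] [NormedSpace ℝ G]
    {H : Type*} [NormedAddCommGroup H] [NormedSpace ℝ H]
    {P : E → F →L[ℝ] G →L[ℝ] H} {V : E → F} {W : E → G} {v : E}
    (hP : DifferentiableAt ℝ P v) (hV : DifferentiableAt ℝ V v) (hW : DifferentiableAt ℝ W v)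
    (x : E) : fderiv ℝ (fun v ↦ P v (V v) (W v)) v x
      = fderiv ℝ P v x (V v) (W v) + P v (fderiv ℝ V v x) (W v) + P v (V v) (fderiv ℝ W v x) := by
  rw [fderiv_clm_apply (hP.clm_apply hV) hW, fderiv_clm_apply hP hV]
  simp
  abel

/-- Ricci identity: the commutator of covariant derivatives in constant directions is the
curvature. -/
lemma ricci_identity {P : E → E →L[ℝ] F →L[ℝ] F} {W : E → F} {v : E} (hP : ContDiffAt ℝ ∞ P v)
    (hW : ContDiffAt ℝ ∞ W v) (x y : E) :
    cov P (fun v ↦ cov P W v y) v x - cov P (fun v ↦ cov P W v x) v y = curv P v x y (W v) := by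
  have hP' : DifferentiableAt ℝ P v := hP.differentiableAt (by simp)
  have hW' : DifferentiableAt ℝ W v := hW.differentiableAt (by simp)
  have key : ∀ x y, cov P (fun v ↦ cov P W v y) v x
      = fderiv ℝ (fun v ↦ fderiv ℝ W v y) v x + fderiv ℝ P v x y (W v) + P v y (fderiv ℝ W v x)
        + P v x (fderiv ℝ W v y) + P v x (P v y (W v)) := by
    intro x y
    unfold cov
    rw [fderiv_fun_add (differentiableAt_fderiv_apply hW y) (by fun_prop)]
    rw [add_apply, fderiv_clm₂_apply hP' (by fun_prop) hW']
    simp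
    abel
  rw [key, key, fderiv_apply_symm hW x y, curv]
  abel

/-- The connection form of the pullback along `f` of the connection with form `Γ`. -/
def pullForm (Γ : F → F →L[ℝ] F →L[ℝ] F) (f : E → F) (v : E) : E →L[ℝ] F →L[ℝ] F :=
  (Γ (f v)).comp (fderiv ℝ f v)

lemma contDiffAt_pullForm {Γ : F → F →L[ℝ] F →L[ℝ] F} {f : E → F} {v : E}
    (hΓ : ContDiffAt ℝ ∞ Γ (f v)) (hf : ContDiffAt ℝ ∞ f v) :
    ContDiffAt ℝ ∞ (pullForm Γ f) v := by
  have h1 : ContDiffAt ℝ ∞ (fderiv ℝ f) v := hf.fderiv_right (by simp)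
  exact (hΓ.comp v hf).clm_comp h1

lemma curv_pullForm {Γ : F → F →L[ℝ] F →L[ℝ] F} {f : E → F} {v : E}
    (hΓ : ContDiffAt ℝ ∞ Γ (f v)) (hf : ContDiffAt ℝ ∞ f v) (x y : E) (w : F) :
    curv (pullForm Γ f) v x y w = curv Γ (f v) (fderiv ℝ f v x) (fderiv ℝ f v y) w := by
  have h1 : ContDiffAt ℝ ∞ (fderiv ℝ f) v := hf.fderiv_right (by simp)
  have h2 : DifferentiableAt ℝ (fun v ↦ Γ (f v)) v := (hΓ.comp v hf).differentiableAt (by simp)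
  have key : ∀ x y, fderiv ℝ (pullForm Γ f) v x y w
      = fderiv ℝ Γ (f v) (fderiv ℝ f v x) (fderiv ℝ f v y) w
        + Γ (f v) (fderiv ℝ (fderiv ℝ f) v x y) w := by
    intro x y
    have : pullForm Γ f = fun v ↦ (Γ (f v)).comp (fderiv ℝ f v) := rfl
    rw [this, fderiv_clm_comp h2 (h1.differentiableAt (by simp)),
      fderiv_fun_comp v (hΓ.differentiableAt (by simp)) (hf.differentiableAt (by simp))]
    simp
    abel
  have hs : fderiv ℝ (fderiv ℝ f) v x y = fderiv ℝ (fderiv ℝ f) v y x :=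
    (hf.isSymmSndFDerivAt (by simpa using two_le_infty)).eq x y
  simp only [curv, key, hs, pullForm, ContinuousLinearMap.comp_apply]
  abel

end Connections

/-! ### The Christoffel map of a metric -/

section Christoffel

variable {E : Type*} [NormedAddCommGroup E] [NormedSpace ℝ E]

/-- A nondegenerate bilinear form on a finite-dimensional space identifies it with its dual. -/
lemma isInvertible_of_nondegenerate [FiniteDimensional ℝ E] (B : E →L[ℝ] E →L[ℝ] ℝ)
    (hB : ∀ x, (∀ y, B x y = 0) → x = 0) : B.IsInvertible := by
  have hinj : Function.Injective (B : E →ₗ[ℝ] (E →L[ℝ] ℝ)) := by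
    rw [injective_iff_map_eq_zero]
    intro x hx
    exact hB x fun y ↦ by
      have := congrArg (fun l : E →L[ℝ] ℝ ↦ l y) hx
      simpa using this
  have hfr : Module.finrank ℝ E = Module.finrank ℝ (E →L[ℝ] ℝ) := by
    rw [← (LinearMap.toContinuousLinearMap (𝕜 := ℝ) (E := E) (F' := ℝ)).finrank_eq]
    exact (Subspace.dual_finrank_eq).symm
  let e : E ≃ₗ[ℝ] (E →L[ℝ] ℝ) :=
    LinearEquiv.ofInjectiveOfFinrankEq (B : E →ₗ[ℝ] (E →L[ℝ] ℝ)) hinj hfr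
  exact ⟨e.toContinuousLinearEquiv, by ext; rfl⟩

/-- Twice the Christoffel symbols of the first kind: the trilinear form
`D g(x)(y, z) + D g(y)(x, z) - D g(z)(x, y)`. -/
def christoffelLower (g : E → E →L[ℝ] E →L[ℝ] ℝ) (v : E) : E →L[ℝ] E →L[ℝ] E →L[ℝ] ℝ :=
  fderiv ℝ g v + (fderiv ℝ g v).flip
    - ((ContinuousLinearMap.flipₗᵢ ℝ E E ℝ).toContinuousLinearEquiv :
        (E →L[ℝ] E →L[ℝ] ℝ) →L[ℝ] (E →L[ℝ] E →L[ℝ] ℝ)).comp (fderiv ℝ g v).flip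

lemma christoffelLower_apply (g : E → E →L[ℝ] E →L[ℝ] ℝ) (v x y z : E) :
    christoffelLower g v x y z
      = fderiv ℝ g v x y z + fderiv ℝ g v y x z - fderiv ℝ g v z x y := rfl

/-- The Christoffel symbols of the metric `g` on an open subset of a vector space, i.e. the
connection form of its Levi-Civita connection. It is zero where `g` is degenerate. -/
def christoffel (g : E → E →L[ℝ] E →L[ℝ] ℝ) (v : E) : E →L[ℝ] E →L[ℝ] E :=
  (ContinuousLinearMap.compL ℝ E (E →L[ℝ] ℝ) E ((1 / 2 : ℝ) • (g v).inverse)).comp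
    (christoffelLower g v)

lemma christoffel_spec {g : E → E →L[ℝ] E →L[ℝ] ℝ} {v : E} (hg : (g v).IsInvertible)
    (x y z : E) : 2 * g v (christoffel g v x y) z
      = fderiv ℝ g v x y z + fderiv ℝ g v y x z - fderiv ℝ g v z x y := by
  rw [← christoffelLower_apply]
  have : christoffel g v x y = (1 / 2 : ℝ) • (g v).inverse (christoffelLower g v x y) := rfl
  rw [this, map_smul, ContinuousLinearMap.IsInvertible.self_apply_inverse hg]
  simp

lemma contDiffAt_christoffel [CompleteSpace E] {g : E → E →L[ℝ] E →L[ℝ] ℝ} {v : E}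
    (hg : ContDiffAt ℝ ∞ g v)
    (hi : (g v).IsInvertible) : ContDiffAt ℝ ∞ (christoffel g) v := by
  have h1 : ContDiffAt ℝ ∞ (fderiv ℝ g) v := hg.fderiv_right (by simp)
  have h2 : ContDiffAt ℝ ∞ (fun v ↦ (g v).inverse) v := by
    obtain ⟨e, he⟩ := hi
    have := contDiffAt_map_inverse (n := ∞) (𝕜 := ℝ) e
    rw [he] at this
    exact this.comp v hg
  have h3 : ContDiffAt ℝ ∞ (fun v ↦ (fderiv ℝ g v).flip) v :=
    (ContinuousLinearMap.flipₗᵢ ℝ E E (E →L[ℝ] ℝ)).contDiff.contDiffAt.comp v h1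
  have h4 : ContDiffAt ℝ ∞ (christoffelLower g) v :=
    (h1.add h3).sub (contDiffAt_const.clm_comp h3)
  have h5 : ContDiffAt ℝ ∞ (fun v ↦ (1 / 2 : ℝ) • (g v).inverse) v :=
    (contDiffAt_const (c := (1 / 2 : ℝ))).smul h2
  have h6 : ContDiffAt ℝ ∞
      (fun v ↦ ContinuousLinearMap.compL ℝ E (E →L[ℝ] ℝ) E ((1 / 2 : ℝ) • (g v).inverse)) v :=
    (ContinuousLinearMap.contDiff _).contDiffAt.comp v h5
  exact h6.clm_comp h4

/-- Nondegeneracy in the form used to compare vectors. -/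
lemma eq_of_metric_eq {g : E →L[ℝ] E →L[ℝ] ℝ} (hg : ∀ x, (∀ y, g x y = 0) → x = 0) {a b : E}
    (h : ∀ z, g a z = g b z) : a = b := by
  rw [← sub_eq_zero]
  exact hg _ fun z ↦ by simp [h z]

lemma nondegenerate_of_isInvertible {g : E →L[ℝ] E →L[ℝ] ℝ} (hg : g.IsInvertible) (x : E)
    (hx : ∀ y, g x y = 0) : x = 0 := by
  obtain ⟨e, rfl⟩ := hg
  have : e x = 0 := by ext y; exact hx y
  simpa using this

lemma fderiv_metric_symm {g : E → E →L[ℝ] E →L[ℝ] ℝ} {v : E} (hg : DifferentiableAt ℝ g v)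
    (hs : ∀ᶠ w in nhds v, ∀ x y, g w x y = g w y x) (x y z : E) :
    fderiv ℝ g v x y z = fderiv ℝ g v x z y := by
  have h : ∀ y z, fderiv ℝ (fun w ↦ g w y z) v x = fderiv ℝ g v x y z := by
    intro y z
    rw [fderiv_clm₂_apply hg (by fun_prop) (by fun_prop)]
    simp
  rw [← h, ← h]
  congr 1
  apply Filter.EventuallyEq.fderiv_eq
  filter_upwards [hs] with w hw using hw y z

lemma christoffel_symm {g : E → E →L[ℝ] E →L[ℝ] ℝ} {v : E} (hg : DifferentiableAt ℝ g v)
    (hi : (g v).IsInvertible) (hs : ∀ᶠ w in nhds v, ∀ x y, g w x y = g w y x) (x y : E) :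
    christoffel g v x y = christoffel g v y x := by
  apply eq_of_metric_eq (nondegenerate_of_isInvertible hi)
  intro z
  have h1 := christoffel_spec hi x y z
  have h2 := christoffel_spec hi y x z
  have h3 := fderiv_metric_symm hg hs z x y
  linarith

lemma christoffel_compat {g : E → E →L[ℝ] E →L[ℝ] ℝ} {v : E} (hg : DifferentiableAt ℝ g v)
    (hi : (g v).IsInvertible) (hs : ∀ᶠ w in nhds v, ∀ x y, g w x y = g w y x) (x y z : E) :
    fderiv ℝ g v x y z = g v (christoffel g v x y) z + g v y (christoffel g v x z) := by
  have h1 := christoffel_spec hi x y z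
  have h2 := christoffel_spec hi x z y
  have h3 := fderiv_metric_symm hg hs x y z
  have h4 := fderiv_metric_symm hg hs y x z
  have h5 := fderiv_metric_symm hg hs z x y
  rw [hs.self_of_nhds y]
  linarith

/-- The Levi-Civita connection is determined by the Koszul formula: in a vector space the Koszul
expression of three vector fields is `2 g(∇_X Y, Z)`. -/
lemma koszul_vectorSpace {g : E → E →L[ℝ] E →L[ℝ] ℝ} {v : E} (hg : DifferentiableAt ℝ g v)
    (hi : (g v).IsInvertible) (hs : ∀ᶠ w in nhds v, ∀ x y, g w x y = g w y x)
    {X Y Z : E → E} (hX : DifferentiableAt ℝ X v) (hY : DifferentiableAt ℝ Y v)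
    (hZ : DifferentiableAt ℝ Z v) :
    fderiv ℝ (fun w ↦ g w (Y w) (Z w)) v (X v) + fderiv ℝ (fun w ↦ g w (X w) (Z w)) v (Y v)
      - fderiv ℝ (fun w ↦ g w (X w) (Y w)) v (Z v)
      + g v (VectorField.lieBracket ℝ X Y v) (Z v) - g v (VectorField.lieBracket ℝ X Z v) (Y v)
      - g v (VectorField.lieBracket ℝ Y Z v) (X v)
    = 2 * g v (cov (christoffel g) Y v (X v)) (Z v) := by
  rw [fderiv_clm₂_apply hg hY hZ, fderiv_clm₂_apply hg hX hZ, fderiv_clm₂_apply hg hX hY]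
  have h1 := christoffel_spec hi (X v) (Y v) (Z v)
  have hs' := hs.self_of_nhds
  simp only [VectorField.lieBracket, cov, map_add, map_sub, add_apply, sub_apply]
  rw [hs' (fderiv ℝ Z v (X v)), hs' (fderiv ℝ X v (Z v)), hs' (fderiv ℝ Z v (Y v)),
    hs' (fderiv ℝ Y v (Z v)) (X v)]
  linarith

end Christoffel

/-! ### Tensor fields and the Levi-Civita connection in a chart -/

section Charts

open Filter Topology Bundle

variable {E : Type*} [NormedAddCommGroup E] [NormedSpace ℝ E]
  {M : Type*} [TopologicalSpace M] [ChartedSpace E M] [IsManifold 𝓘(ℝ, E) ∞ M]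

/-- The tangent space at `q` read in the chart at `p₀`; zero if `q` is not in the chart domain. -/
def toChart (p₀ q : M) : TangentSpace 𝓘(ℝ, E) q →L[ℝ] E :=
  (trivializationAt E (TangentSpace 𝓘(ℝ, E)) p₀).continuousLinearMapAt ℝ q

/-- The tangent vector at `q` with given coordinates in the chart at `p₀`; zero if `q` is not in the
chart domain. -/
def ofChart (p₀ q : M) : E →L[ℝ] TangentSpace 𝓘(ℝ, E) q :=
  (trivializationAt E (TangentSpace 𝓘(ℝ, E)) p₀).symmL ℝ q

/-- The vector field `X` in the chart at `p₀`. -/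
def vfieldChart (p₀ : M) (X : VField E M) (v : E) : E :=
  toChart p₀ ((extChartAt 𝓘(ℝ, E) p₀).symm v) (X ((extChartAt 𝓘(ℝ, E) p₀).symm v))

/-- The field of bilinear forms `g` in the chart at `p₀`. -/
def bilinChart (p₀ : M) (g : BilinField E M) (v : E) : E →L[ℝ] E →L[ℝ] ℝ :=
  ContinuousLinearMap.bilinearComp
    (show E →L[ℝ] E →L[ℝ] ℝ from g ((extChartAt 𝓘(ℝ, E) p₀).symm v))
    (show E →L[ℝ] E from ofChart p₀ ((extChartAt 𝓘(ℝ, E) p₀).symm v))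
    (show E →L[ℝ] E from ofChart p₀ ((extChartAt 𝓘(ℝ, E) p₀).symm v))

omit [IsManifold 𝓘(ℝ, E) ∞ M] in
lemma target_mem_nhds (p₀ : M) {v : E} (hv : v ∈ (extChartAt 𝓘(ℝ, E) p₀).target) :
    (extChartAt 𝓘(ℝ, E) p₀).target ∈ 𝓝 v :=
  (isOpen_extChartAt_target p₀).mem_nhds hv

lemma mem_baseSet {p₀ q : M} (hq : q ∈ (extChartAt 𝓘(ℝ, E) p₀).source) :
    q ∈ (trivializationAt E (TangentSpace 𝓘(ℝ, E)) p₀).baseSet := by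
  rw [TangentBundle.trivializationAt_baseSet]
  rwa [extChartAt_source] at hq

lemma ofChart_toChart {p₀ q : M} (hq : q ∈ (extChartAt 𝓘(ℝ, E) p₀).source)
    (x : TangentSpace 𝓘(ℝ, E) q) : ofChart p₀ q (toChart p₀ q x) = x :=
  (trivializationAt E (TangentSpace 𝓘(ℝ, E)) p₀).symmL_continuousLinearMapAt (mem_baseSet hq) x

lemma toChart_ofChart {p₀ q : M} (hq : q ∈ (extChartAt 𝓘(ℝ, E) p₀).source)
    (x : E) : toChart p₀ q (ofChart p₀ q x) = x :=
  (trivializationAt E (TangentSpace 𝓘(ℝ, E)) p₀).continuousLinearMapAt_symmL (mem_baseSet hq) x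

lemma toChart_eq_mfderiv {p₀ q : M} (hq : q ∈ (extChartAt 𝓘(ℝ, E) p₀).source) :
    toChart p₀ q = mfderiv 𝓘(ℝ, E) 𝓘(ℝ, E) (extChartAt 𝓘(ℝ, E) p₀) q := by
  rw [extChartAt_source] at hq
  exact TangentBundle.continuousLinearMapAt_trivializationAt hq

lemma ofChart_eq_mfderiv {p₀ : M} {v : E} (hv : v ∈ (extChartAt 𝓘(ℝ, E) p₀).target) :
    ofChart (E := E) p₀ ((extChartAt 𝓘(ℝ, E) p₀).symm v)
      = mfderiv 𝓘(ℝ, E) 𝓘(ℝ, E) (extChartAt 𝓘(ℝ, E) p₀).symm v := by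
  have hq := (extChartAt 𝓘(ℝ, E) p₀).map_target hv
  rw [extChartAt_source] at hq
  have h := TangentBundle.symmL_trivializationAt (I := 𝓘(ℝ, E)) hq
  rw [modelWithCornersSelf_coe, Set.range_id, mfderivWithin_univ,
    (extChartAt 𝓘(ℝ, E) p₀).right_inv hv] at h
  exact h

lemma toChart_self (p₀ : M) (x : TangentSpace 𝓘(ℝ, E) p₀) : toChart p₀ p₀ x = x := by
  rw [toChart_eq_mfderiv (mem_extChartAt_source p₀), mfderiv_extChartAt_self]
  rfl

lemma vfieldChart_ext {p₀ : M} (x : TangentSpace 𝓘(ℝ, E) p₀) {v : E}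
    (hv : v ∈ (extChartAt 𝓘(ℝ, E) p₀).target) :
    vfieldChart p₀ (NordenGeometry.ext x) v = toChart p₀ p₀ x := by
  have hq := (extChartAt 𝓘(ℝ, E) p₀).map_target hv
  set e := trivializationAt E (TangentSpace 𝓘(ℝ, E)) p₀
  have h1 : (e ⟨p₀, x⟩).2 = toChart p₀ p₀ x := by
    simp only [toChart]
    rw [Bundle.Trivialization.continuousLinearMapAt_apply, Bundle.Trivialization.linearMapAt_apply,
      if_pos (mem_baseSet (mem_extChartAt_source p₀))]
  have h2 : (e ⟨(extChartAt 𝓘(ℝ, E) p₀).symm v,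
      e.symm ((extChartAt 𝓘(ℝ, E) p₀).symm v) (e ⟨p₀, x⟩).2⟩).2 = (e ⟨p₀, x⟩).2 := by
    rw [e.apply_mk_symm (mem_baseSet hq)]
  rw [← h1, ← h2, vfieldChart, toChart, Bundle.Trivialization.continuousLinearMapAt_apply,
    Bundle.Trivialization.linearMapAt_apply, if_pos (mem_baseSet hq)]
  rfl

lemma mdifferentiableAt_chart_iff {G : Type*} [NormedAddCommGroup G] [NormedSpace ℝ G]
    {p₀ : M} {h : M → G} {v : E} (hv : v ∈ (extChartAt 𝓘(ℝ, E) p₀).target) :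
    MDifferentiableAt 𝓘(ℝ, E) 𝓘(ℝ, G) h ((extChartAt 𝓘(ℝ, E) p₀).symm v)
      ↔ DifferentiableAt ℝ (fun w ↦ h ((extChartAt 𝓘(ℝ, E) p₀).symm w)) v := by
  have hq := (extChartAt 𝓘(ℝ, E) p₀).map_target hv
  have hs : MDifferentiableAt 𝓘(ℝ, E) 𝓘(ℝ, E) (extChartAt 𝓘(ℝ, E) p₀).symm v :=
    (mdifferentiableOn_extChartAt_symm v hv).mdifferentiableAt (target_mem_nhds p₀ hv)
  constructor
  · intro h1
    exact (h1.comp v hs).differentiableAt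
  · intro h1
    have h2 : MDifferentiableAt 𝓘(ℝ, E) 𝓘(ℝ, E) (extChartAt 𝓘(ℝ, E) p₀)
        ((extChartAt 𝓘(ℝ, E) p₀).symm v) :=
      mdifferentiableAt_extChartAt (by rwa [extChartAt_source] at hq)
    have h3 : MDifferentiableAt 𝓘(ℝ, E) 𝓘(ℝ, G) (fun w ↦ h ((extChartAt 𝓘(ℝ, E) p₀).symm w))
        ((extChartAt 𝓘(ℝ, E) p₀) ((extChartAt 𝓘(ℝ, E) p₀).symm v)) := by
      rw [(extChartAt 𝓘(ℝ, E) p₀).right_inv hv]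
      exact h1.mdifferentiableAt
    refine (h3.comp _ h2).congr_of_eventuallyEq ?_
    filter_upwards [(isOpen_extChartAt_source p₀).mem_nhds hq] with r hr
    change h r = h _
    rw [(extChartAt 𝓘(ℝ, E) p₀).left_inv hr]

lemma mdifferentiableAt_vfield_iff {p₀ : M} {X : VField E M} {v : E}
    (hv : v ∈ (extChartAt 𝓘(ℝ, E) p₀).target) :
    MDifferentiableAt 𝓘(ℝ, E) (𝓘(ℝ, E).prod 𝓘(ℝ, E))
      (fun q ↦ TotalSpace.mk' E (E := fun q : M ↦ TangentSpace 𝓘(ℝ, E) q) q (X q))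
      ((extChartAt 𝓘(ℝ, E) p₀).symm v) ↔ DifferentiableAt ℝ (vfieldChart p₀ X) v := by
  have hq := (extChartAt 𝓘(ℝ, E) p₀).map_target hv
  set e := trivializationAt E (TangentSpace 𝓘(ℝ, E)) p₀
  have h1 := e.mdifferentiableAt_section_iff 𝓘(ℝ, E) X (mem_baseSet hq)
  refine h1.trans ?_
  have h2 := mdifferentiableAt_chart_iff (h := fun q ↦ toChart p₀ q (X q)) hv
  refine Iff.trans ?_ h2
  apply Filter.EventuallyEq.mdifferentiableAt_iff
  filter_upwards [(isOpen_extChartAt_source p₀).mem_nhds hq] with r hr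
  simp only [toChart]
  rw [Bundle.Trivialization.continuousLinearMapAt_apply, Bundle.Trivialization.linearMapAt_apply,
      if_pos (mem_baseSet hr)]

lemma differentiableAt_vfieldChart_ext {p₀ : M} {v : E}
    (hv : v ∈ (extChartAt 𝓘(ℝ, E) p₀).target)
    (z : TangentSpace 𝓘(ℝ, E) ((extChartAt 𝓘(ℝ, E) p₀).symm v)) :
    DifferentiableAt ℝ (vfieldChart p₀ (NordenGeometry.ext z)) v := by
  rw [← mdifferentiableAt_vfield_iff hv]
  exact FiberBundle.mdifferentiableAt_extend 𝓘(ℝ, E) E z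

lemma lieD_eq_fderiv {p₀ : M} {v : E} (hv : v ∈ (extChartAt 𝓘(ℝ, E) p₀).target) (X : VField E M)
    {h : M → ℝ} (hh : DifferentiableAt ℝ (fun w ↦ h ((extChartAt 𝓘(ℝ, E) p₀).symm w)) v) :
    lieD X h ((extChartAt 𝓘(ℝ, E) p₀).symm v)
      = fderiv ℝ (fun w ↦ h ((extChartAt 𝓘(ℝ, E) p₀).symm w)) v (vfieldChart p₀ X v) := by
  have hq := (extChartAt 𝓘(ℝ, E) p₀).map_target hv
  have hs : MDifferentiableAt 𝓘(ℝ, E) 𝓘(ℝ, E) (extChartAt 𝓘(ℝ, E) p₀).symm v :=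
    (mdifferentiableOn_extChartAt_symm v hv).mdifferentiableAt (target_mem_nhds p₀ hv)
  have h1 := mfderiv_comp v ((mdifferentiableAt_chart_iff hv).2 hh) hs
  rw [← ofChart_eq_mfderiv hv] at h1
  have h2 : fderiv ℝ (fun w ↦ h ((extChartAt 𝓘(ℝ, E) p₀).symm w)) v
      = mfderiv 𝓘(ℝ, E) 𝓘(ℝ, ℝ) (h ∘ (extChartAt 𝓘(ℝ, E) p₀).symm) v := by
    rw [mfderiv_eq_fderiv]; rfl
  rw [h2, h1]
  change _ = mfderiv 𝓘(ℝ, E) 𝓘(ℝ, ℝ) h ((extChartAt 𝓘(ℝ, E) p₀).symm v)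
    (ofChart p₀ ((extChartAt 𝓘(ℝ, E) p₀).symm v) (vfieldChart p₀ X v))
  rw [vfieldChart, ofChart_toChart hq]
  rfl

lemma mpullback_symm_eq_vfieldChart {p₀ : M} {v : E} (hv : v ∈ (extChartAt 𝓘(ℝ, E) p₀).target)
    (X : VField E M) :
    VectorField.mpullback 𝓘(ℝ, E) 𝓘(ℝ, E) (extChartAt 𝓘(ℝ, E) p₀).symm X v
      = vfieldChart p₀ X v := by
  have hq := (extChartAt 𝓘(ℝ, E) p₀).map_target hv
  rw [VectorField.mpullback_apply, ← ofChart_eq_mfderiv hv]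
  have : (ofChart (E := E) p₀ ((extChartAt 𝓘(ℝ, E) p₀).symm v)).inverse
      = toChart p₀ ((extChartAt 𝓘(ℝ, E) p₀).symm v) := by
    apply ContinuousLinearMap.inverse_eq
    · ext x; exact ofChart_toChart hq x
    · ext x; exact toChart_ofChart hq x
  exact DFunLike.congr_fun this _

lemma vfieldChart_bracket [CompleteSpace E] {p₀ : M} {v : E}
    (hv : v ∈ (extChartAt 𝓘(ℝ, E) p₀).target)
    {X Y : VField E M} (hX : DifferentiableAt ℝ (vfieldChart p₀ X) v)
    (hY : DifferentiableAt ℝ (vfieldChart p₀ Y) v) :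
    vfieldChart p₀ (bracket X Y) v
      = VectorField.lieBracket ℝ (vfieldChart p₀ X) (vfieldChart p₀ Y) v := by
  have hX' := (mdifferentiableAt_vfield_iff hv).2 hX
  have hY' := (mdifferentiableAt_vfield_iff hv).2 hY
  have hs : ContMDiffAt 𝓘(ℝ, E) 𝓘(ℝ, E) ∞ (extChartAt 𝓘(ℝ, E) p₀).symm v :=
    (contMDiffOn_extChartAt_symm p₀).contMDiffAt (target_mem_nhds p₀ hv)
  have : IsManifold 𝓘(ℝ, E) (minSmoothness ℝ 2) M :=
    IsManifold.of_le (n := ∞) (by simpa using two_le_infty)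
  have h1 := VectorField.mpullback_mlieBracket hX' hY' hs (by simpa using two_le_infty)
  rw [mpullback_symm_eq_vfieldChart hv] at h1
  rw [bracket, h1]
  have hcongr : ∀ X : VField E M, VectorField.mpullback 𝓘(ℝ, E) 𝓘(ℝ, E)
      (extChartAt 𝓘(ℝ, E) p₀).symm X =ᶠ[𝓝 v] vfieldChart p₀ X := by
    intro X
    filter_upwards [target_mem_nhds p₀ hv] with w hw using mpullback_symm_eq_vfieldChart hw X
  refine (Filter.EventuallyEq.mlieBracket_vectorField_eq (hcongr X) (hcongr Y)).trans ?_
  have h2 := congrFun (VectorField.mlieBracketWithin_eq_lieBracketWithin (𝕜 := ℝ)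
    (V := vfieldChart p₀ X) (W := vfieldChart p₀ Y) (s := Set.univ)) v
  rw [VectorField.lieBracketWithin_univ] at h2
  exact h2

lemma bilinChart_vfieldChart {p₀ : M} {v : E} (hv : v ∈ (extChartAt 𝓘(ℝ, E) p₀).target)
    (g : BilinField E M) (X Y : VField E M) :
    bilinChart p₀ g v (vfieldChart p₀ X v) (vfieldChart p₀ Y v)
      = g ((extChartAt 𝓘(ℝ, E) p₀).symm v) (X ((extChartAt 𝓘(ℝ, E) p₀).symm v))
        (Y ((extChartAt 𝓘(ℝ, E) p₀).symm v)) := by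
  have hq := (extChartAt 𝓘(ℝ, E) p₀).map_target hv
  change g ((extChartAt 𝓘(ℝ, E) p₀).symm v)
    (ofChart p₀ ((extChartAt 𝓘(ℝ, E) p₀).symm v) (toChart p₀ _ _))
    (ofChart p₀ ((extChartAt 𝓘(ℝ, E) p₀).symm v) (toChart p₀ _ _)) = _
  rw [ofChart_toChart hq, ofChart_toChart hq]

lemma bilinChart_toChart {p₀ : M} {v : E} (hv : v ∈ (extChartAt 𝓘(ℝ, E) p₀).target)
    (g : BilinField E M) (x y : TangentSpace 𝓘(ℝ, E) ((extChartAt 𝓘(ℝ, E) p₀).symm v)) :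
    bilinChart p₀ g v (toChart p₀ _ x) (toChart p₀ _ y)
      = g ((extChartAt 𝓘(ℝ, E) p₀).symm v) x y := by
  have hq := (extChartAt 𝓘(ℝ, E) p₀).map_target hv
  change g ((extChartAt 𝓘(ℝ, E) p₀).symm v)
    (ofChart p₀ ((extChartAt 𝓘(ℝ, E) p₀).symm v) (toChart p₀ _ _))
    (ofChart p₀ ((extChartAt 𝓘(ℝ, E) p₀).symm v) (toChart p₀ _ _)) = _
  rw [ofChart_toChart hq, ofChart_toChart hq]

lemma lieD_bilin {p₀ : M} {v : E} (hv : v ∈ (extChartAt 𝓘(ℝ, E) p₀).target)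
    {g : BilinField E M} (hg : DifferentiableAt ℝ (bilinChart p₀ g) v) (X : VField E M)
    {Y Z : VField E M} (hY : DifferentiableAt ℝ (vfieldChart p₀ Y) v)
    (hZ : DifferentiableAt ℝ (vfieldChart p₀ Z) v) :
    lieD X (fun q ↦ g q (Y q) (Z q)) ((extChartAt 𝓘(ℝ, E) p₀).symm v)
      = fderiv ℝ (fun w ↦ bilinChart p₀ g w (vfieldChart p₀ Y w) (vfieldChart p₀ Z w)) v
        (vfieldChart p₀ X v) := by
  have he : (fun w ↦ g ((extChartAt 𝓘(ℝ, E) p₀).symm w) (Y ((extChartAt 𝓘(ℝ, E) p₀).symm w))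
      (Z ((extChartAt 𝓘(ℝ, E) p₀).symm w)))
      =ᶠ[𝓝 v] fun w ↦ bilinChart p₀ g w (vfieldChart p₀ Y w) (vfieldChart p₀ Z w) := by
    filter_upwards [target_mem_nhds p₀ hv] with w hw
    exact (bilinChart_vfieldChart hw g Y Z).symm
  have hd : DifferentiableAt ℝ
      (fun w ↦ bilinChart p₀ g w (vfieldChart p₀ Y w) (vfieldChart p₀ Z w)) v :=
    (hg.clm_apply hY).clm_apply hZ
  rw [lieD_eq_fderiv hv X (he.differentiableAt_iff.2 hd), he.fderiv_eq]

/-- The Levi-Civita connection in a chart is given by the Christoffel symbols. -/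
lemma vfieldChart_leviCivita_of_isInvertible [CompleteSpace E] {p₀ : M} {v : E}
    (hv : v ∈ (extChartAt 𝓘(ℝ, E) p₀).target)
    {g : BilinField E M} (hg : DifferentiableAt ℝ (bilinChart p₀ g) v)
    (hi : (bilinChart p₀ g v).IsInvertible) (hs : ∀ q x y, g q x y = g q y x)
    {X Y : VField E M} (hX : DifferentiableAt ℝ (vfieldChart p₀ X) v)
    (hY : DifferentiableAt ℝ (vfieldChart p₀ Y) v) :
    vfieldChart p₀ (leviCivita g X Y) v
      = cov (christoffel (bilinChart p₀ g)) (vfieldChart p₀ Y) v (vfieldChart p₀ X v) := by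
  have hq := (extChartAt 𝓘(ℝ, E) p₀).map_target hv
  have hs' : ∀ᶠ w in nhds v, ∀ x y, bilinChart p₀ g w x y = bilinChart p₀ g w y x :=
    Eventually.of_forall fun w x y ↦ hs _ _ _
  set c := cov (christoffel (bilinChart p₀ g)) (vfieldChart p₀ Y) v (vfieldChart p₀ X v) with hc
  -- The vector with coordinates `c` satisfies the condition under `Classical.epsilon`.
  have key : ∀ z : TangentSpace 𝓘(ℝ, E) ((extChartAt 𝓘(ℝ, E) p₀).symm v),
      koszul g X Y (NordenGeometry.ext z) ((extChartAt 𝓘(ℝ, E) p₀).symm v)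
        = 2 * bilinChart p₀ g v c (toChart p₀ _ z) := by
    intro z
    have hZ := differentiableAt_vfieldChart_ext hv z
    have hz : vfieldChart p₀ (NordenGeometry.ext z) v = toChart p₀ _ z := by
      rw [vfieldChart, NordenGeometry.ext, FiberBundle.extend_apply_self]
    have h1 := koszul_vectorSpace hg hi hs' hX hY hZ
    rw [← hz, hc, ← h1, koszul, lieD_bilin hv hg X hY hZ, lieD_bilin hv hg Y hX hZ,
      lieD_bilin hv hg _ hX hY, ← vfieldChart_bracket hv hX hY, ← vfieldChart_bracket hv hX hZ,
      ← vfieldChart_bracket hv hY hZ, bilinChart_vfieldChart hv, bilinChart_vfieldChart hv,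
      bilinChart_vfieldChart hv]
  have hex : ∃ w : TangentSpace 𝓘(ℝ, E) ((extChartAt 𝓘(ℝ, E) p₀).symm v), ∀ z,
      2 * g ((extChartAt 𝓘(ℝ, E) p₀).symm v) w z
        = koszul g X Y (NordenGeometry.ext z) ((extChartAt 𝓘(ℝ, E) p₀).symm v) := by
    refine ⟨ofChart p₀ _ c, fun z ↦ ?_⟩
    rw [key z, ← bilinChart_toChart hv, toChart_ofChart hq]
  have hspec := Classical.epsilon_spec hex
  apply eq_of_metric_eq (nondegenerate_of_isInvertible hi)
  intro z
  have h2 := hspec (ofChart p₀ _ z)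
  rw [key, toChart_ofChart hq, ← bilinChart_toChart hv, toChart_ofChart hq] at h2
  exact mul_left_cancel₀ two_ne_zero h2

end Charts

/-! ### Hypersurfaces of an open set: pointwise structure -/

section CovRules

open Filter Topology

variable {E F : Type*} [NormedAddCommGroup E] [NormedSpace ℝ E]
  [NormedAddCommGroup F] [NormedSpace ℝ F]

lemma cov_congr {P : E → E →L[ℝ] F →L[ℝ] F} {W W' : E → F} {v : E} (h : W =ᶠ[𝓝 v] W') (x : E) :
    cov P W v x = cov P W' v x := by
  rw [cov, cov, h.fderiv_eq, h.eq_of_nhds]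

lemma cov_add {P : E → E →L[ℝ] F →L[ℝ] F} {W W' : E → F} {v : E} (hW : DifferentiableAt ℝ W v)
    (hW' : DifferentiableAt ℝ W' v) (x : E) :
    cov P (fun w ↦ W w + W' w) v x = cov P W v x + cov P W' v x := by
  simp only [cov]
  rw [fderiv_fun_add hW hW', add_apply, map_add]
  abel

lemma cov_sub {P : E → E →L[ℝ] F →L[ℝ] F} {W W' : E → F} {v : E} (hW : DifferentiableAt ℝ W v)
    (hW' : DifferentiableAt ℝ W' v) (x : E) :
    cov P (fun w ↦ W w - W' w) v x = cov P W v x - cov P W' v x := by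
  simp only [cov]
  rw [fderiv_fun_sub hW hW', sub_apply, map_sub]
  abel

lemma cov_smul {P : E → E →L[ℝ] F →L[ℝ] F} {W : E → F} {c : E → ℝ} {v : E}
    (hc : DifferentiableAt ℝ c v) (hW : DifferentiableAt ℝ W v) (x : E) :
    cov P (fun w ↦ c w • W w) v x = fderiv ℝ c v x • W v + c v • cov P W v x := by
  simp only [cov]
  rw [fderiv_fun_smul hc hW]
  simp only [add_apply, smul_apply, ContinuousLinearMap.smulRight_apply, map_smul, smul_add]
  abel

lemma cov_zero_right {P : E → E →L[ℝ] F →L[ℝ] F} {W : E → F} {v : E} : cov P W v 0 = 0 := by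
  simp [cov]

end CovRules

/-- A time-like hypersurface of a Kähler manifold with Norden metric, read in charts: `f` is an
immersion of the open set `U` of `E` into `E'`, with unit normal field `N`, where `E'` carries the
Norden metric `G` and the parallel complex structure `J`. The conditions on `G` and `J`, apart from
symmetry, are required only along `f`. -/
structure LocalHypersurface (E E' : Type*) [NormedAddCommGroup E] [NormedSpace ℝ E]
    [NormedAddCommGroup E'] [NormedSpace ℝ E'] where
  U : Set E
  f : E → E'
  N : E → E'
  G : E' → E' →L[ℝ] E' →L[ℝ] ℝ
  J : E' → E' →L[ℝ] E'
  isOpen : IsOpen U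
  smooth_f : ∀ v ∈ U, ContDiffAt ℝ ∞ f v
  smooth_N : ∀ v ∈ U, ContDiffAt ℝ ∞ N v
  smooth_G : ∀ v ∈ U, ContDiffAt ℝ ∞ G (f v)
  smooth_J : ∀ v ∈ U, ContDiffAt ℝ ∞ J (f v)
  symm : ∀ w x y, G w x y = G w y x
  nondegenerate : ∀ v ∈ U, ∀ x, (∀ y, G (f v) x y = 0) → x = 0
  sq : ∀ v ∈ U, ∀ x, J (f v) (J (f v) x) = -x
  norden : ∀ v ∈ U, ∀ x y, G (f v) (J (f v) x) (J (f v) y) = -G (f v) x y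
  parallel : ∀ v ∈ U, ∀ x y, fderiv ℝ J (f v) x y + christoffel G (f v) x (J (f v) y)
    = J (f v) (christoffel G (f v) x y)
  immersion : ∀ v ∈ U, ∀ x, fderiv ℝ f v x = 0 → x = 0
  normal : ∀ v ∈ U, ∀ x, G (f v) (N v) (fderiv ℝ f v x) = 0
  timelike : ∀ v ∈ U, G (f v) (N v) (N v) = -1
  finrank_eq : Module.finrank ℝ E' = Module.finrank ℝ E + 1

namespace LocalHypersurface

open Filter Topology

variable {E E' : Type*} [NormedAddCommGroup E] [NormedSpace ℝ E]
  [NormedAddCommGroup E'] [NormedSpace ℝ E'] (H : LocalHypersurface E E')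

/-- The differential of the immersion. -/
def D (v : E) : E →L[ℝ] E' := fderiv ℝ H.f v

/-- The ambient metric along the immersion. -/
def B (v : E) : E' →L[ℝ] E' →L[ℝ] ℝ := H.G (H.f v)

/-- The ambient complex structure along the immersion. -/
def I (v : E) : E' →L[ℝ] E' := H.J (H.f v)

/-- The connection form of the ambient Levi-Civita connection, pulled back along the immersion. -/
def P : E → E →L[ℝ] E' →L[ℝ] E' := pullForm (christoffel H.G) H.f

/-- The induced metric. -/
def g (v : E) : E →L[ℝ] E →L[ℝ] ℝ := (H.B v).bilinearComp (H.D v) (H.D v)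

/-- The Christoffel symbols of the induced metric. -/
def Γ : E → E →L[ℝ] E →L[ℝ] E := christoffel H.g

/-- The tangential projection along the immersion, with values in the tangent space of the
hypersurface: the vector representing `g'(w, ·)` with respect to the induced metric. -/
def tan (v : E) : E' →L[ℝ] E :=
  (H.g v).inverse ∘L ((ContinuousLinearMap.compL ℝ E E' ℝ).flip (H.D v) ∘L H.B v)

/-- The shape operator, the tangential part of `-∇' N`. -/
def A (v x : E) : E := -H.tan v (cov H.P H.N v x)

/-- The angle `t = arctan g'(N, JN)`. -/
def t (v : E) : ℝ := Real.arctan (H.B v (H.N v) (H.I v (H.N v)))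

/-- The contact form `η = cos t g'(·, JN)`. -/
def η (v : E) : E →L[ℝ] ℝ := Real.cos (H.t v) • ((H.B v (H.I v (H.N v))).comp (H.D v))

/-- The Reeb field `ξ = sin t N + cos t JN`. -/
def ξ (v : E) : E :=
  H.tan v (Real.sin (H.t v) • H.N v + Real.cos (H.t v) • H.I v (H.N v))

/-- The endomorphism `φ = J + η ⊗ (cos t N - sin t JN)`. -/
def φ (v : E) : E →L[ℝ] E :=
  H.tan v ∘L (H.I v ∘L H.D v + (H.η v).smulRight
    (Real.cos (H.t v) • H.N v - Real.sin (H.t v) • H.I v (H.N v)))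

lemma g_apply (v x y : E) : H.g v x y = H.B v (H.D v x) (H.D v y) := rfl

lemma η_apply (v x : E) : H.η v x = Real.cos (H.t v) * H.B v (H.I v (H.N v)) (H.D v x) := rfl

lemma P_apply (v x : E) (w : E') : H.P v x w = christoffel H.G (H.f v) (H.D v x) w := rfl

lemma B_symm (v : E) (x y : E') : H.B v x y = H.B v y x := H.symm _ x y

lemma g_symm (v x y : E) : H.g v x y = H.g v y x := H.symm _ _ _

section Pointwise

variable {H} {v : E} (hv : v ∈ H.U)
include hv

lemma I_symm (x y : E') : H.B v (H.I v x) y = H.B v x (H.I v y) := by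
  have h1 := H.norden v hv x (H.J (H.f v) y)
  rw [H.sq v hv, map_neg] at h1
  simpa [B, I] using h1

lemma I_norden (x y : E') : H.B v (H.I v x) (H.I v y) = -H.B v x y := H.norden v hv x y

lemma I_sq (x : E') : H.I v (H.I v x) = -x := H.sq v hv x

lemma B_normal (x : E) : H.B v (H.N v) (H.D v x) = 0 := H.normal v hv x

lemma B_normal' (x : E) : H.B v (H.D v x) (H.N v) = 0 := by rw [B_symm]; exact H.normal v hv x

lemma B_timelike : H.B v (H.N v) (H.N v) = -1 := H.timelike v hv

lemma mem_nhds : ∀ᶠ w in 𝓝 v, w ∈ H.U := H.isOpen.mem_nhds hv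

variable [FiniteDimensional ℝ E] [FiniteDimensional ℝ E']

/-- The ambient space is spanned by the tangent space and the normal. -/
lemma exists_decomposition (w : E') : ∃ x : E, ∃ c : ℝ, w = H.D v x + c • H.N v := by
  let T : (E × ℝ) →ₗ[ℝ] E' :=
    (H.D v : E →ₗ[ℝ] E').coprod (LinearMap.toSpanSingleton ℝ E' (H.N v))
  have hT : ∀ p, T p = H.D v p.1 + p.2 • H.N v := fun p ↦ by
    simp [T, LinearMap.coprod_apply]
  have hinj : Function.Injective T := by
    rw [injective_iff_map_eq_zero]
    rintro ⟨x, c⟩ h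
    rw [hT] at h
    have h1 : H.B v (H.N v) (H.D v x + c • H.N v) = 0 := by rw [h, map_zero]
    rw [map_add, map_smul, B_normal hv, B_timelike hv] at h1
    have hc : c = 0 := by simpa using h1
    have hx : x = 0 := H.immersion v hv x (by simpa [hc, D] using h)
    simp [hc, hx]
  have hsurj : Function.Surjective T := by
    refine (LinearMap.injective_iff_surjective_of_finrank_eq_finrank ?_).1 hinj
    rw [H.finrank_eq, Module.finrank_prod, Module.finrank_self]
  obtain ⟨⟨x, c⟩, h⟩ := hsurj w
  exact ⟨x, c, by rw [← h, hT]⟩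

lemma g_nondegenerate (x : E) (hx : ∀ y, H.g v x y = 0) : x = 0 := by
  apply H.immersion v hv
  apply H.nondegenerate v hv
  intro w
  obtain ⟨y, c, rfl⟩ := exists_decomposition hv w
  have h1 : H.B v (H.D v x) (H.D v y) = 0 := hx y
  have h2 : H.B v (H.D v x) (H.N v) = 0 := B_normal' hv x
  change H.B v (H.D v x) _ = 0
  rw [map_add, map_smul, h1, h2]
  simp

lemma g_isInvertible : (H.g v).IsInvertible :=
  isInvertible_of_nondegenerate _ (g_nondegenerate hv)

lemma g_tan (w : E') (z : E) : H.g v (H.tan v w) z = H.B v w (H.D v z) := by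
  simp only [tan, ContinuousLinearMap.comp_apply]
  rw [ContinuousLinearMap.IsInvertible.self_apply_inverse (g_isInvertible hv)]
  rfl

lemma eq_of_g_eq {x y : E} (h : ∀ z, H.g v x z = H.g v y z) : x = y :=
  eq_of_metric_eq (g_nondegenerate hv) h

omit [FiniteDimensional ℝ E] [FiniteDimensional ℝ E'] in
lemma D_injective {x y : E} (h : H.D v x = H.D v y) : x = y := by
  rw [← sub_eq_zero]
  exact H.immersion v hv _ (by rw [map_sub, sub_eq_zero]; exact h)

lemma tan_D (x : E) : H.tan v (H.D v x) = x :=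
  eq_of_g_eq hv fun z ↦ by rw [g_tan hv]; rfl

lemma tan_N : H.tan v (H.N v) = 0 :=
  eq_of_g_eq hv fun z ↦ by rw [g_tan hv, B_normal hv]; simp

/-- Splitting of an ambient vector into its tangential and normal parts. -/
lemma D_tan (w : E') : H.D v (H.tan v w) = w + H.B v w (H.N v) • H.N v := by
  obtain ⟨x, c, rfl⟩ := exists_decomposition hv w
  have h : H.B v (H.D v x + c • H.N v) (H.N v) = -c := by
    rw [map_add, add_apply, map_smul, smul_apply, B_normal' hv, B_timelike hv]
    simp
  rw [h, map_add, map_smul, tan_D hv, tan_N hv]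
  simp

lemma D_tan_of_orthogonal {w : E'} (h : H.B v w (H.N v) = 0) : H.D v (H.tan v w) = w := by
  rw [D_tan hv, h]; simp

omit [FiniteDimensional ℝ E] [FiniteDimensional ℝ E'] hv in
lemma cos_t_pos : 0 < Real.cos (H.t v) := Real.cos_arctan_pos _

omit [FiniteDimensional ℝ E] [FiniteDimensional ℝ E'] hv in
lemma cos_t_ne : Real.cos (H.t v) ≠ 0 := cos_t_pos.ne'

omit [FiniteDimensional ℝ E] [FiniteDimensional ℝ E'] hv in
lemma cos_mul_B : Real.cos (H.t v) * H.B v (H.N v) (H.I v (H.N v)) = Real.sin (H.t v) := by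
  have h : Real.tan (H.t v) = H.B v (H.N v) (H.I v (H.N v)) := Real.tan_arctan _
  rw [← h, mul_comm, Real.tan_mul_cos cos_t_ne]

lemma D_ξ : H.D v (H.ξ v) = Real.sin (H.t v) • H.N v + Real.cos (H.t v) • H.I v (H.N v) := by
  apply D_tan_of_orthogonal hv
  simp only [map_add, map_smul, add_apply, smul_apply, smul_eq_mul]
  rw [B_timelike hv, I_symm hv, cos_mul_B]
  ring

lemma g_ξ (x : E) : H.g v x (H.ξ v) = H.η v x := by
  rw [g_apply, D_ξ hv, η_apply, map_add, map_smul, map_smul, B_normal' hv, B_symm]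
  simp

lemma g_ξ' (x : E) : H.g v (H.ξ v) x = H.η v x := by rw [g_symm, g_ξ hv]

lemma η_ξ : H.η v (H.ξ v) = 1 := by
  have h := cos_mul_B (H := H) (v := v)
  rw [η_apply, D_ξ hv, map_add, map_smul, map_smul, I_norden hv, B_timelike hv, I_symm hv]
  simp only [smul_eq_mul]
  linear_combination Real.sin (H.t v) * h + Real.sin_sq_add_cos_sq (H.t v)

lemma D_φ (x : E) : H.D v (H.φ v x) = H.I v (H.D v x)
    + H.η v x • (Real.cos (H.t v) • H.N v - Real.sin (H.t v) • H.I v (H.N v)) := by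
  have h0 : H.φ v x = H.tan v (H.I v (H.D v x)
    + H.η v x • (Real.cos (H.t v) • H.N v - Real.sin (H.t v) • H.I v (H.N v))) := rfl
  rw [h0]
  apply D_tan_of_orthogonal hv
  have h := cos_mul_B (H := H) (v := v)
  have h2 : H.B v (H.I v (H.D v x)) (H.N v) = H.B v (H.I v (H.N v)) (H.D v x) := by
    rw [I_symm hv, B_symm]
  simp only [add_apply, map_add, map_smul, map_sub, sub_apply, smul_apply, smul_eq_mul]
  rw [B_timelike hv, h2, I_symm hv (H.N v) (H.N v), η_apply]
  set b := H.B v (H.I v (H.N v)) (H.D v x)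
  linear_combination (-Real.sin (H.t v) * b) * h - b * Real.sin_sq_add_cos_sq (H.t v)

lemma φ_ξ : H.φ v (H.ξ v) = 0 := by
  apply D_injective hv
  rw [D_φ hv, D_ξ hv, η_ξ hv, map_add, map_smul, map_smul, I_sq hv, map_zero]
  module

lemma B_I_D (x y : E) : H.B v (H.I v (H.D v x)) (H.D v y)
    = H.g v (H.φ v x) y + Real.tan (H.t v) * H.η v x * H.η v y := by
  have hc : Real.tan (H.t v) * Real.cos (H.t v) = Real.sin (H.t v) := Real.tan_mul_cos cos_t_ne
  have hN := B_normal hv y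
  rw [g_apply, D_φ hv]
  simp only [add_apply, map_add, map_smul, map_sub, sub_apply, smul_apply, smul_eq_mul]
  rw [hN, η_apply H v y]
  linear_combination (-H.η v x * H.B v (H.I v (H.N v)) (H.D v y)) * hc

lemma φ_symm (x y : E) : H.g v (H.φ v x) y = H.g v x (H.φ v y) := by
  have h1 := B_I_D hv x y
  have h2 := B_I_D hv y x
  rw [I_symm hv, B_symm] at h1
  rw [g_symm H v x]
  linarith

lemma η_φ (x : E) : H.η v (H.φ v x) = 0 := by
  rw [← g_ξ hv, φ_symm hv, φ_ξ hv, map_zero]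

lemma φ_φ (x : E) : H.φ v (H.φ v x) = -x + H.η v x • H.ξ v := by
  apply D_injective hv
  rw [D_φ hv, η_φ hv, D_φ hv, map_add, map_smul, map_sub, map_smul, map_smul, I_sq hv, I_sq hv,
    map_add, map_smul, map_neg, D_ξ hv]
  module

lemma g_φ_φ (x y : E) : H.g v (H.φ v x) (H.φ v y) = -H.g v x y + H.η v x * H.η v y := by
  rw [← φ_symm hv, φ_φ hv, map_add, map_smul, map_neg, add_apply, smul_apply, neg_apply, g_ξ' hv,
    smul_eq_mul]

end Pointwise

end LocalHypersurface

/-! ### Hypersurfaces of an open set: smoothness and the Gauss equation -/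

namespace LocalHypersurface

open Filter Topology

variable {E E' : Type*} [NormedAddCommGroup E] [NormedSpace ℝ E] [FiniteDimensional ℝ E]
  [NormedAddCommGroup E'] [NormedSpace ℝ E'] [FiniteDimensional ℝ E']
  {H : LocalHypersurface E E'} {v : E} (hv : v ∈ H.U)
include hv

omit [FiniteDimensional ℝ E] [FiniteDimensional ℝ E'] in
lemma contDiffAt_D : ContDiffAt ℝ ∞ H.D v := (H.smooth_f v hv).fderiv_right (by simp)

omit [FiniteDimensional ℝ E] [FiniteDimensional ℝ E'] in
lemma contDiffAt_B : ContDiffAt ℝ ∞ H.B v := (H.smooth_G v hv).comp v (H.smooth_f v hv)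

omit [FiniteDimensional ℝ E] [FiniteDimensional ℝ E'] in
lemma contDiffAt_I : ContDiffAt ℝ ∞ H.I v := (H.smooth_J v hv).comp v (H.smooth_f v hv)

omit [FiniteDimensional ℝ E] in
lemma G_isInvertible : (H.G (H.f v)).IsInvertible :=
  isInvertible_of_nondegenerate _ (H.nondegenerate v hv)

omit [FiniteDimensional ℝ E] in
lemma contDiffAt_christoffel_G : ContDiffAt ℝ ∞ (christoffel H.G) (H.f v) := by
  have := FiniteDimensional.complete ℝ E'
  exact contDiffAt_christoffel (H.smooth_G v hv) (G_isInvertible hv)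

omit [FiniteDimensional ℝ E] in
lemma contDiffAt_P : ContDiffAt ℝ ∞ H.P v :=
  contDiffAt_pullForm (contDiffAt_christoffel_G hv) (H.smooth_f v hv)

omit [FiniteDimensional ℝ E] [FiniteDimensional ℝ E'] in
lemma contDiffAt_g : ContDiffAt ℝ ∞ H.g v := by
  have hB := contDiffAt_B hv
  have hD := contDiffAt_D hv
  have h1 : ContDiffAt ℝ ∞ (fun w ↦ (H.B w ∘L H.D w).flip) v :=
    (ContinuousLinearMap.flipₗᵢ ℝ E E' ℝ).contDiff.contDiffAt.comp v (hB.clm_comp hD)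
  exact (ContinuousLinearMap.flipₗᵢ ℝ E E ℝ).contDiff.contDiffAt.comp v (h1.clm_comp hD)

lemma contDiffAt_Γ : ContDiffAt ℝ ∞ H.Γ v := by
  have := FiniteDimensional.complete ℝ E
  exact contDiffAt_christoffel (contDiffAt_g hv) (g_isInvertible hv)

lemma contDiffAt_tan : ContDiffAt ℝ ∞ H.tan v := by
  have := FiniteDimensional.complete ℝ E
  have h1 : ContDiffAt ℝ ∞ (fun w ↦ (H.g w).inverse) v := by
    obtain ⟨e, he⟩ := g_isInvertible hv
    have := contDiffAt_map_inverse (n := ∞) (𝕜 := ℝ) e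
    rw [he] at this
    exact this.comp v (contDiffAt_g hv)
  have h2 : ContDiffAt ℝ ∞ (fun w ↦ (ContinuousLinearMap.compL ℝ E E' ℝ).flip (H.D w)) v :=
    (ContinuousLinearMap.contDiff _).contDiffAt.comp v (contDiffAt_D hv)
  exact h1.clm_comp (h2.clm_comp (contDiffAt_B hv))

omit [FiniteDimensional ℝ E] [FiniteDimensional ℝ E'] in
lemma contDiffAt_IN : ContDiffAt ℝ ∞ (fun w ↦ H.I w (H.N w)) v :=
  (contDiffAt_I hv).clm_apply (H.smooth_N v hv)

omit [FiniteDimensional ℝ E] [FiniteDimensional ℝ E'] in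
lemma contDiffAt_t : ContDiffAt ℝ ∞ H.t v :=
  Real.contDiff_arctan.contDiffAt.comp v
    (((contDiffAt_B hv).clm_apply (H.smooth_N v hv)).clm_apply (contDiffAt_IN hv))

omit [FiniteDimensional ℝ E] [FiniteDimensional ℝ E'] in
lemma contDiffAt_cos : ContDiffAt ℝ ∞ (fun w ↦ Real.cos (H.t w)) v :=
  Real.contDiff_cos.contDiffAt.comp v (contDiffAt_t hv)

omit [FiniteDimensional ℝ E] [FiniteDimensional ℝ E'] in
lemma contDiffAt_sin : ContDiffAt ℝ ∞ (fun w ↦ Real.sin (H.t w)) v :=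
  Real.contDiff_sin.contDiffAt.comp v (contDiffAt_t hv)

omit [FiniteDimensional ℝ E] [FiniteDimensional ℝ E'] in
lemma contDiffAt_η : ContDiffAt ℝ ∞ H.η v :=
  (contDiffAt_cos hv).smul
    (((contDiffAt_B hv).clm_apply (contDiffAt_IN hv)).clm_comp (contDiffAt_D hv))

lemma contDiffAt_ξ : ContDiffAt ℝ ∞ H.ξ v :=
  (contDiffAt_tan hv).clm_apply
    (((contDiffAt_sin hv).smul (H.smooth_N v hv)).add ((contDiffAt_cos hv).smul (contDiffAt_IN hv)))

lemma contDiffAt_φ : ContDiffAt ℝ ∞ H.φ v :=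
  (contDiffAt_tan hv).clm_comp (((contDiffAt_I hv).clm_comp (contDiffAt_D hv)).add
    ((contDiffAt_η hv).smulRight (((contDiffAt_cos hv).smul (H.smooth_N v hv)).sub
      ((contDiffAt_sin hv).smul (contDiffAt_IN hv)))))

omit [FiniteDimensional ℝ E] in
/-- The pulled back connection is compatible with the ambient metric. -/
lemma fderiv_B_apply {W Z : E → E'} (hW : DifferentiableAt ℝ W v) (hZ : DifferentiableAt ℝ Z v)
    (x : E) : fderiv ℝ (fun w ↦ H.B w (W w) (Z w)) v x
      = H.B v (cov H.P W v x) (Z v) + H.B v (W v) (cov H.P Z v x) := by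
  have hG : DifferentiableAt ℝ H.G (H.f v) := (H.smooth_G v hv).differentiableAt (by simp)
  have h1 : fderiv ℝ H.B v = (fderiv ℝ H.G (H.f v)).comp (H.D v) :=
    fderiv_fun_comp v hG ((H.smooth_f v hv).differentiableAt (by simp))
  rw [fderiv_clm₂_apply ((contDiffAt_B hv).differentiableAt (by simp)) hW hZ, h1,
    ContinuousLinearMap.comp_apply, christoffel_compat hG (G_isInvertible hv)
      (Eventually.of_forall H.symm)]
  simp only [cov, P_apply, map_add, add_apply, B]
  ring

omit [FiniteDimensional ℝ E] in
/-- The pulled back connection is torsion-free. -/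
lemma cov_D_symm (x y : E) :
    cov H.P (fun w ↦ H.D w y) v x = cov H.P (fun w ↦ H.D w x) v y := by
  have hG : DifferentiableAt ℝ H.G (H.f v) := (H.smooth_G v hv).differentiableAt (by simp)
  have h1 : fderiv ℝ (fun w ↦ H.D w y) v x = fderiv ℝ (fun w ↦ H.D w x) v y :=
    fderiv_apply_symm (H.smooth_f v hv) x y
  simp only [cov, P_apply]
  rw [h1, christoffel_symm hG (G_isInvertible hv) (Eventually.of_forall H.symm)]

omit [FiniteDimensional ℝ E] [FiniteDimensional ℝ E'] in
/-- The complex structure is parallel. -/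
lemma cov_I {W : E → E'} (hW : DifferentiableAt ℝ W v) (x : E) :
    cov H.P (fun w ↦ H.I w (W w)) v x = H.I v (cov H.P W v x) := by
  have hJ : DifferentiableAt ℝ H.J (H.f v) := (H.smooth_J v hv).differentiableAt (by simp)
  have h1 : fderiv ℝ H.I v = (fderiv ℝ H.J (H.f v)).comp (H.D v) :=
    fderiv_fun_comp v hJ ((H.smooth_f v hv).differentiableAt (by simp))
  have h2 := H.parallel v hv (H.D v x) (W v)
  simp only [cov, P_apply]
  rw [fderiv_clm_apply ((contDiffAt_I hv).differentiableAt (by simp)) hW, h1]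
  simp only [add_apply, ContinuousLinearMap.comp_apply, ContinuousLinearMap.flip_apply, map_add]
  rw [show H.I v (christoffel H.G (H.f v) (H.D v x) (W v))
    = H.J (H.f v) (christoffel H.G (H.f v) (H.D v x) (W v)) from rfl, ← h2]
  simp only [I]
  abel

omit [FiniteDimensional ℝ E] [FiniteDimensional ℝ E'] in
lemma cov_D_apply {Y : E → E} (hY : DifferentiableAt ℝ Y v) (x : E) :
    cov H.P (fun w ↦ H.D w (Y w)) v x
      = cov H.P (fun w ↦ H.D w (Y v)) v x + H.D v (fderiv ℝ Y v x) := by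
  have hD : DifferentiableAt ℝ H.D v := (contDiffAt_D hv).differentiableAt (by simp)
  simp only [cov]
  rw [fderiv_clm_apply hD hY, fderiv_clm_apply hD (differentiableAt_const _)]
  simp
  abel

omit [FiniteDimensional ℝ E] in
lemma B_cov_N_N (x : E) : H.B v (cov H.P H.N v x) (H.N v) = 0 := by
  have hN := (H.smooth_N v hv).differentiableAt (by simp)
  have h1 := fderiv_B_apply hv hN hN x
  have h2 : (fun w ↦ H.B w (H.N w) (H.N w)) =ᶠ[𝓝 v] fun _ ↦ -1 := by
    filter_upwards [mem_nhds hv] with w hw using B_timelike hw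
  rw [h2.fderiv_eq, B_symm H v (H.N v)] at h1
  simp at h1
  linarith

lemma D_A (x : E) : H.D v (H.A v x) = -cov H.P H.N v x := by
  rw [A, map_neg, D_tan_of_orthogonal hv (B_cov_N_N hv x)]

lemma g_A (x z : E) : H.g v (H.A v x) z = -H.B v (cov H.P H.N v x) (H.D v z) := by
  rw [A, map_neg, neg_apply, g_tan hv]

omit [FiniteDimensional ℝ E] in
lemma B_cov_D_N {Y : E → E} (hY : DifferentiableAt ℝ Y v) (x : E) :
    H.B v (cov H.P (fun w ↦ H.D w (Y w)) v x) (H.N v)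
      = -H.B v (cov H.P H.N v x) (H.D v (Y v)) := by
  have hN := (H.smooth_N v hv).differentiableAt (by simp)
  have hD : DifferentiableAt ℝ H.D v := (contDiffAt_D hv).differentiableAt (by simp)
  have h1 := fderiv_B_apply hv (hD.clm_apply hY) hN x
  have h2 : (fun w ↦ H.B w (H.D w (Y w)) (H.N w)) =ᶠ[𝓝 v] fun _ ↦ 0 := by
    filter_upwards [mem_nhds hv] with w hw using B_normal' hw _
  rw [h2.fderiv_eq, B_symm H v (H.D v (Y v))] at h1
  simp at h1
  linarith

lemma A_symm (x y : E) : H.g v (H.A v x) y = H.g v (H.A v y) x := by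
  have h1 := B_cov_D_N hv (differentiableAt_const y) x
  have h2 := B_cov_D_N hv (differentiableAt_const x) y
  rw [cov_D_symm hv] at h1
  rw [g_A hv, g_A hv]
  linarith

lemma differentiableAt_g_A (y z : E) : DifferentiableAt ℝ (fun w ↦ H.g w (H.A w y) z) v := by
  have h1 : ContDiffAt ℝ ∞ (fun w ↦ -H.B w (cov H.P H.N w y) (H.D w z)) v := by
    have hc := contDiffAt_cov (contDiffAt_P hv) (H.smooth_N v hv) y
    exact (((contDiffAt_B hv).clm_apply hc).clm_apply
      ((contDiffAt_D hv).clm_apply contDiffAt_const)).neg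
  refine (h1.differentiableAt (by simp)).congr_of_eventuallyEq ?_
  filter_upwards [mem_nhds hv] with w hw using g_A hw y z

lemma fderiv_g_apply {Y Z : E → E} (hY : DifferentiableAt ℝ Y v) (hZ : DifferentiableAt ℝ Z v)
    (x : E) : fderiv ℝ (fun w ↦ H.g w (Y w) (Z w)) v x
      = H.g v (cov H.Γ Y v x) (Z v) + H.g v (Y v) (cov H.Γ Z v x) := by
  have hg : DifferentiableAt ℝ H.g v := (contDiffAt_g hv).differentiableAt (by simp)
  rw [fderiv_clm₂_apply hg hY hZ, christoffel_compat hg (g_isInvertible hv)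
      (Eventually.of_forall (H.g_symm))]
  simp only [cov, map_add, add_apply, Γ]
  ring

/-- The tangential part of the ambient covariant derivative is the Levi-Civita connection of the
induced metric: both are metric and torsion-free. -/
lemma B_cov_D_D (x y z : E) :
    H.B v (cov H.P (fun w ↦ H.D w y) v x) (H.D v z) = H.g v (H.Γ v x y) z := by
  have hD : DifferentiableAt ℝ H.D v := (contDiffAt_D hv).differentiableAt (by simp)
  have hg : DifferentiableAt ℝ H.g v := (contDiffAt_g hv).differentiableAt (by simp)
  have key : ∀ x y z, fderiv ℝ H.g v x y z
      = H.B v (cov H.P (fun w ↦ H.D w y) v x) (H.D v z)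
        + H.B v (H.D v y) (cov H.P (fun w ↦ H.D w z) v x) := by
    intro x y z
    rw [← fderiv_B_apply hv (hD.clm_apply (differentiableAt_const y))
      (hD.clm_apply (differentiableAt_const z))]
    have := fderiv_clm₂_apply hg (differentiableAt_const (c := y) (x := v))
      (differentiableAt_const (c := z) (x := v)) x
    change _ = fderiv ℝ (fun w ↦ H.g w y z) v x
    simpa using this.symm
  have h1 : 2 * H.g v (H.Γ v x y) z = _ := christoffel_spec (g_isInvertible hv) x y z
  rw [key, key, key, cov_D_symm hv y x, cov_D_symm hv z x, cov_D_symm hv z y,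
    B_symm H v (H.D v y), B_symm H v (H.D v x)] at h1
  linarith

/-- Gauss formula. -/
lemma gauss_formula {Y : E → E} (hY : DifferentiableAt ℝ Y v) (x : E) :
    cov H.P (fun w ↦ H.D w (Y w)) v x
      = H.D v (cov H.Γ Y v x) - H.g v (H.A v x) (Y v) • H.N v := by
  have h1 := D_tan hv (cov H.P (fun w ↦ H.D w (Y w)) v x)
  rw [B_cov_D_N hv hY, ← g_A hv] at h1
  have h2 : H.tan v (cov H.P (fun w ↦ H.D w (Y w)) v x) = cov H.Γ Y v x := by
    apply eq_of_g_eq hv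
    intro z
    rw [g_tan hv, cov_D_apply hv hY, map_add, add_apply, B_cov_D_D hv, cov, map_add, add_apply,
      g_apply H v (fderiv ℝ Y v x)]
    ring
  rw [← h2, h1]
  abel

/-- Gauss equation. -/
lemma gauss_equation (x y z u : E) :
    H.B v (curv H.P v x y (H.D v z)) (H.D v u)
      = H.g v (curv H.Γ v x y z) u + H.g v (H.A v y) z * H.g v (H.A v x) u
        - H.g v (H.A v x) z * H.g v (H.A v y) u := by
  have hD : DifferentiableAt ℝ H.D v := (contDiffAt_D hv).differentiableAt (by simp)
  have hN := (H.smooth_N v hv).differentiableAt (by simp)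
  have key : ∀ x y, H.B v (cov H.P (fun w ↦ cov H.P (fun w ↦ H.D w z) w y) v x) (H.D v u)
      = H.g v (cov H.Γ (fun w ↦ cov H.Γ (fun _ ↦ z) w y) v x) u
        + H.g v (H.A v y) z * H.g v (H.A v x) u := by
    intro x y
    have hY : DifferentiableAt ℝ (fun w ↦ cov H.Γ (fun _ ↦ z) w y) v :=
      (contDiffAt_cov (contDiffAt_Γ hv) contDiffAt_const y).differentiableAt (by simp)
    have h1 : (fun w ↦ cov H.P (fun w ↦ H.D w z) w y) =ᶠ[𝓝 v] fun w ↦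
        H.D w (cov H.Γ (fun _ ↦ z) w y) - H.g w (H.A w y) z • H.N w := by
      filter_upwards [mem_nhds hv] with w hw using gauss_formula hw (differentiableAt_const z) y
    have hs := differentiableAt_g_A hv y z
    rw [cov_congr h1, cov_sub (hD.clm_apply hY) (hs.fun_smul hN), gauss_formula hv hY,
      cov_smul hs hN, g_A hv x u]
    simp only [map_sub, map_add, map_smul, sub_apply, add_apply, smul_apply, smul_eq_mul,
      B_normal hv, g_apply]
    ring
  have h2 := ricci_identity (contDiffAt_P hv)
    ((contDiffAt_D hv).clm_apply (contDiffAt_const (c := z))) x y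
  have h3 := ricci_identity (contDiffAt_Γ hv) (contDiffAt_const (c := z)) x y
  rw [← h2, ← h3, map_sub, map_sub, sub_apply, sub_apply, key, key]
  ring

end LocalHypersurface

/-! ### The class 𝓕₄ ⊕ 𝓕₅ -/

namespace LocalHypersurface

open Filter Topology

variable {E E' : Type*} [NormedAddCommGroup E] [NormedSpace ℝ E]
  [NormedAddCommGroup E'] [NormedSpace ℝ E'] (H : LocalHypersurface E E')

/-- The tensor `(∇_x φ) y`, for the Levi-Civita connection of the induced metric. -/
def nablaφ (v x y : E) : E := cov H.Γ (fun w ↦ H.φ w y) v x - H.φ v (H.Γ v x y)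

/-- The class `𝓕₄ ⊕ 𝓕₅`, with coefficients `a = θ(ξ) / 2n` and `b = θ*(ξ) / 2n`. -/
def IsF4F5 (a b : E → ℝ) : Prop :=
  ∀ v ∈ H.U, ∀ x y z, H.g v (H.nablaφ v x y) z
    = -a v * (H.g v (H.φ v x) (H.φ v y) * H.η v z + H.g v (H.φ v x) (H.φ v z) * H.η v y)
      - b v * (H.g v x (H.φ v y) * H.η v z + H.g v x (H.φ v z) * H.η v y)

/-- The connection `∇_x W + g(∇_x ξ, W) ξ - η(W) ∇_x ξ`, which is the canonical connection in the
class `𝓕₄ ⊕ 𝓕₅`. -/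
def can (W : E → E) (v x : E) : E :=
  cov H.Γ W v x + H.g v (cov H.Γ H.ξ v x) (W v) • H.ξ v - H.η v (W v) • cov H.Γ H.ξ v x

variable {H} [FiniteDimensional ℝ E] [FiniteDimensional ℝ E'] {v : E} (hv : v ∈ H.U)
include hv

lemma nablaφ_apply {Y : E → E} (hY : DifferentiableAt ℝ Y v) (x : E) :
    cov H.Γ (fun w ↦ H.φ w (Y w)) v x - H.φ v (cov H.Γ Y v x) = H.nablaφ v x (Y v) := by
  have hφ : DifferentiableAt ℝ H.φ v := (contDiffAt_φ hv).differentiableAt (by simp)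
  simp only [nablaφ, cov]
  rw [fderiv_clm_apply hφ hY, fderiv_clm_apply hφ (differentiableAt_const _)]
  simp
  abel

lemma fderiv_η_apply {Y : E → E} (hY : DifferentiableAt ℝ Y v) (x : E) :
    fderiv ℝ (fun w ↦ H.η w (Y w)) v x
      = H.g v (cov H.Γ H.ξ v x) (Y v) + H.η v (cov H.Γ Y v x) := by
  have h1 : (fun w ↦ H.η w (Y w)) =ᶠ[𝓝 v] fun w ↦ H.g w (H.ξ w) (Y w) := by
    filter_upwards [mem_nhds hv] with w hw using (g_ξ' hw _).symm
  rw [h1.fderiv_eq, fderiv_g_apply hv ((contDiffAt_ξ hv).differentiableAt (by simp)) hY,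
    g_ξ' hv]

/-- The Reeb field has constant length. -/
lemma η_cov_ξ (x : E) : H.η v (cov H.Γ H.ξ v x) = 0 := by
  have h1 := fderiv_η_apply hv ((contDiffAt_ξ hv).differentiableAt (by simp)) x
  have h2 : (fun w ↦ H.η w (H.ξ w)) =ᶠ[𝓝 v] fun _ ↦ 1 := by
    filter_upwards [mem_nhds hv] with w hw using η_ξ hw
  rw [h2.fderiv_eq, g_ξ hv] at h1
  simp at h1
  linarith

lemma nablaφ_ξ (x : E) : H.nablaφ v x (H.ξ v) = -H.φ v (cov H.Γ H.ξ v x) := by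
  rw [← nablaφ_apply hv ((contDiffAt_ξ hv).differentiableAt (by simp))]
  have h2 : (fun w ↦ H.φ w (H.ξ w)) =ᶠ[𝓝 v] fun _ ↦ 0 := by
    filter_upwards [mem_nhds hv] with w hw using φ_ξ hw
  rw [cov_congr h2]
  simp [cov]

section F4F5

variable {a b : E → ℝ} (hF : H.IsF4F5 a b)
include hF

/-- In the class `𝓕₄ ⊕ 𝓕₅` the covariant derivative of the Reeb field is a combination of `φ` and
of the projection `h = -φ²`. -/
lemma cov_ξ (x : E) : cov H.Γ H.ξ v x = a v • H.φ v x + b v • (x - H.η v x • H.ξ v) := by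
  have h1 : H.φ v (cov H.Γ H.ξ v x) = a v • H.φ v (H.φ v x) + b v • H.φ v x := by
    apply eq_of_g_eq hv
    intro z
    have h2 := hF v hv x (H.ξ v) z
    rw [nablaφ_ξ hv, φ_ξ hv, η_ξ hv] at h2
    simp only [map_neg, map_zero, neg_apply] at h2
    simp only [map_add, map_smul, add_apply, smul_apply, smul_eq_mul]
    rw [φ_symm hv (H.φ v x) z, φ_symm hv x z]
    linarith
  have h3 := φ_φ hv (cov H.Γ H.ξ v x)
  rw [η_cov_ξ hv, h1, map_add, map_smul, map_smul, φ_φ hv (H.φ v x), η_φ hv, φ_φ hv] at h3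
  rw [zero_smul, add_zero, add_zero] at h3
  rw [← neg_inj, ← h3]
  module

lemma cov_ξ_ξ : cov H.Γ H.ξ v (H.ξ v) = 0 := by
  rw [cov_ξ hv hF, φ_ξ hv, η_ξ hv]
  simp

lemma φ_cov_ξ (x : E) : H.φ v (cov H.Γ H.ξ v x)
    = b v • H.φ v x - a v • (x - H.η v x • H.ξ v) := by
  rw [cov_ξ hv hF, map_add, map_smul, map_smul, map_sub, map_smul, φ_ξ hv, φ_φ hv]
  module

lemma nablaφ_ξ_left (y : E) : H.nablaφ v (H.ξ v) y = 0 := by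
  apply g_nondegenerate hv
  intro z
  rw [hF v hv, φ_ξ hv, g_ξ' hv, g_ξ' hv, η_φ hv, η_φ hv]
  simp

/-- In the class `𝓕₄ ⊕ 𝓕₅` the term `(∇_x φ) φy` of the canonical connection is a multiple of `ξ`.
-/
lemma nablaφ_φ (x y : E) :
    H.nablaφ v x (H.φ v y) = H.g v (cov H.Γ H.ξ v x) y • H.ξ v := by
  apply eq_of_g_eq hv
  intro z
  rw [hF v hv, η_φ hv, φ_φ hv, cov_ξ hv hF, map_smul, smul_apply, g_ξ' hv]
  simp only [map_add, map_smul, map_neg, map_sub, add_apply, smul_apply, sub_apply, smul_eq_mul,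
    g_ξ hv, g_ξ' hv, η_φ hv]
  ring

omit hF in
/-- The derivative of `ξ = sin t N + cos t JN`: its normal and tangential parts express `dt` and
`∇ξ` through the shape operator, since `J` is parallel. -/
lemma deriv_t_and_cov_ξ (x : E) :
    fderiv ℝ H.t v x = -2 * Real.cos (H.t v) * H.η v (H.A v x) ∧
    cov H.Γ H.ξ v x = Real.sin (H.t v) • (H.η v (H.A v x) • H.ξ v - H.A v x)
      - Real.cos (H.t v) • H.φ v (H.A v x) := by
  have hN := (H.smooth_N v hv).differentiableAt (by simp)
  have ht := (contDiffAt_t hv).differentiableAt (by simp)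
  have hIN := (contDiffAt_IN hv).differentiableAt (by simp)
  have hsin := (contDiffAt_sin hv).differentiableAt (by simp)
  have hcos := (contDiffAt_cos hv).differentiableAt (by simp)
  have h1 : (fun w ↦ H.D w (H.ξ w)) =ᶠ[𝓝 v] fun w ↦
      Real.sin (H.t w) • H.N w + Real.cos (H.t w) • H.I w (H.N w) := by
    filter_upwards [mem_nhds hv] with w hw using D_ξ hw
  have h2 := gauss_formula hv ((contDiffAt_ξ hv).differentiableAt (by simp)) x
  rw [cov_congr h1, cov_add (hsin.fun_smul hN) (hcos.fun_smul hIN), cov_smul hsin hN,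
    cov_smul hcos hIN, cov_I hv hN, fderiv_sin ht, fderiv_cos ht, g_ξ hv,
    ← neg_neg (cov H.P H.N v x), ← D_A hv] at h2
  have hT := cos_mul_B (H := H) (v := v)
  have hη := η_apply H v (H.A v x)
  have hc := cos_t_ne (H := H) (v := v)
  have htan : Real.tan (H.t v) * Real.cos (H.t v) = Real.sin (H.t v) := Real.tan_mul_cos cos_t_ne
  have hsc := Real.sin_sq_add_cos_sq (H.t v)
  have hdt : fderiv ℝ H.t v x = -2 * Real.cos (H.t v) * H.η v (H.A v x) := by
    have h3 := congrArg (fun w ↦ H.B v w (H.N v)) h2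
    simp only [map_add, map_smul, map_sub, map_neg, add_apply, smul_apply, sub_apply, neg_apply,
      smul_eq_mul, B_normal' hv, B_timelike hv] at h3
    rw [I_symm hv (H.N v), I_symm hv (H.D v _), B_symm H v (H.D v _)] at h3
    linear_combination (-Real.cos (H.t v)) * h3 - (fderiv ℝ H.t v x) * hsc
      - (Real.sin (H.t v) * fderiv ℝ H.t v x) * hT + Real.cos (H.t v) * hη
  refine ⟨hdt, ?_⟩
  apply eq_of_g_eq hv
  intro z
  have h3 := congrArg (fun w ↦ H.B v w (H.D v z)) h2
  have hηz := η_apply H v z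
  simp only [map_add, map_smul, map_sub, map_neg, add_apply, smul_apply, sub_apply, neg_apply,
      smul_eq_mul, B_normal hv, B_I_D hv, ← g_apply] at h3
  simp only [map_sub, map_smul, sub_apply, smul_apply, smul_eq_mul, g_ξ' hv]
  rw [hdt] at h3
  linear_combination -h3 - (2 * Real.sin (H.t v) * H.η v (H.A v x)) * hηz
    - (H.η v (H.A v x) * H.η v z) * htan

/-- The shape operator in the class `𝓕₄ ⊕ 𝓕₅`: its horizontal part solves the equation
`sin t A + cos t φA = -∇ξ`, and its component along `ξ` is fixed by self-adjointness. -/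
lemma A_eq (x : E) : H.A v x
    = -(b v * Real.sin (H.t v) + a v * Real.cos (H.t v)) • (x - H.η v x • H.ξ v)
      + (b v * Real.cos (H.t v) - a v * Real.sin (H.t v)) • H.φ v x
      + (H.η v (H.A v (H.ξ v)) * H.η v x) • H.ξ v := by
  have hsc := Real.sin_sq_add_cos_sq (H.t v)
  have key : ∀ x, H.A v x
      = -(b v * Real.sin (H.t v) + a v * Real.cos (H.t v)) • (x - H.η v x • H.ξ v)
      + (b v * Real.cos (H.t v) - a v * Real.sin (H.t v)) • H.φ v x
      + H.η v (H.A v x) • H.ξ v := by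
    intro x
    have h1 := (deriv_t_and_cov_ξ hv x).2
    have h2 := congrArg (H.φ v) h1
    rw [φ_cov_ξ hv hF] at h2
    rw [cov_ξ hv hF] at h1
    simp only [map_sub, map_smul, φ_ξ hv, φ_φ hv] at h2
    have h3 : (Real.sin (H.t v) ^ 2 + Real.cos (H.t v) ^ 2) • (H.A v x - H.η v (H.A v x) • H.ξ v)
        = -(b v * Real.sin (H.t v) + a v * Real.cos (H.t v)) • (x - H.η v x • H.ξ v)
          + (b v * Real.cos (H.t v) - a v * Real.sin (H.t v)) • H.φ v x := by
      linear_combination (norm := module) Real.sin (H.t v) • h1 - Real.cos (H.t v) • h2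
    rw [hsc, one_smul] at h3
    rw [← h3, sub_add_cancel]
  have h5 : H.η v (H.A v x) = H.η v (H.A v (H.ξ v)) * H.η v x := by
    have h6 := A_symm hv x (H.ξ v)
    rw [g_ξ hv, key (H.ξ v), η_ξ hv, φ_ξ hv] at h6
    simpa [g_ξ' hv] using h6
  rw [← h5, ← key x]

lemma g_A_eq (x z : E) : H.g v (H.A v x) z
    = -(b v * Real.sin (H.t v) + a v * Real.cos (H.t v)) * (H.g v x z - H.η v x * H.η v z)
      + (b v * Real.cos (H.t v) - a v * Real.sin (H.t v)) * H.g v x (H.φ v z)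
      + H.η v (H.A v (H.ξ v)) * H.η v x * H.η v z := by
  conv_lhs => rw [A_eq hv hF]
  simp only [map_add, map_sub, map_smul, add_apply, sub_apply, smul_apply, smul_eq_mul, g_ξ' hv,
    φ_symm hv]

lemma g_cov_ξ_eq (x z : E) : H.g v (cov H.Γ H.ξ v x) z
    = a v * H.g v x (H.φ v z) + b v * (H.g v x z - H.η v x * H.η v z) := by
  rw [cov_ξ hv hF]
  simp only [map_add, map_sub, map_smul, add_apply, sub_apply, smul_apply, smul_eq_mul, g_ξ' hv,
    φ_symm hv]

omit hF in
/-- The metric is nonzero on `ker η`, which is a nondegenerate subspace. -/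
lemma exists_horizontal_nonnull (hE : 2 ≤ Module.finrank ℝ E) :
    ∃ x, H.g v x x - H.η v x * H.η v x ≠ 0 := by
  by_contra! hcon
  have hpol : ∀ x y, H.g v x y = H.η v x * H.η v y := by
    intro x y
    have h1 := hcon (x + y)
    have h2 := hcon x
    have h3 := hcon y
    simp only [map_add, add_apply] at h1
    rw [H.g_symm v y x] at h1
    linarith
  have hker : ∃ x, x ≠ 0 ∧ H.η v x = 0 := by
    by_contra! h
    have hinj : Function.Injective (H.η v : E →ₗ[ℝ] ℝ) := by
      rw [injective_iff_map_eq_zero]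
      intro x hx
      by_contra hne
      exact h x hne hx
    have := LinearMap.finrank_le_finrank_of_injective hinj
    rw [Module.finrank_self] at this
    omega
  obtain ⟨x, hx, hη⟩ := hker
  exact hx (g_nondegenerate hv x fun y ↦ by rw [hpol, hη, zero_mul])

omit hF in
/-- The restrictions to `ker η` of the identity and of `φ` are linearly independent. -/
lemma coeff_eq_zero (hE : 2 ≤ Module.finrank ℝ E) {c d : ℝ}
    (h : ∀ x u, c * (H.g v x u - H.η v x * H.η v u) + d * H.g v x (H.φ v u) = 0) :
    c = 0 ∧ d = 0 := by
  obtain ⟨x, hx⟩ := exists_horizontal_nonnull hv hE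
  set Q := H.g v x x - H.η v x * H.η v x with hQ
  set R := H.g v x (H.φ v x) with hR
  have h1 : c * Q + d * R = 0 := h x x
  have h2 : c * R - d * Q = 0 := by
    have := h x (H.φ v x)
    rw [η_φ hv, ← φ_symm hv x (H.φ v x), g_φ_φ hv] at this
    linear_combination this
  have hpos : 0 < Q ^ 2 + R ^ 2 := by positivity
  -- The system has the determinant `-(Q² + R²)`.
  constructor
  · have : c * (Q ^ 2 + R ^ 2) = 0 := by linear_combination Q * h1 + R * h2
    exact (mul_eq_zero.1 this).resolve_right hpos.ne'
  · have : d * (Q ^ 2 + R ^ 2) = 0 := by linear_combination R * h1 - Q * h2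
    exact (mul_eq_zero.1 this).resolve_right hpos.ne'

/-- The coefficients of the class `𝓕₄ ⊕ 𝓕₅` are smooth, being determined by `∇ξ` through its
values on a vector with `g(hx, hx) ≠ 0`. -/
lemma contDiffAt_coeff (hE : 2 ≤ Module.finrank ℝ E) :
    ContDiffAt ℝ ∞ a v ∧ ContDiffAt ℝ ∞ b v := by
  obtain ⟨x, hx⟩ := exists_horizontal_nonnull hv hE
  have hg := contDiffAt_g hv
  have hηx : ContDiffAt ℝ ∞ (fun w ↦ H.η w x) v := (contDiffAt_η hv).clm_apply contDiffAt_const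
  have hφx : ContDiffAt ℝ ∞ (fun w ↦ H.φ w x) v := (contDiffAt_φ hv).clm_apply contDiffAt_const
  have hBx := contDiffAt_cov (contDiffAt_Γ hv) (contDiffAt_ξ hv) x
  have hQ : ContDiffAt ℝ ∞ (fun w ↦ H.g w x x - H.η w x * H.η w x) v :=
    ((hg.clm_apply contDiffAt_const).clm_apply contDiffAt_const).sub (hηx.mul hηx)
  have hR : ContDiffAt ℝ ∞ (fun w ↦ H.g w x (H.φ w x)) v :=
    (hg.clm_apply contDiffAt_const).clm_apply hφx
  have h1 : ContDiffAt ℝ ∞ (fun w ↦ H.g w (cov H.Γ H.ξ w x) x) v :=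
    (hg.clm_apply hBx).clm_apply contDiffAt_const
  have h2 : ContDiffAt ℝ ∞ (fun w ↦ H.g w (cov H.Γ H.ξ w x) (H.φ w x)) v :=
    (hg.clm_apply hBx).clm_apply hφx
  have hpos : (H.g v x x - H.η v x * H.η v x) ^ 2 + H.g v x (H.φ v x) ^ 2 ≠ 0 := by positivity
  have hden := (hQ.pow 2).add (hR.pow 2)
  have hnear : ∀ᶠ w in 𝓝 v, w ∈ H.U ∧
      (H.g w x x - H.η w x * H.η w x) ^ 2 + H.g w x (H.φ w x) ^ 2 ≠ 0 :=
    (mem_nhds hv).and (hden.continuousAt.eventually_ne hpos)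
  have e2 : ∀ w ∈ H.U, H.g w (cov H.Γ H.ξ w x) (H.φ w x)
      = -a w * (H.g w x x - H.η w x * H.η w x) + b w * H.g w x (H.φ w x) := by
    intro w hw
    rw [g_cov_ξ_eq hw hF, ← φ_symm hw x (H.φ w x), g_φ_φ hw, η_φ hw]
    ring
  constructor
  · refine (((hR.mul h1).sub (hQ.mul h2)).div hden hpos).congr_of_eventuallyEq ?_
    filter_upwards [hnear] with w hw
    simp only [Pi.div_apply]
    rw [eq_div_iff hw.2, e2 w hw.1, g_cov_ξ_eq hw.1 hF]
    ring
  · refine (((hQ.mul h1).add (hR.mul h2)).div hden hpos).congr_of_eventuallyEq ?_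
    filter_upwards [hnear] with w hw
    simp only [Pi.div_apply]
    rw [eq_div_iff hw.2, e2 w hw.1, g_cov_ξ_eq hw.1 hF]
    ring

/-- The curvature `R(x, ξ) ξ` of the induced metric in the class `𝓕₄ ⊕ 𝓕₅`. -/
lemma curv_ξ_ξ (hE : 2 ≤ Module.finrank ℝ E) (x : E) :
    curv H.Γ v x (H.ξ v) (H.ξ v)
      = (a v ^ 2 - b v ^ 2 - fderiv ℝ b v (H.ξ v)) • (x - H.η v x • H.ξ v)
        - (2 * a v * b v + fderiv ℝ a v (H.ξ v)) • H.φ v x := by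
  obtain ⟨ha, hb⟩ := contDiffAt_coeff hv hF hE
  have ha' := ha.differentiableAt (by simp)
  have hb' := hb.differentiableAt (by simp)
  have hξ' := (contDiffAt_ξ hv).differentiableAt (by simp)
  have hφ' := (contDiffAt_φ hv).differentiableAt (by simp)
  have hη' := (contDiffAt_η hv).differentiableAt (by simp)
  have key : ∀ x y, cov H.Γ (fun w ↦ cov H.Γ H.ξ w y) v x
      = fderiv ℝ a v x • H.φ v y + a v • (H.nablaφ v x y + H.φ v (H.Γ v x y))
        + (fderiv ℝ b v x • (y - H.η v y • H.ξ v)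
        + b v • (H.Γ v x y - ((H.g v (cov H.Γ H.ξ v x) y + H.η v (H.Γ v x y)) • H.ξ v
          + H.η v y • cov H.Γ H.ξ v x))) := by
    intro x y
    have hy : DifferentiableAt ℝ (fun _ : E ↦ y) v := differentiableAt_const y
    have h1 : (fun w ↦ cov H.Γ H.ξ w y) =ᶠ[𝓝 v]
        fun w ↦ a w • H.φ w y + b w • (y - H.η w y • H.ξ w) := by
      filter_upwards [mem_nhds hv] with w hw using cov_ξ hw hF y
    have hc : cov H.Γ (fun _ ↦ y) v x = H.Γ v x y := by simp [cov]
    have hφy : DifferentiableAt ℝ (fun w ↦ H.φ w y) v := hφ'.clm_apply hy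
    have hηy : DifferentiableAt ℝ (fun w ↦ H.η w y) v := hη'.clm_apply hy
    have hη : fderiv ℝ (fun w ↦ H.η w y) v x = _ := fderiv_η_apply hv hy x
    rw [cov_congr h1, cov_add (ha'.fun_smul hφy) (hb'.fun_smul (hy.fun_sub (hηy.fun_smul hξ'))),
      cov_smul ha' hφy, cov_smul hb' (hy.fun_sub (hηy.fun_smul hξ')),
      cov_sub hy (hηy.fun_smul hξ'), cov_smul hηy hξ', hη, hc, nablaφ]
    rw [sub_add_cancel]
  have hg := (contDiffAt_g hv).differentiableAt (by simp)
  have hs : H.Γ v (H.ξ v) x = H.Γ v x (H.ξ v) :=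
    christoffel_symm hg (g_isInvertible hv) (Eventually.of_forall H.g_symm) _ _
  have h := ricci_identity (contDiffAt_Γ hv) (contDiffAt_ξ hv) x (H.ξ v)
  rw [← h, key, key, hs, φ_ξ hv, η_ξ hv, cov_ξ_ξ hv hF, nablaφ_ξ_left hv hF, nablaφ_ξ hv,
    φ_cov_ξ hv hF, g_ξ hv, η_cov_ξ hv, cov_ξ hv hF]
  simp only [map_zero, zero_apply]
  module

end F4F5

end LocalHypersurface

/-! ### The canonical curvature tensor of a hypersurface of an open set -/

namespace LocalHypersurface

open Filter Topology

variable {E E' : Type*} [NormedAddCommGroup E] [NormedSpace ℝ E]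
  [NormedAddCommGroup E'] [NormedSpace ℝ E'] {H : LocalHypersurface E E'}
  [FiniteDimensional ℝ E] [FiniteDimensional ℝ E'] {v : E} (hv : v ∈ H.U)
include hv

/-- The form `η` is parallel for the connection `can`. -/
lemma η_can {W : E → E} (hW : DifferentiableAt ℝ W v) (x : E) :
    H.η v (H.can W v x) = fderiv ℝ (fun w ↦ H.η w (W w)) v x := by
  rw [fderiv_η_apply hv hW, can]
  simp only [map_add, map_sub, map_smul, smul_eq_mul, η_ξ hv, η_cov_ξ hv]
  ring

lemma contDiffAt_cov_ξ (y : E) : ContDiffAt ℝ ∞ (fun w ↦ cov H.Γ H.ξ w y) v :=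
  contDiffAt_cov (contDiffAt_Γ hv) (contDiffAt_ξ hv) y

lemma contDiffAt_can {W : E → E} (hW : ContDiffAt ℝ ∞ W v) (y : E) :
    ContDiffAt ℝ ∞ (fun w ↦ H.can W w y) v :=
  ((contDiffAt_cov (contDiffAt_Γ hv) hW y).add
    ((((contDiffAt_g hv).clm_apply (contDiffAt_cov_ξ hv y)).clm_apply hW).smul
      (contDiffAt_ξ hv))).sub (((contDiffAt_η hv).clm_apply hW).smul (contDiffAt_cov_ξ hv y))

/-- The curvature of the connection `can` in terms of the Riemannian curvature: the horizontal part
of the latter, corrected by a quadratic term in `∇ξ`. -/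
lemma g_can_can (x y z u : E) :
    H.g v (H.can (fun w ↦ H.can (fun _ ↦ z) w y) v x
        - H.can (fun w ↦ H.can (fun _ ↦ z) w x) v y) u
      = H.g v (curv H.Γ v x y z) u - H.η v z * H.g v (curv H.Γ v x y (H.ξ v)) u
        - H.η v u * H.g v (curv H.Γ v x y z) (H.ξ v)
        + H.η v z * H.η v u * H.g v (curv H.Γ v x y (H.ξ v)) (H.ξ v)
        + H.g v (cov H.Γ H.ξ v y) z * H.g v (cov H.Γ H.ξ v x) u
        - H.g v (cov H.Γ H.ξ v x) z * H.g v (cov H.Γ H.ξ v y) u := by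
  have hz : ∀ w, ContDiffAt ℝ ∞ (fun _ : E ↦ z) w := fun w ↦ contDiffAt_const
  have hηz : ContDiffAt ℝ ∞ (fun w ↦ H.η w z) v := (contDiffAt_η hv).clm_apply (hz v)
  -- The terms along `ξ` are collected in `S`; they are recovered below from the component along
  -- `ξ`, which is symmetric in `x` and `y` because `η` is parallel.
  have key : ∀ x y, ∃ S : ℝ, ∀ u, H.g v (H.can (fun w ↦ H.can (fun _ ↦ z) w y) v x) u
      = H.g v (cov H.Γ (fun w ↦ cov H.Γ (fun _ ↦ z) w y) v x) u
        + H.g v (cov H.Γ H.ξ v y) z * H.g v (cov H.Γ H.ξ v x) u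
        - fderiv ℝ (fun w ↦ H.η w z) v x * H.g v (cov H.Γ H.ξ v y) u
        - fderiv ℝ (fun w ↦ H.η w z) v y * H.g v (cov H.Γ H.ξ v x) u
        - H.η v z * H.g v (cov H.Γ (fun w ↦ cov H.Γ H.ξ w y) v x) u + S * H.η v u := by
    intro x y
    have h1 := (contDiffAt_cov (contDiffAt_Γ hv) (hz v) y).differentiableAt (by simp)
    have h2 := (((contDiffAt_g hv).clm_apply (contDiffAt_cov_ξ hv y)).clm_apply
      (hz v)).differentiableAt (by simp)
    have h3 := (contDiffAt_ξ hv).differentiableAt (by simp)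
    have h4 := hηz.differentiableAt (by simp)
    have h5 := (contDiffAt_cov_ξ hv y).differentiableAt (by simp)
    have h6 := η_can hv ((hz v).differentiableAt (by simp)) y
    refine ⟨fderiv ℝ (fun w ↦ H.g w (cov H.Γ H.ξ w y) z) v x
      + H.g v (cov H.Γ H.ξ v x) (H.can (fun _ ↦ z) v y), fun u ↦ ?_⟩
    rw [can, h6]
    have h7 : cov H.Γ (fun w ↦ H.can (fun _ ↦ z) w y) v x
        = cov H.Γ (fun w ↦ cov H.Γ (fun _ ↦ z) w y) v x
          + (fderiv ℝ (fun w ↦ H.g w (cov H.Γ H.ξ w y) z) v x • H.ξ v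
            + H.g v (cov H.Γ H.ξ v y) z • cov H.Γ H.ξ v x)
          - (fderiv ℝ (fun w ↦ H.η w z) v x • cov H.Γ H.ξ v y
            + H.η v z • cov H.Γ (fun w ↦ cov H.Γ H.ξ w y) v x) := by
      simp only [can]
      rw [cov_sub (h1.fun_add (h2.fun_smul h3)) (h4.fun_smul h5), cov_add h1 (h2.fun_smul h3),
        cov_smul h2 h3, cov_smul h4 h5]
    rw [h7]
    simp only [map_sub, map_add, map_smul, sub_apply, add_apply, smul_apply, smul_eq_mul, g_ξ' hv]
    ring
  have hξ : H.η v (H.can (fun w ↦ H.can (fun _ ↦ z) w y) v x)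
      = H.η v (H.can (fun w ↦ H.can (fun _ ↦ z) w x) v y) := by
    rw [η_can hv ((contDiffAt_can hv (hz v) y).differentiableAt (by simp)),
      η_can hv ((contDiffAt_can hv (hz v) x).differentiableAt (by simp))]
    have h1 : ∀ y, (fun w ↦ H.η w (H.can (fun _ ↦ z) w y)) =ᶠ[𝓝 v]
        fun w ↦ fderiv ℝ (fun w ↦ H.η w z) w y := fun y ↦ by
      filter_upwards [mem_nhds hv] with w hw
        using η_can hw ((hz w).differentiableAt (by simp)) y
    rw [(h1 x).fderiv_eq, (h1 y).fderiv_eq, fderiv_apply_symm hηz]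
  obtain ⟨S, hS⟩ := key x y
  obtain ⟨S', hS'⟩ := key y x
  have hz' := ricci_identity (contDiffAt_Γ hv) (hz v) x y
  have hξ' := ricci_identity (contDiffAt_Γ hv) (contDiffAt_ξ hv) x y
  have h1 := hS (H.ξ v)
  have h2 := hS' (H.ξ v)
  rw [g_ξ hv, g_ξ hv, g_ξ hv, g_ξ hv, g_ξ hv, η_cov_ξ hv, η_cov_ξ hv, η_ξ hv] at h1 h2
  rw [← hz', ← hξ']
  simp only [map_sub, sub_apply, hS, hS', g_ξ hv]
  linear_combination H.η v u * (h2 - h1 + hξ)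

lemma B_D_I_D (x y : E) : H.B v (H.D v x) (H.I v (H.D v y))
    = H.g v x (H.φ v y) + Real.tan (H.t v) * H.η v x * H.η v y := by
  rw [← I_symm hv, B_I_D hv, φ_symm hv]

/-- The curvature of the canonical connection of a hypersurface in the class `𝓕₄ ⊕ 𝓕₅`, the
ambient curvature being determined by constant totally real sectional curvatures `ν` and `ν'`. The
asserted expression contains the derivatives of `a`, `b` and `t` along `ξ`. They are eliminated by
comparing the two expressions for `R(x, ξ) ξ`, and the remaining formula is `hcan`. -/
theorem canonical_curvature {a b : E → ℝ} (hF : H.IsF4F5 a b) (hE : 2 ≤ Module.finrank ℝ E)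
    {ν ν' : ℝ}
    (hR : ∀ x y z u, H.B v (curv (christoffel H.G) (H.f v) x y z) u
      = ν * (H.B v y z * H.B v x u - H.B v x z * H.B v y u
          - (H.B v y (H.I v z) * H.B v x (H.I v u) - H.B v x (H.I v z) * H.B v y (H.I v u)))
        + ν' * (-(H.B v y z * H.B v x (H.I v u)) + H.B v x z * H.B v y (H.I v u)
          - H.B v y (H.I v z) * H.B v x u + H.B v x (H.I v z) * H.B v y u)) (x y z u : E) :
    H.g v (H.can (fun w ↦ H.can (fun _ ↦ z) w y) v x
        - H.can (fun w ↦ H.can (fun _ ↦ z) w x) v y) u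
      = (ν + b v ^ 2) * (H.g v y z * H.g v x u - H.g v x z * H.g v y u
          - (H.g v y (H.φ v z) * H.g v x (H.φ v u) - H.g v x (H.φ v z) * H.g v y (H.φ v u)))
        + (ν' - a v * b v) * (- H.g v y z * H.g v x (H.φ v u) + H.g v x z * H.g v y (H.φ v u)
          - H.g v y (H.φ v z) * H.g v x u + H.g v x (H.φ v z) * H.g v y u)
        - (ν' * Real.tan (H.t v) + fderiv ℝ H.t v (H.ξ v) * a v / 2
            + fderiv ℝ H.t v (H.ξ v) * b v / 2 * Real.tan (H.t v) - fderiv ℝ b v (H.ξ v)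
            + a v ^ 2)
          * (H.η v y * H.η v z * H.g v x u - H.η v x * H.η v z * H.g v y u
            + H.η v x * H.η v u * H.g v y z - H.η v y * H.η v u * H.g v x z)
        - (ν * Real.tan (H.t v) + fderiv ℝ H.t v (H.ξ v) * a v / 2 * Real.tan (H.t v)
            - fderiv ℝ H.t v (H.ξ v) * b v / 2 - fderiv ℝ a v (H.ξ v) - a v * b v)
          * (H.η v y * H.η v z * H.g v x (H.φ v u) - H.η v x * H.η v z * H.g v y (H.φ v u)
            + H.η v x * H.η v u * H.g v y (H.φ v z) - H.η v y * H.η v u * H.g v x (H.φ v z))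
        - (a v * Real.cos (H.t v) + b v * Real.sin (H.t v)) ^ 2
          * (H.g v y z * H.g v x u - H.g v x z * H.g v y u
          - (H.g v y (H.φ v z) * H.g v x (H.φ v u) - H.g v x (H.φ v z) * H.g v y (H.φ v u))
          - (H.η v y * H.η v z * H.g v x u - H.η v x * H.η v z * H.g v y u
            + H.η v x * H.η v u * H.g v y z - H.η v y * H.η v u * H.g v x z))
        + (a v * Real.sin (H.t v) - b v * Real.cos (H.t v))
          * (a v * Real.cos (H.t v) + b v * Real.sin (H.t v))
          * ((- H.g v y z * H.g v x (H.φ v u) + H.g v x z * H.g v y (H.φ v u)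
          - H.g v y (H.φ v z) * H.g v x u + H.g v x (H.φ v z) * H.g v y u)
          + (H.η v y * H.η v z * H.g v x (H.φ v u) - H.η v x * H.η v z * H.g v y (H.φ v u)
            + H.η v x * H.η v u * H.g v y (H.φ v z)
            - H.η v y * H.η v u * H.g v x (H.φ v z))) := by
  set T := Real.tan (H.t v) with hT
  set k := H.η v (H.A v (H.ξ v)) with hk
  set α := -(b v * Real.sin (H.t v) + a v * Real.cos (H.t v)) with hα
  set β := b v * Real.cos (H.t v) - a v * Real.sin (H.t v) with hβ
  have hTc : T * Real.cos (H.t v) = Real.sin (H.t v) := Real.tan_mul_cos cos_t_ne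
  have hA : ∀ x z, H.g v (H.A v x) z = α * (H.g v x z - H.η v x * H.η v z)
      + β * H.g v x (H.φ v z) + k * H.η v x * H.η v z := g_A_eq hv hF
  -- The curvature of the induced metric by the Gauss equation.
  have hgauss : ∀ x y z u, H.g v (curv H.Γ v x y z) u
      = ν * (H.g v y z * H.g v x u - H.g v x z * H.g v y u
          - ((H.g v y (H.φ v z) + T * H.η v y * H.η v z)
              * (H.g v x (H.φ v u) + T * H.η v x * H.η v u)
            - (H.g v x (H.φ v z) + T * H.η v x * H.η v z)
              * (H.g v y (H.φ v u) + T * H.η v y * H.η v u)))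
        + ν' * (-(H.g v y z * (H.g v x (H.φ v u) + T * H.η v x * H.η v u))
          + H.g v x z * (H.g v y (H.φ v u) + T * H.η v y * H.η v u)
          - (H.g v y (H.φ v z) + T * H.η v y * H.η v z) * H.g v x u
          + (H.g v x (H.φ v z) + T * H.η v x * H.η v z) * H.g v y u)
        - (α * (H.g v y z - H.η v y * H.η v z)
            + β * H.g v y (H.φ v z) + k * H.η v y * H.η v z)
          * (α * (H.g v x u - H.η v x * H.η v u)
            + β * H.g v x (H.φ v u) + k * H.η v x * H.η v u)
        + (α * (H.g v x z - H.η v x * H.η v z)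
            + β * H.g v x (H.φ v z) + k * H.η v x * H.η v z)
          * (α * (H.g v y u - H.η v y * H.η v u)
            + β * H.g v y (H.φ v u) + k * H.η v y * H.η v u) := fun x y z u ↦ by
    have h := gauss_equation hv x y z u
    have h' := curv_pullForm (contDiffAt_christoffel_G hv) (H.smooth_f v hv) x y (H.D v z)
    rw [P, h'] at h
    change H.B v (curv (christoffel H.G) (H.f v) (H.D v x) (H.D v y) (H.D v z)) _ = _ at h
    rw [hR] at h
    simp only [B_D_I_D hv, ← g_apply, ← hT, hA] at h
    linear_combination -h
  -- The component `R(x, ξ, ξ, u)` determines the derivatives of `a` and `b` along `ξ`.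
  have hcoeff := coeff_eq_zero hv hE
    (c := a v ^ 2 - b v ^ 2 - fderiv ℝ b v (H.ξ v) + k * α - ν + ν' * T)
    (d := -(2 * a v * b v + fderiv ℝ a v (H.ξ v)) + k * β + ν * T + ν') fun x u ↦ by
      have h := hgauss x (H.ξ v) (H.ξ v) u
      rw [curv_ξ_ξ hv hF hE] at h
      simp only [map_sub, map_smul, sub_apply, smul_apply, smul_eq_mul, g_ξ' hv, g_ξ hv, φ_ξ hv,
        η_ξ hv, map_zero, η_φ hv, φ_symm hv] at h
      linear_combination h
  obtain ⟨hb, ha⟩ := hcoeff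
  have hdt : fderiv ℝ H.t v (H.ξ v) = -2 * Real.cos (H.t v) * k := (deriv_t_and_cov_ξ hv _).1
  rw [hdt]
  have hcan : H.g v (H.can (fun w ↦ H.can (fun _ ↦ z) w y) v x
        - H.can (fun w ↦ H.can (fun _ ↦ z) w x) v y) u
      = (ν + b v ^ 2 - α ^ 2) * (H.g v y z * H.g v x u - H.g v x z * H.g v y u
          - (H.g v y (H.φ v z) * H.g v x (H.φ v u) - H.g v x (H.φ v z) * H.g v y (H.φ v u))
          - (H.η v y * H.η v z * H.g v x u - H.η v x * H.η v z * H.g v y u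
            + H.η v x * H.η v u * H.g v y z - H.η v y * H.η v u * H.g v x z))
        + (ν' + α * β - a v * b v)
          * ((- H.g v y z * H.g v x (H.φ v u) + H.g v x z * H.g v y (H.φ v u)
          - H.g v y (H.φ v z) * H.g v x u + H.g v x (H.φ v z) * H.g v y u)
          + (H.η v y * H.η v z * H.g v x (H.φ v u) - H.η v x * H.η v z * H.g v y (H.φ v u)
            + H.η v x * H.η v u * H.g v y (H.φ v z)
            - H.η v y * H.η v u * H.g v x (H.φ v z))) := by
    have hab : α ^ 2 + β ^ 2 = a v ^ 2 + b v ^ 2 := by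
      have hsc := Real.sin_sq_add_cos_sq (H.t v)
      rw [hα, hβ]
      linear_combination (a v ^ 2 + b v ^ 2) * hsc
    rw [g_can_can hv]
    simp only [hgauss, g_cov_ξ_eq hv hF, g_ξ hv, φ_ξ hv, η_ξ hv, map_zero]
    linear_combination (-(H.g v y (H.φ v z) * H.g v x (H.φ v u)
      - H.g v x (H.φ v z) * H.g v y (H.φ v u))) * hab
  rw [hcan]
  have hb' : fderiv ℝ b v (H.ξ v) = a v ^ 2 - b v ^ 2 + k * α - ν + ν' * T := by
    linear_combination -hb
  have ha' : fderiv ℝ a v (H.ξ v) = -(2 * a v * b v) + k * β + ν * T + ν' := by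
    linear_combination -ha
  rw [hb', ha', hα, hβ]
  linear_combination (k * b v * (H.η v y * H.η v z * H.g v x u - H.η v x * H.η v z * H.g v y u
            + H.η v x * H.η v u * H.g v y z - H.η v y * H.η v u * H.g v x z)
      + k * a v * (H.η v y * H.η v z * H.g v x (H.φ v u) - H.η v x * H.η v z * H.g v y (H.φ v u)
            + H.η v x * H.η v u * H.g v y (H.φ v z)
            - H.η v y * H.η v u * H.g v x (H.φ v z))) * (-hTc)

end LocalHypersurface

/-! ### Curvature-like tensors of Kähler type -/

section KaehlerCurvature

variable {V : Type*} [AddCommGroup V] [Module ℝ V]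

omit [AddCommGroup V] [Module ℝ V] in
/-- The pair symmetry of a tensor with the antisymmetries of a curvature tensor and the first
Bianchi identity. -/
lemma pair_symm_of_bianchi {Q : V → V → V → V → ℝ} (h₁ : ∀ x y z u, Q x y z u = -Q y x z u)
    (h₂ : ∀ x y z u, Q x y z u = -Q x y u z)
    (h₃ : ∀ x y z u, Q x y z u + Q y z x u + Q z x y u = 0) (x y z u : V) :
    Q x y z u = Q z u x y := by
  linarith [h₃ x y z u, h₃ y z u x, h₃ z u x y, h₃ u x y z, h₁ x y z u, h₁ y z x u, h₁ z x y u,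
    h₁ y z u x, h₁ z u y x, h₁ u y z x, h₁ z u x y, h₁ u x z y, h₁ x z u y, h₁ u x y z,
    h₁ x y u z, h₁ y u x z, h₂ x y z u, h₂ y z x u, h₂ z x y u,
    h₂ y z u x, h₂ z u y x, h₂ u y z x, h₂ z u x y, h₂ u x z y, h₂ x z u y, h₂ u x y z,
    h₂ x y u z, h₂ y u x z]

/-- A tensor with the algebraic properties of the curvature tensor of a Kähler manifold with Norden
metric and complex structure `I`: its complexification is complex multilinear. -/
structure IsKaehlerCurvature (I : V →ₗ[ℝ] V) (Q : V → V → V → V → ℝ) : Prop where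
  add : ∀ x y z u u', Q x y z (u + u') = Q x y z u + Q x y z u'
  smul : ∀ (c : ℝ) x y z u, Q x y z (c • u) = c * Q x y z u
  antisymm_left : ∀ x y z u, Q x y z u = -Q y x z u
  antisymm_right : ∀ x y z u, Q x y z u = -Q x y u z
  bianchi : ∀ x y z u, Q x y z u + Q y z x u + Q z x y u = 0
  complex : ∀ x y z u, Q x y (I z) u = Q x y z (I u)

namespace IsKaehlerCurvature

variable {I : V →ₗ[ℝ] V} {Q : V → V → V → V → ℝ} (hQ : IsKaehlerCurvature I Q)
include hQ

lemma pair_symm (x y z u : V) : Q x y z u = Q z u x y :=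
  pair_symm_of_bianchi hQ.antisymm_left hQ.antisymm_right hQ.bianchi x y z u

lemma add₃ (x y z z' u : V) : Q x y (z + z') u = Q x y z u + Q x y z' u := by
  rw [hQ.antisymm_right, hQ.add, hQ.antisymm_right x y z, hQ.antisymm_right x y z']; ring

lemma add₂ (x y y' z u : V) : Q x (y + y') z u = Q x y z u + Q x y' z u := by
  rw [hQ.pair_symm, hQ.add, hQ.pair_symm z u, hQ.pair_symm z u]

lemma add₁ (x x' y z u : V) : Q (x + x') y z u = Q x y z u + Q x' y z u := by
  rw [hQ.pair_symm, hQ.add₃, hQ.pair_symm z u, hQ.pair_symm z u]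

lemma smul₃ (c : ℝ) (x y z u : V) : Q x y (c • z) u = c * Q x y z u := by
  rw [hQ.antisymm_right, hQ.smul, hQ.antisymm_right x y z]; ring

lemma smul₂ (c : ℝ) (x y z u : V) : Q x (c • y) z u = c * Q x y z u := by
  rw [hQ.pair_symm, hQ.smul, hQ.pair_symm z u]

lemma smul₁ (c : ℝ) (x y z u : V) : Q (c • x) y z u = c * Q x y z u := by
  rw [hQ.pair_symm, hQ.smul₃, hQ.pair_symm z u]

/-- Complex linearity in the first pair: the tensor `Q(x, y, z, Iu)` also has the symmetries of a
curvature tensor, hence pair symmetry. -/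
lemma complex₂ (x y z u : V) : Q x (I y) z u = Q x y z (I u) := by
  have h := pair_symm_of_bianchi (Q := fun x y z u ↦ Q x y z (I u))
    (fun x y z u ↦ hQ.antisymm_left x y z (I u))
    (fun x y z u ↦ by rw [hQ.antisymm_right, hQ.complex])
    (fun x y z u ↦ hQ.bianchi x y z (I u)) x y z u
  rw [hQ.pair_symm]
  exact h.symm

lemma complex₁ (x y z u : V) : Q (I x) y z u = Q x y z (I u) := by
  rw [hQ.antisymm_left, hQ.complex₂, hQ.antisymm_left y x, neg_neg]

lemma neg (x y z u : V) : Q x y z (-u) = -Q x y z u := by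
  simpa using hQ.smul (-1) x y z u

lemma self_left (x z u : V) : Q x x z u = 0 := by linarith [hQ.antisymm_left x x z u]

lemma self_right (x y z : V) : Q x y z z = 0 := by linarith [hQ.antisymm_right x y z z]

/-- A curvature tensor is determined by its sectional curvatures. -/
lemma eq_zero_of_sectional (h : ∀ x y, Q x y y x = 0) (x y z u : V) : Q x y z u = 0 := by
  have h1 : ∀ x y u, Q x y y u = 0 := by
    intro x y u
    have h2 := h (x + u) y
    rw [hQ.add₁, hQ.add, hQ.add, h, h, hQ.pair_symm u y y x, hQ.antisymm_left y x,
      hQ.antisymm_right x y u y] at h2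
    linarith
  have h3 : ∀ x y z u, Q x y z u = -Q x z y u := by
    intro x y z u
    have h2 := h1 x (y + z) u
    rw [hQ.add₂, hQ.add₃, hQ.add₃, h1, h1] at h2
    linarith
  linarith [hQ.bianchi x y z u, h3 x y z u, hQ.antisymm_left z x y u, h3 y z x u,
    hQ.antisymm_left y x z u]

end IsKaehlerCurvature

/-- Scalar multiplication by complex numbers defined by the complex structure `I`. -/
def complexSmul (I : V →ₗ[ℝ] V) (c : ℂ) (x : V) : V := c.re • x + c.im • I x

/-- The complex bilinear form with real part `B`, for `I` self-adjoint with respect to `B`. -/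
def complexForm (I : V →ₗ[ℝ] V) (B : V →ₗ[ℝ] V →ₗ[ℝ] ℝ) (x y : V) : ℂ := ⟨B x y, -B x (I y)⟩

/-- The complex sectional curvature `Q(x, y, y, x) - i Q(x, y, y, Ix)` of the pair `x, y`. -/
def complexSectional (I : V →ₗ[ℝ] V) (Q : V → V → V → V → ℝ) (x y : V) : ℂ :=
  ⟨Q x y y x, -Q x y y (I x)⟩

/-- A density argument: if `q₀ + s q₁` vanishes for all real `s ≠ 0` that are not the root of the
non-constant polynomial `d₁ + s d₂`, then `q₀ = 0`. -/
lemma eq_zero_of_forall_or {q₀ q₁ d₁ d₂ : ℂ} (hd : d₂ ≠ 0)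
    (h : ∀ s : ℝ, s ≠ 0 → d₁ + s * d₂ = 0 ∨ q₀ + s * q₁ = 0) : q₀ = 0 := by
  -- At most one of the three values is a root of `d₁ + s d₂`.
  have h1 := h 1 (by norm_num)
  have h2 := h 2 (by norm_num)
  have h3 := h 3 (by norm_num)
  push_cast at h1 h2 h3
  rcases h1 with h1 | h1 <;> rcases h2 with h2 | h2 <;> rcases h3 with h3 | h3
  · exact absurd (by linear_combination h2 - h1) hd
  · exact absurd (by linear_combination h2 - h1) hd
  · exact absurd (by linear_combination (h3 - h1) / 2) hd
  · linear_combination 3 * h2 - 2 * h3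
  · exact absurd (by linear_combination h3 - h2) hd
  · linear_combination (3 * h1 - h3) / 2
  · linear_combination 2 * h1 - h2
  · linear_combination 2 * h1 - h2

section Complex

variable {I : V →ₗ[ℝ] V} {B : V →ₗ[ℝ] V →ₗ[ℝ] ℝ} {Q : V → V → V → V → ℝ}

local notation "G" => complexForm I B
local notation "q" => complexSectional I Q

lemma complexForm_add_left (x x' y : V) : G (x + x') y = G x y + G x' y := by
  apply Complex.ext <;> simp [complexForm]; ring

lemma complexForm_add_right (x y y' : V) : G x (y + y') = G x y + G x y' := by
  apply Complex.ext <;> simp [complexForm]; ring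

lemma complexForm_real_smul_left (s : ℝ) (x y : V) : G (s • x) y = s * G x y := by
  apply Complex.ext <;> simp [complexForm]

lemma complexForm_real_smul_right (s : ℝ) (x y : V) : G x (s • y) = s * G x y := by
  apply Complex.ext <;> simp [complexForm]

variable (hI : ∀ x, I (I x) = -x) (hs : ∀ x y, B x y = B y x) (hIs : ∀ x y, B (I x) y = B x (I y))

include hs hIs in
lemma complexForm_symm (x y : V) : G x y = G y x := by
  apply Complex.ext
  · exact hs x y
  · simp only [complexForm]
    rw [hs, hIs]

include hI hIs in
lemma complexForm_smul_left (c : ℂ) (x y : V) : G (complexSmul I c x) y = c * G x y := by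
  apply Complex.ext <;> simp [complexForm, complexSmul, hIs, hI]
  ring

include hI hs hIs in
lemma complexForm_smul_right (c : ℂ) (x y : V) : G x (complexSmul I c y) = c * G x y := by
  rw [complexForm_symm hs hIs, complexForm_smul_left hI hIs, complexForm_symm hs hIs]

variable (hQ : IsKaehlerCurvature I Q)

include hI hQ in
lemma complexSectional_smul_left (c : ℂ) (x y : V) :
    q (complexSmul I c x) y = c ^ 2 * q x y := by
  apply Complex.ext <;>
  simp only [complexSectional, complexSmul, map_add, map_smul, hI, hQ.neg, hQ.add, hQ.smul,
    hQ.add₁, hQ.smul₁, hQ.complex₁, pow_two, Complex.mul_re, Complex.mul_im] <;> ring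

include hQ in
lemma complexSectional_symm (x y : V) : q x y = q y x := by
  apply Complex.ext <;> simp only [complexSectional]
  · rw [hQ.pair_symm]
  · rw [← hQ.complex₁ x y y x, hQ.pair_symm, ← hQ.complex y x x y]

include hI hQ in
lemma complexSectional_smul_right (c : ℂ) (x y : V) :
    q x (complexSmul I c y) = c ^ 2 * q x y := by
  rw [complexSectional_symm hQ, complexSectional_smul_left hI hQ, complexSectional_symm hQ]

include hI hQ in
lemma complexSectional_shear (c : ℂ) (x y : V) : q x (y + complexSmul I c x) = q x y := by
  have h1 : ∀ u, Q x (I x) y u = 0 := fun u ↦ by rw [hQ.complex₂, hQ.self_left]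
  have h2 : Q x y x (I x) = 0 := by linarith [hQ.complex x y x x, hQ.antisymm_right x y x (I x)]
  apply Complex.ext <;>
  simp only [complexSectional, complexSmul, hQ.add₂, hQ.add₃, hQ.smul₂, hQ.smul₃, hQ.complex₂,
    hQ.complex, hI, hQ.neg, hQ.self_left, hQ.self_right, h2] <;> ring

/-- A complex curvature tensor whose sectional curvature vanishes on orthonormal pairs is zero.
Pairs spanning a nondegenerate plane with non-null first vector reduce to orthonormal ones,
complex square roots being available; the other pairs are limits of such. The real dimension is at
least `3`, so that the complex orthogonal complement of a vector is not zero. -/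
lemma IsKaehlerCurvature.eq_zero [FiniteDimensional ℝ V] (hdim : 3 ≤ Module.finrank ℝ V)
    (hQ : IsKaehlerCurvature I Q) (hI : ∀ x, I (I x) = -x) (hs : ∀ x y, B x y = B y x)
    (hIs : ∀ x y, B (I x) y = B x (I y)) (hB : ∀ x, (∀ y, B x y = 0) → x = 0)
    (h : ∀ x y, G x x = 1 → G y y = 1 → G x y = 0 → q x y = 0) (x y z u : V) :
    Q x y z u = 0 := by
  have hGs := complexForm_symm hs hIs
  -- Orthogonal pairs of non-null vectors can be normalized.
  have h1 : ∀ x y, G x x ≠ 0 → G y y ≠ 0 → G x y = 0 → q x y = 0 := by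
    intro x y hx hy hxy
    obtain ⟨c, hc⟩ := IsAlgClosed.exists_pow_nat_eq (G x x)⁻¹ two_pos
    obtain ⟨d, hd⟩ := IsAlgClosed.exists_pow_nat_eq (G y y)⁻¹ two_pos
    have h2 := h (complexSmul I c x) (complexSmul I d y)
      (by rw [complexForm_smul_left hI hIs, complexForm_smul_right hI hs hIs, ← mul_assoc,
        ← pow_two, hc, inv_mul_cancel₀ hx])
      (by rw [complexForm_smul_left hI hIs, complexForm_smul_right hI hs hIs, ← mul_assoc,
        ← pow_two, hd, inv_mul_cancel₀ hy])
      (by rw [complexForm_smul_left hI hIs, complexForm_smul_right hI hs hIs, hxy]; simp)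
    rw [complexSectional_smul_left hI hQ, complexSectional_smul_right hI hQ, hc, hd] at h2
    simpa [hx, hy] using h2
  -- The orthogonal projection of `y` on the complement of `x`.
  have hproj : ∀ x y, G x x ≠ 0 → G x (y + complexSmul I (-(G x y / G x x)) x) = 0 := by
    intro x y hx
    rw [complexForm_add_right, complexForm_smul_right hI hs hIs]
    field_simp
    ring
  have h2 : ∀ x y, G x x ≠ 0 → G x x * G y y - G x y ^ 2 ≠ 0 → q x y = 0 := by
    intro x y hx hxy
    rw [← complexSectional_shear hI hQ (-(G x y / G x x)) x y]
    refine h1 _ _ hx ?_ (hproj x y hx)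
    rw [complexForm_add_left, complexForm_smul_left hI hIs, hproj x y hx, complexForm_add_right,
      complexForm_smul_right hI hs hIs, hGs y x]
    intro h0
    apply hxy
    field_simp at h0
    linear_combination h0
  -- There are non-null vectors, also orthogonal to a given one.
  have hex : ∀ w, w ≠ 0 → ∃ z, G w z ≠ 0 := by
    intro w hw
    by_contra! hcon
    exact hw (hB w fun z ↦ congrArg Complex.re (hcon z))
  have hpol : ∀ w z, G w w = 0 → G z z = 0 → G w z ≠ 0 → G (w + z) (w + z) ≠ 0 := by
    intro w z hw hz hwz
    rw [complexForm_add_left, complexForm_add_right, complexForm_add_right, hw, hz, hGs z w]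
    simpa [← two_mul] using hwz
  have hpos : 0 < Module.finrank ℝ V := by omega
  obtain ⟨x₀, hx₀⟩ : ∃ x, G x x ≠ 0 := by
    have := Module.finrank_pos_iff.1 hpos
    obtain ⟨w, hw⟩ := exists_ne (0 : V)
    obtain ⟨z, hz⟩ := hex w hw
    by_contra! hcon
    exact hpol w z (hcon w) (hcon z) hz (hcon _)
  have hex₂ : ∀ x, G x x ≠ 0 → ∃ y, G x y = 0 ∧ G y y ≠ 0 := by
    intro x hx
    obtain ⟨w, hw0, hw⟩ : ∃ w, w ≠ 0 ∧ G x w = 0 := by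
      let T : V →ₗ[ℝ] ℝ × ℝ := (B x).prod (B x ∘ₗ I)
      by_contra! hcon
      have hinj : Function.Injective T := by
        rw [injective_iff_map_eq_zero]
        intro w hw
        by_contra hw0
        apply hcon w hw0
        have h3 : B x w = 0 := congrArg Prod.fst hw
        have h4 : B x (I w) = 0 := congrArg Prod.snd hw
        apply Complex.ext <;> simp [complexForm, h3, h4]
      have := LinearMap.finrank_le_finrank_of_injective hinj
      rw [Module.finrank_prod, Module.finrank_self] at this
      omega
    obtain ⟨z, hz⟩ := hex w hw0
    set z' := z + complexSmul I (-(G x z / G x x)) x with hz'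
    have hxz : G x z' = 0 := hproj x z hx
    have hwz : G w z' ≠ 0 := by
      rw [hz', complexForm_add_right, complexForm_smul_right hI hs hIs, hGs w x, hw]
      simpa using hz
    by_contra! hcon
    refine hpol w z' (hcon w hw) (hcon z' hxz) hwz (hcon _ ?_)
    rw [complexForm_add_right, hw, hxz, add_zero]
  -- Perturbing the second vector, the sectional curvature is a quadratic polynomial.
  have hquad : ∀ x y y' : V, ∃ c : ℂ, ∀ s : ℝ,
      q x (y + s • y') = q x y + s * c + s ^ 2 * q x y' := by
    intro x y y'
    refine ⟨⟨Q x y y' x + Q x y' y x, -(Q x y y' (I x) + Q x y' y (I x))⟩, fun s ↦ ?_⟩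
    apply Complex.ext <;>
    simp [complexSectional, hQ.add₂, hQ.add₃, hQ.smul₂, hQ.smul₃, pow_two] <;> ring
  -- Degenerate planes: perturb `y` in a direction orthogonal to `x`.
  have h3 : ∀ x y, G x x ≠ 0 → q x y = 0 := by
    intro x y hx
    by_contra hxy
    obtain ⟨y', hxy', hy'⟩ := hex₂ x hx
    obtain ⟨c, hc⟩ := hquad x y y'
    have hd0 : G x x * G y y - G x y ^ 2 = 0 := by
      by_contra hd
      exact hxy (h2 x y hx hd)
    apply hxy
    refine eq_zero_of_forall_or (q₁ := c) (d₁ := 2 * (G x x * G y y'))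
      (mul_ne_zero hx hy') fun s hs0 ↦ ?_
    by_cases hd : G x x * G (y + s • y') (y + s • y') - G x (y + s • y') ^ 2 = 0
    · left
      rw [complexForm_add_left, complexForm_add_right, complexForm_add_right, complexForm_add_right,
        complexForm_real_smul_left, complexForm_real_smul_left, complexForm_real_smul_right,
        complexForm_real_smul_right, complexForm_real_smul_right, hxy', hGs y' y] at hd
      have hs' : (s : ℂ) ≠ 0 := by exact_mod_cast hs0
      apply mul_left_cancel₀ hs'
      linear_combination hd - hd0
    · right
      rw [← h2 x _ hx hd, hc, h1 x y' hx hy' hxy']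
      ring
  -- Null vectors `x`: perturb `x` in a direction `x₀` that is not null.
  have h4 : ∀ x y, q x y = 0 := by
    intro x y
    by_contra hxy
    have hx : G x x = 0 := by
      by_contra hx
      exact hxy (h3 x y hx)
    obtain ⟨c, hc⟩ := hquad y x x₀
    apply hxy
    refine eq_zero_of_forall_or (q₁ := c) (d₁ := 2 * G x x₀) hx₀ fun s hs0 ↦ ?_
    by_cases hd : G (x + s • x₀) (x + s • x₀) = 0
    · left
      rw [complexForm_add_left, complexForm_add_right, complexForm_add_right,
        complexForm_real_smul_left, complexForm_real_smul_left, complexForm_real_smul_right,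
        complexForm_real_smul_right, hx, hGs x₀ x] at hd
      have hs' : (s : ℂ) ≠ 0 := by exact_mod_cast hs0
      apply mul_left_cancel₀ hs'
      linear_combination hd
    · right
      rw [← h3 _ y hd, complexSectional_symm hQ (x + s • x₀) y, hc, complexSectional_symm hQ y x₀,
        h3 x₀ y hx₀, complexSectional_symm hQ y x]
      ring
  exact hQ.eq_zero_of_sectional (fun x y ↦ congrArg Complex.re (h4 x y)) x y z u

end Complex

end KaehlerCurvature

/-! ### The curvature of constant totally real sectional curvatures -/

section RiemannCurvature

open Filter Topology

variable {E : Type*} [NormedAddCommGroup E] [NormedSpace ℝ E]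

lemma curv_antisymm {F : Type*} [NormedAddCommGroup F] [NormedSpace ℝ F]
    (P : E → E →L[ℝ] F →L[ℝ] F) (v x y : E) (w : F) : curv P v x y w = -curv P v y x w := by
  simp only [curv]
  abel

lemma eventually_isInvertible [CompleteSpace E] {G : E → E →L[ℝ] E →L[ℝ] ℝ} {v : E}
    (hG : ContinuousAt G v) (hi : (G v).IsInvertible) : ∀ᶠ w in 𝓝 v, (G w).IsInvertible := by
  obtain ⟨e, he⟩ := hi
  have h := ContinuousLinearEquiv.nhds e
  rw [he] at h
  filter_upwards [hG h] with w hw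
  obtain ⟨e', he'⟩ := hw
  exact ⟨e', he'⟩

variable {G : E → E →L[ℝ] E →L[ℝ] ℝ} {v : E} (hs : ∀ w x y, G w x y = G w y x)
include hs

lemma fderiv_metric_apply (hG : DifferentiableAt ℝ G v) (hi : (G v).IsInvertible) {Y Z : E → E}
    (hY : DifferentiableAt ℝ Y v) (hZ : DifferentiableAt ℝ Z v) (x : E) :
    fderiv ℝ (fun w ↦ G w (Y w) (Z w)) v x
      = G v (cov (christoffel G) Y v x) (Z v) + G v (Y v) (cov (christoffel G) Z v x) := by
  rw [fderiv_clm₂_apply hG hY hZ, christoffel_compat hG hi (Eventually.of_forall hs)]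
  simp only [cov, map_add, add_apply]
  ring

variable [CompleteSpace E] (hG : ContDiffAt ℝ ∞ G v) (hi : (G v).IsInvertible)
include hG hi

lemma curv_christoffel_bianchi (x y z : E) :
    curv (christoffel G) v x y z + curv (christoffel G) v y z x + curv (christoffel G) v z x y
      = 0 := by
  have hΓ := (contDiffAt_christoffel hG hi).differentiableAt (by simp)
  have hsymm : ∀ᶠ w in 𝓝 v, ∀ y z, christoffel G w y z = christoffel G w z y := by
    filter_upwards [eventually_isInvertible hG.continuousAt hi,
      (hG.of_le (by simp : (1 : WithTop ℕ∞) ≤ ∞)).eventually (by simp)] with w hw hw' y z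
    exact christoffel_symm (hw'.differentiableAt (by simp)) hw (Eventually.of_forall hs) y z
  have hd : ∀ x y z, fderiv ℝ (christoffel G) v x y z = fderiv ℝ (christoffel G) v x z y := by
    intro x y z
    have h : ∀ y z, fderiv ℝ (fun w ↦ christoffel G w y z) v x
        = fderiv ℝ (christoffel G) v x y z := by
      intro y z
      rw [fderiv_clm₂_apply hΓ (by fun_prop) (by fun_prop)]
      simp
    rw [← h, ← h]
    congr 1
    apply Filter.EventuallyEq.fderiv_eq
    filter_upwards [hsymm] with w hw using hw y z
  have h0 := hsymm.self_of_nhds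
  simp only [curv]
  rw [hd x z y, hd y x z, hd z y x, h0 y z, h0 z x, h0 x y]
  abel

/-- The curvature of a metric connection takes values in the skew-adjoint endomorphisms. -/
lemma curv_christoffel_skew (x y z u : E) :
    G v (curv (christoffel G) v x y z) u + G v z (curv (christoffel G) v x y u) = 0 := by
  have hΓ := contDiffAt_christoffel hG hi
  have hf : ContDiffAt ℝ ∞ (fun w ↦ G w z u) v :=
    (hG.clm_apply contDiffAt_const).clm_apply contDiffAt_const
  have hconst : ∀ z : E, ∀ w, DifferentiableAt ℝ (fun _ : E ↦ z) w :=
    fun z w ↦ differentiableAt_const z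
  have key : ∀ x y, fderiv ℝ (fun w ↦ fderiv ℝ (fun w ↦ G w z u) w y) v x
      = G v (cov (christoffel G) (fun w ↦ cov (christoffel G) (fun _ ↦ z) w y) v x) u
        + G v (cov (christoffel G) (fun _ ↦ z) v y) (cov (christoffel G) (fun _ ↦ u) v x)
        + (G v (cov (christoffel G) (fun _ ↦ z) v x) (cov (christoffel G) (fun _ ↦ u) v y)
        + G v z (cov (christoffel G) (fun w ↦ cov (christoffel G) (fun _ ↦ u) w y) v x)) := by
    intro x y
    have h1 : (fun w ↦ fderiv ℝ (fun w ↦ G w z u) w y) =ᶠ[𝓝 v] fun w ↦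
        G w (cov (christoffel G) (fun _ ↦ z) w y) u
          + G w z (cov (christoffel G) (fun _ ↦ u) w y) := by
      filter_upwards [eventually_isInvertible hG.continuousAt hi,
        (hG.of_le (by simp : (1 : WithTop ℕ∞) ≤ ∞)).eventually (by simp)] with w hw hw'
      exact fderiv_metric_apply hs (hw'.differentiableAt (by simp)) hw (hconst z w) (hconst u w) y
    have hc : ∀ z, DifferentiableAt ℝ (fun w ↦ cov (christoffel G) (fun _ ↦ z) w y) v :=
      fun z ↦ (contDiffAt_cov hΓ contDiffAt_const y).differentiableAt (by simp)
    have hG' := hG.differentiableAt (by simp)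
    rw [h1.fderiv_eq, fderiv_fun_add ((hG'.clm_apply (hc z)).clm_apply (hconst u v))
      ((hG'.clm_apply (hconst z v)).clm_apply (hc u)), add_apply,
      fderiv_metric_apply hs hG' hi (hc z) (hconst u v),
      fderiv_metric_apply hs hG' hi (hconst z v) (hc u)]
  have h1 := fderiv_apply_symm hf x y
  rw [key, key] at h1
  rw [← ricci_identity hΓ (contDiffAt_const (c := z)) x y,
    ← ricci_identity hΓ (contDiffAt_const (c := u)) x y]
  simp only [map_sub, sub_apply]
  linear_combination h1

variable {J : E → E →L[ℝ] E} (hJ : ContDiffAt ℝ ∞ J v)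
  (hp : ∀ᶠ w in 𝓝 v, ∀ x y, fderiv ℝ J w x y + christoffel G w x (J w y)
    = J w (christoffel G w x y))
include hJ hp

omit hs in
/-- The curvature commutes with a parallel endomorphism. -/
lemma curv_christoffel_complex (x y z : E) :
    curv (christoffel G) v x y (J v z) = J v (curv (christoffel G) v x y z) := by
  have hΓ := contDiffAt_christoffel hG hi
  have hcov : ∀ᶠ w in 𝓝 v, ∀ (W : E → E), DifferentiableAt ℝ W w → ∀ x,
      cov (christoffel G) (fun w ↦ J w (W w)) w x = J w (cov (christoffel G) W w x) := by
    filter_upwards [hp, (hJ.of_le (by simp : (1 : WithTop ℕ∞) ≤ ∞)).eventually (by simp)]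
      with w hw hw' W hW x
    simp only [cov]
    rw [fderiv_clm_apply (hw'.differentiableAt (by simp)) hW]
    simp only [add_apply, ContinuousLinearMap.comp_apply, ContinuousLinearMap.flip_apply, map_add]
    rw [← hw]
    abel
  have key : ∀ x y, cov (christoffel G) (fun w ↦ cov (christoffel G) (fun w ↦ J w z) w y) v x
      = J v (cov (christoffel G) (fun w ↦ cov (christoffel G) (fun _ ↦ z) w y) v x) := by
    intro x y
    have h1 : (fun w ↦ cov (christoffel G) (fun w ↦ J w z) w y) =ᶠ[𝓝 v]
        fun w ↦ J w (cov (christoffel G) (fun _ ↦ z) w y) := by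
      filter_upwards [hcov] with w hw using hw _ (differentiableAt_const z) y
    rw [cov_congr h1, hcov.self_of_nhds _
      ((contDiffAt_cov hΓ contDiffAt_const y).differentiableAt (by simp))]
  rw [← ricci_identity hΓ (contDiffAt_const (c := z)) x y,
    ← ricci_identity hΓ (hJ.clm_apply (contDiffAt_const (c := z))) x y, key, key, map_sub]

/-- The curvature tensor of a Kähler manifold with Norden metric of constant totally real sectional
curvatures `ν` and `ν'`: the difference `Q` of the two sides is a complex curvature tensor with
vanishing sectional curvature on orthonormal pairs. -/
theorem curv_eq_of_const_totallyReal [FiniteDimensional ℝ E] (hdim : 3 ≤ Module.finrank ℝ E)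
    (hsq : ∀ x, J v (J v x) = -x) (hn : ∀ x y, G v (J v x) (J v y) = -G v x y) {ν ν' : ℝ}
    (hν : ∀ x y, G v x x = 1 → G v y y = 1 → G v x y = 0 → G v x (J v x) = 0 →
      G v y (J v y) = 0 → G v x (J v y) = 0 →
      G v (curv (christoffel G) v x y y) x = ν ∧ G v (curv (christoffel G) v x y y) (J v x) = ν')
    (x y z u : E) :
    G v (curv (christoffel G) v x y z) u
      = ν * (G v y z * G v x u - G v x z * G v y u
          - (G v y (J v z) * G v x (J v u) - G v x (J v z) * G v y (J v u)))
        + ν' * (-(G v y z * G v x (J v u)) + G v x z * G v y (J v u)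
          - G v y (J v z) * G v x u + G v x (J v z) * G v y u) := by
  have hs' := hs v
  have hJs : ∀ x y, G v (J v x) y = G v x (J v y) := by
    intro x y
    have h1 := hn x (J v y)
    rw [hsq, map_neg] at h1
    linarith
  set Q : E → E → E → E → ℝ := fun x y z u ↦ G v (curv (christoffel G) v x y z) u
    - (ν * (G v y z * G v x u - G v x z * G v y u
          - (G v y (J v z) * G v x (J v u) - G v x (J v z) * G v y (J v u)))
        + ν' * (-(G v y z * G v x (J v u)) + G v x z * G v y (J v u)
          - G v y (J v z) * G v x u + G v x (J v z) * G v y u)) with hQdef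
  have hQ : IsKaehlerCurvature (J v : E →ₗ[ℝ] E) Q :=
  { add := fun x y z u u' ↦ by simp only [hQdef, map_add]; ring
    smul := fun c x y z u ↦ by simp only [hQdef, map_smul, smul_eq_mul]; ring
    antisymm_left := fun x y z u ↦ by
      simp only [hQdef]
      rw [curv_antisymm, map_neg, neg_apply]
      ring
    antisymm_right := fun x y z u ↦ by
      have h := curv_christoffel_skew hs hG hi x y z u
      rw [hs' z] at h
      simp only [hQdef]
      linear_combination h
    bianchi := fun x y z u ↦ by
      have h := congrArg (fun w ↦ G v w u) (curv_christoffel_bianchi hs hG hi x y z)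
      simp only [map_add, add_apply, map_zero, zero_apply] at h
      simp only [hQdef]
      have h1 : ∀ x y, G v x (J v y) = G v y (J v x) := fun x y ↦ by rw [hs', hJs]
      rw [hs' z y, hs' z x, hs' y x, h1 z y, h1 z x, h1 y x]
      linear_combination h
    complex := fun x y z u ↦ by
      have h := curv_christoffel_complex hG hi hJ hp x y z
      simp only [hQdef, ContinuousLinearMap.coe_coe]
      rw [h, hJs, hsq, hsq, map_neg, map_neg, map_neg, map_neg]
      ring }
  have h0 := hQ.eq_zero (B := (G v).toLinearMap₁₂) hdim hsq hs' hJs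
    (nondegenerate_of_isInvertible hi) (fun x y hx hy hxy ↦ by
      have hx1 : G v x x = 1 := congrArg Complex.re hx
      have hx2 : -G v x (J v x) = 0 := congrArg Complex.im hx
      have hy1 : G v y y = 1 := congrArg Complex.re hy
      have hy2 : -G v y (J v y) = 0 := congrArg Complex.im hy
      have hxy1 : G v x y = 0 := congrArg Complex.re hxy
      have hxy2 : -G v x (J v y) = 0 := congrArg Complex.im hxy
      rw [neg_eq_zero] at hx2 hy2 hxy2
      obtain ⟨h1, h2⟩ := hν x y hx1 hy1 hxy1 hx2 hy2 hxy2
      have hyx1 : G v y x = 0 := by rw [hs', hxy1]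
      have hyx2 : G v y (J v x) = 0 := by rw [hs', hJs, hxy2]
      apply Complex.ext
      · simp only [complexSectional, hQdef, Complex.zero_re, h1, hx1, hx2, hy1, hy2, hxy1, hxy2,
          hyx1, hyx2]
        ring
      · simp only [complexSectional, hQdef, Complex.zero_im, ContinuousLinearMap.coe_coe, h2, hx1,
          hx2, hy1, hy2, hxy1, hxy2, hyx1, hyx2, hsq, map_neg]
        ring) x y z u
  exact sub_eq_zero.1 h0

end RiemannCurvature

/-! ### Smoothness and curvature in a chart -/

section ChartSmoothness

open Filter Topology Bundle

variable {E : Type*} [NormedAddCommGroup E] [NormedSpace ℝ E]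
  {M : Type*} [TopologicalSpace M] [ChartedSpace E M] [IsManifold 𝓘(ℝ, E) ∞ M]

/-- The field of endomorphisms `J` in the chart at `p₀`. -/
def endChart (p₀ : M) (J : EndField E M) (v : E) : E →L[ℝ] E :=
  (show E →L[ℝ] E from toChart p₀ ((extChartAt 𝓘(ℝ, E) p₀).symm v)).comp
    ((show E →L[ℝ] E from J ((extChartAt 𝓘(ℝ, E) p₀).symm v)).comp
      (show E →L[ℝ] E from ofChart p₀ ((extChartAt 𝓘(ℝ, E) p₀).symm v)))

/-- The form `bilinChart` at the coordinates of a point `r`. The point with these coordinates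
equals `r`, but not definitionally, hence the generalization over `r'` in the proof. -/
lemma bilinChart_extChartAt {p₀ r : M} (hr : r ∈ (extChartAt 𝓘(ℝ, E) p₀).source)
    (g : BilinField E M) (x y : TangentSpace 𝓘(ℝ, E) r) :
    bilinChart p₀ g (extChartAt 𝓘(ℝ, E) p₀ r) (toChart p₀ r x) (toChart p₀ r y) = g r x y := by
  have h : ∀ r', r' = r → ContinuousLinearMap.bilinearComp (show E →L[ℝ] E →L[ℝ] ℝ from g r')
      (show E →L[ℝ] E from ofChart p₀ r') (show E →L[ℝ] E from ofChart p₀ r')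
      (toChart p₀ r x) (toChart p₀ r y) = g r x y := by
    rintro _ rfl
    change g _ (ofChart p₀ _ (toChart p₀ _ x)) (ofChart p₀ _ (toChart p₀ _ y)) = _
    rw [ofChart_toChart hr, ofChart_toChart hr]
  exact h _ ((extChartAt 𝓘(ℝ, E) p₀).left_inv hr)

lemma endChart_extChartAt {p₀ r : M} (hr : r ∈ (extChartAt 𝓘(ℝ, E) p₀).source)
    (J : EndField E M) (x : TangentSpace 𝓘(ℝ, E) r) :
    endChart p₀ J (extChartAt 𝓘(ℝ, E) p₀ r) (toChart p₀ r x) = toChart p₀ r (J r x) := by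
  have h : ∀ r', r' = r → (show E →L[ℝ] E from toChart p₀ r')
      ((show E →L[ℝ] E from J r') ((show E →L[ℝ] E from ofChart p₀ r') (toChart p₀ r x)))
      = toChart p₀ r (J r x) := by
    rintro _ rfl
    change toChart p₀ _ (J _ (ofChart p₀ _ (toChart p₀ _ x))) = _
    rw [ofChart_toChart hr]
  exact h _ ((extChartAt 𝓘(ℝ, E) p₀).left_inv hr)

lemma vfieldChart_extChartAt {p₀ r : M} (hr : r ∈ (extChartAt 𝓘(ℝ, E) p₀).source)
    (X : VField E M) : vfieldChart p₀ X (extChartAt 𝓘(ℝ, E) p₀ r) = toChart p₀ r (X r) := by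
  have h : ∀ r', r' = r → (show E →L[ℝ] E from toChart p₀ r') (X r') = toChart p₀ r (X r) := by
    rintro _ rfl
    rfl
  exact h _ ((extChartAt 𝓘(ℝ, E) p₀).left_inv hr)

lemma endChart_vfieldChart {p₀ : M} {v : E} (hv : v ∈ (extChartAt 𝓘(ℝ, E) p₀).target)
    (J : EndField E M) (X : VField E M) :
    vfieldChart p₀ (fun q ↦ J q (X q)) v = endChart p₀ J v (vfieldChart p₀ X v) := by
  have hq := (extChartAt 𝓘(ℝ, E) p₀).map_target hv
  change _ = toChart p₀ _ (J _ (ofChart p₀ _ (toChart p₀ _ _)))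
  rw [ofChart_toChart hq]
  rfl

/-- The local vector field with constant coordinates `x` in the chart at `p₀` is smooth. -/
lemma contMDiffAt_ofChart {p₀ r : M} (hr : r ∈ (extChartAt 𝓘(ℝ, E) p₀).source) (x : E) :
    ContMDiffAt 𝓘(ℝ, E) (𝓘(ℝ, E).prod 𝓘(ℝ, E)) ∞
      (fun q ↦ TotalSpace.mk' E (E := fun q : M ↦ TangentSpace 𝓘(ℝ, E) q) q (ofChart p₀ q x))
      r := by
  set e := trivializationAt E (TangentSpace 𝓘(ℝ, E)) p₀
  rw [e.contMDiffAt_section_iff (mem_baseSet hr)]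
  refine (contMDiffAt_const (c := x)).congr_of_eventuallyEq ?_
  filter_upwards [(isOpen_extChartAt_source p₀).mem_nhds hr] with q hq
  have h := toChart_ofChart hq x
  rw [toChart, Bundle.Trivialization.continuousLinearMapAt_apply,
    Bundle.Trivialization.linearMapAt_apply, if_pos (mem_baseSet hq)] at h
  exact h

lemma contDiffAt_of_contMDiffAt {G : Type*} [NormedAddCommGroup G] [NormedSpace ℝ G]
    {p₀ : M} {h : M → G} {v : E} (hv : v ∈ (extChartAt 𝓘(ℝ, E) p₀).target)
    (hh : ContMDiffAt 𝓘(ℝ, E) 𝓘(ℝ, G) ∞ h ((extChartAt 𝓘(ℝ, E) p₀).symm v)) :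
    ContDiffAt ℝ ∞ (fun w ↦ h ((extChartAt 𝓘(ℝ, E) p₀).symm w)) v := by
  have hs : ContMDiffAt 𝓘(ℝ, E) 𝓘(ℝ, E) ∞ (extChartAt 𝓘(ℝ, E) p₀).symm v :=
    (contMDiffOn_extChartAt_symm p₀).contMDiffAt (target_mem_nhds p₀ hv)
  exact (hh.comp v hs).contDiffAt

lemma contDiffAt_vfieldChart {p₀ : M} {X : VField E M} {v : E}
    (hv : v ∈ (extChartAt 𝓘(ℝ, E) p₀).target)
    (hX : SmoothVFieldAt X ((extChartAt 𝓘(ℝ, E) p₀).symm v)) :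
    ContDiffAt ℝ ∞ (vfieldChart p₀ X) v := by
  have hq := (extChartAt 𝓘(ℝ, E) p₀).map_target hv
  set e := trivializationAt E (TangentSpace 𝓘(ℝ, E)) p₀
  have h1 := (e.contMDiffAt_section_iff (mem_baseSet hq)).1 hX
  refine (contDiffAt_of_contMDiffAt hv h1).congr_of_eventuallyEq ?_
  filter_upwards [target_mem_nhds p₀ hv] with w hw
  rw [vfieldChart, toChart, Bundle.Trivialization.continuousLinearMapAt_apply,
    Bundle.Trivialization.linearMapAt_apply,
    if_pos (mem_baseSet ((extChartAt 𝓘(ℝ, E) p₀).map_target hw))]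

variable [FiniteDimensional ℝ E]

lemma contDiffAt_bilinChart {p₀ : M} {g : BilinField E M} (hg : IsPseudoRiemannianMetric g) {v : E}
    (hv : v ∈ (extChartAt 𝓘(ℝ, E) p₀).target) : ContDiffAt ℝ ∞ (bilinChart p₀ g) v := by
  have h : ContDiffOn ℝ ∞ (bilinChart p₀ g) (extChartAt 𝓘(ℝ, E) p₀).target := by
    rw [contDiffOn_clm_apply]
    intro x
    rw [contDiffOn_clm_apply]
    intro y w hw
    have hq := (extChartAt 𝓘(ℝ, E) p₀).map_target hw
    have h1 : ContMDiffAt 𝓘(ℝ, E) (𝓘(ℝ, E).prod 𝓘(ℝ, ℝ)) ∞ (fun q ↦ TotalSpace.mk' ℝ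
        (E := Bundle.Trivial M ℝ) q (g q (ofChart p₀ q x) (ofChart p₀ q y)))
        ((extChartAt 𝓘(ℝ, E) p₀).symm w) := by
      apply ContMDiffAt.clm_bundle_apply₂ (F₁ := E) (F₂ := E)
      · exact hg.smooth _
      · exact contMDiffAt_ofChart hq x
      · exact contMDiffAt_ofChart hq y
    have h2 := (contMDiffAt_totalSpace.1 h1).2
    exact (contDiffAt_of_contMDiffAt hw h2).contDiffWithinAt
  exact h.contDiffAt (target_mem_nhds p₀ hv)

lemma contDiffAt_endChart {p₀ : M} {J : EndField E M} (hJ : IsSmoothEndField J) {v : E}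
    (hv : v ∈ (extChartAt 𝓘(ℝ, E) p₀).target) : ContDiffAt ℝ ∞ (endChart p₀ J) v := by
  have h : ContDiffOn ℝ ∞ (endChart p₀ J) (extChartAt 𝓘(ℝ, E) p₀).target := by
    rw [contDiffOn_clm_apply]
    intro x w hw
    have hq := (extChartAt 𝓘(ℝ, E) p₀).map_target hw
    have h1 : SmoothVFieldAt (fun q ↦ J q (ofChart p₀ q x)) ((extChartAt 𝓘(ℝ, E) p₀).symm w) := by
      apply ContMDiffAt.clm_bundle_apply (F₁ := E)
      · exact hJ _
      · exact contMDiffAt_ofChart hq x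
    exact (contDiffAt_vfieldChart hw h1).contDiffWithinAt
  exact h.contDiffAt (target_mem_nhds p₀ hv)

lemma bilinChart_isInvertible {p₀ : M} {g : BilinField E M} (hg : IsPseudoRiemannianMetric g)
    {v : E} (hv : v ∈ (extChartAt 𝓘(ℝ, E) p₀).target) : (bilinChart p₀ g v).IsInvertible := by
  have hq := (extChartAt 𝓘(ℝ, E) p₀).map_target hv
  apply isInvertible_of_nondegenerate
  intro x hx
  have h1 : ofChart p₀ ((extChartAt 𝓘(ℝ, E) p₀).symm v) x = 0 := by
    apply hg.nondegenerate
    intro y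
    have h2 := hx (toChart p₀ _ y)
    change g _ (ofChart p₀ _ x) (ofChart p₀ _ (toChart p₀ _ y)) = 0 at h2
    rwa [ofChart_toChart hq] at h2
  rw [← toChart_ofChart hq x, h1, map_zero]

lemma vfieldChart_leviCivita {p₀ : M} {g : BilinField E M} (hg : IsPseudoRiemannianMetric g)
    {v : E} (hv : v ∈ (extChartAt 𝓘(ℝ, E) p₀).target)
    {X Y : VField E M} (hX : DifferentiableAt ℝ (vfieldChart p₀ X) v)
    (hY : DifferentiableAt ℝ (vfieldChart p₀ Y) v) :
    vfieldChart p₀ (leviCivita g X Y) v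
      = cov (christoffel (bilinChart p₀ g)) (vfieldChart p₀ Y) v (vfieldChart p₀ X v) :=
  vfieldChart_leviCivita_of_isInvertible hv
    ((contDiffAt_bilinChart hg hv).differentiableAt (by simp))
    (bilinChart_isInvertible hg hv) hg.symm hX hY

/-- The complex structure of a Kähler manifold with Norden metric is parallel in a chart. -/
lemma endChart_parallel {p₀ : M} {J : EndField E M} {g : BilinField E M}
    (hK : IsKaehlerNorden J g) {v : E} (hv : v ∈ (extChartAt 𝓘(ℝ, E) p₀).target) (x y : E) :
    fderiv ℝ (endChart p₀ J) v x y + christoffel (bilinChart p₀ g) v x (endChart p₀ J v y)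
      = endChart p₀ J v (christoffel (bilinChart p₀ g) v x y) := by
  have hq := (extChartAt 𝓘(ℝ, E) p₀).map_target hv
  set X := NordenGeometry.ext (ofChart p₀ ((extChartAt 𝓘(ℝ, E) p₀).symm v) x) with hX
  set Y := NordenGeometry.ext (ofChart p₀ ((extChartAt 𝓘(ℝ, E) p₀).symm v) y) with hY
  have hX' := differentiableAt_vfieldChart_ext hv (ofChart p₀ _ x)
  have hY' := differentiableAt_vfieldChart_ext hv (ofChart p₀ _ y)
  rw [← hX] at hX'
  rw [← hY] at hY'
  have hXv : vfieldChart p₀ X v = x := by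
    rw [vfieldChart, hX, NordenGeometry.ext, FiberBundle.extend_apply_self, toChart_ofChart hq]
  have hYv : vfieldChart p₀ Y v = y := by
    rw [vfieldChart, hY, NordenGeometry.ext, FiberBundle.extend_apply_self, toChart_ofChart hq]
  have hJ := (contDiffAt_endChart (p₀ := p₀) hK.smooth hv).differentiableAt (by simp)
  have hJY : vfieldChart p₀ (fun q ↦ J q (Y q)) =ᶠ[𝓝 v]
      fun w ↦ endChart p₀ J w (vfieldChart p₀ Y w) := by
    filter_upwards [target_mem_nhds p₀ hv] with w hw using endChart_vfieldChart hw J Y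
  have h1 : nablaEnd g (fun q v ↦ J q v) X Y ((extChartAt 𝓘(ℝ, E) p₀).symm v) = 0 :=
    hK.metric.nondegenerate _ _ fun z ↦ hK.parallel _ _ _ z
  rw [nablaEnd, sub_eq_zero] at h1
  have h2 : vfieldChart p₀ (leviCivita g X fun q ↦ J q (Y q)) v
      = vfieldChart p₀ (fun q ↦ J q (leviCivita g X Y q)) v := congrArg (toChart p₀ _) h1
  rw [endChart_vfieldChart hv, vfieldChart_leviCivita hK.metric hv hX' hY',
    vfieldChart_leviCivita hK.metric hv hX' (hJY.differentiableAt_iff.2 (hJ.clm_apply hY')),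
    cov_congr hJY, hXv, cov, cov, fderiv_clm_apply hJ hY', hYv] at h2
  simp only [add_apply, ContinuousLinearMap.comp_apply, ContinuousLinearMap.flip_apply,
    map_add] at h2
  rw [add_assoc] at h2
  exact add_left_cancel h2

omit [FiniteDimensional ℝ E] in
lemma lieBracket_eq_zero_of_eventuallyEq_const {X Y : E → E} {v x y : E}
    (hX : X =ᶠ[𝓝 v] fun _ ↦ x) (hY : Y =ᶠ[𝓝 v] fun _ ↦ y) :
    VectorField.lieBracket ℝ X Y v = 0 := by
  rw [VectorField.lieBracket, hX.fderiv_eq, hY.fderiv_eq]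
  simp

/-- The curvature tensor of a connection whose action on fields with constant coordinates is given
in the chart at `p` by `C`. The extensions of vectors used in the definition of the curvature have
constant coordinates near `p`, so their brackets vanish. -/
lemma curvature_eq_of_chart {p : M} {g : BilinField E M} {D : VField E M → VField E M → VField E M}
    {C : (E → E) → E → E → E} {U : Set E} (hU : IsOpen U) (hp : extChartAt 𝓘(ℝ, E) p p ∈ U)
    (hUt : U ⊆ (extChartAt 𝓘(ℝ, E) p).target)
    (hD : ∀ X Y : VField E M, ∀ v ∈ U, DifferentiableAt ℝ (vfieldChart p X) v →
      DifferentiableAt ℝ (vfieldChart p Y) v →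
      vfieldChart p (D X Y) v = C (vfieldChart p Y) v (vfieldChart p X v))
    (hC : ∀ W W' : E → E, ∀ v ∈ U, W =ᶠ[𝓝 v] W' → ∀ x, C W v x = C W' v x)
    (hC₀ : ∀ W, ∀ v ∈ U, C W v 0 = 0)
    (hCd : ∀ z x, ∀ v ∈ U, DifferentiableAt ℝ (fun w ↦ C (fun _ ↦ z) w x) v)
    (x y z u : TangentSpace 𝓘(ℝ, E) p) :
    curvature g D p x y z u = bilinChart p g (extChartAt 𝓘(ℝ, E) p p)
      (C (fun w ↦ C (fun _ ↦ z) w y) (extChartAt 𝓘(ℝ, E) p p) x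
        - C (fun w ↦ C (fun _ ↦ z) w x) (extChartAt 𝓘(ℝ, E) p p) y) u := by
  have hpp := mem_extChartAt_source (I := 𝓘(ℝ, E)) p
  have hext : ∀ z : TangentSpace 𝓘(ℝ, E) p, ∀ v ∈ U,
      vfieldChart p (NordenGeometry.ext z) =ᶠ[𝓝 v] (fun _ ↦ z : E → E) := by
    intro z v hv
    filter_upwards [hU.mem_nhds hv] with w hw
    rw [vfieldChart_ext z (hUt hw), toChart_self]
  have hextd : ∀ z : TangentSpace 𝓘(ℝ, E) p, ∀ v ∈ U,
      DifferentiableAt ℝ (vfieldChart p (NordenGeometry.ext z)) v := fun z v hv ↦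
    (hext z v hv).differentiableAt_iff.2 (differentiableAt_const _)
  have hD₁ : ∀ y z : TangentSpace 𝓘(ℝ, E) p, ∀ v ∈ U,
      vfieldChart p (D (NordenGeometry.ext y) (NordenGeometry.ext z)) v
        = C (fun _ ↦ z) v y := by
    intro y z v hv
    rw [hD _ _ v hv (hextd y v hv) (hextd z v hv), hC _ _ v hv (hext z v hv),
      (hext y v hv).eq_of_nhds]
  have hD₂ : ∀ x y z : TangentSpace 𝓘(ℝ, E) p,
      vfieldChart p (D (NordenGeometry.ext x) (D (NordenGeometry.ext y) (NordenGeometry.ext z)))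
        (extChartAt 𝓘(ℝ, E) p p)
        = C (fun w ↦ C (fun _ ↦ z) w y) (extChartAt 𝓘(ℝ, E) p p) x := by
    intro x y z
    have h1 : vfieldChart p (D (NordenGeometry.ext y) (NordenGeometry.ext z))
        =ᶠ[𝓝 (extChartAt 𝓘(ℝ, E) p p)] fun w ↦ C (fun _ ↦ z) w y := by
      filter_upwards [hU.mem_nhds hp] with w hw using hD₁ y z w hw
    rw [hD _ _ _ hp (hextd x _ hp) (h1.differentiableAt_iff.2 (hCd _ _ _ hp)), hC _ _ _ hp h1,
      (hext x _ hp).eq_of_nhds]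
  have hbr : ∀ v ∈ U, vfieldChart p (bracket (NordenGeometry.ext x) (NordenGeometry.ext y)) v
      = 0 := by
    intro v hv
    rw [vfieldChart_bracket (hUt hv) (hextd x v hv) (hextd y v hv)]
    exact lieBracket_eq_zero_of_eventuallyEq_const (hext x v hv) (hext y v hv)
  have hD₃ : vfieldChart p (D (bracket (NordenGeometry.ext x) (NordenGeometry.ext y))
      (NordenGeometry.ext z)) (extChartAt 𝓘(ℝ, E) p p) = 0 := by
    have h1 : vfieldChart p (bracket (NordenGeometry.ext x) (NordenGeometry.ext y))
        =ᶠ[𝓝 (extChartAt 𝓘(ℝ, E) p p)] fun _ ↦ 0 := by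
      filter_upwards [hU.mem_nhds hp] with w hw using hbr w hw
    rw [hD _ _ _ hp (h1.differentiableAt_iff.2 (differentiableAt_const _)) (hextd z _ hp),
      hbr _ hp, hC₀ _ _ hp]
  have hval : ∀ X : VField E M, vfieldChart p X (extChartAt 𝓘(ℝ, E) p p) = X p := fun X ↦ by
    rw [vfieldChart_extChartAt hpp, toChart_self]
  rw [hval] at hD₃
  rw [← hD₂ x y z, ← hD₂ y x z, hval, hval, curvature, hD₃]
  have h := bilinChart_extChartAt hpp g (D (NordenGeometry.ext x) (D (NordenGeometry.ext y)
    (NordenGeometry.ext z)) p - D (NordenGeometry.ext y) (D (NordenGeometry.ext x)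
    (NordenGeometry.ext z)) p) u
  rw [toChart_self, toChart_self] at h
  refine Eq.trans ?_ h.symm
  congr 2
  exact sub_zero _

/-- The curvature tensor of a pseudo-Riemannian metric in a chart. -/
lemma curvature_leviCivita_eq {p : M} {g : BilinField E M} (hg : IsPseudoRiemannianMetric g)
    (x y z u : TangentSpace 𝓘(ℝ, E) p) :
    curvature g (leviCivita g) p x y z u = bilinChart p g (extChartAt 𝓘(ℝ, E) p p)
      (curv (christoffel (bilinChart p g)) (extChartAt 𝓘(ℝ, E) p p) x y z) u := by
  have hp := mem_extChartAt_target (I := 𝓘(ℝ, E)) p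
  have hΓ : ∀ v ∈ (extChartAt 𝓘(ℝ, E) p).target,
      ContDiffAt ℝ ∞ (christoffel (bilinChart p g)) v := fun v hv ↦
    contDiffAt_christoffel (contDiffAt_bilinChart hg hv) (bilinChart_isInvertible hg hv)
  refine (curvature_eq_of_chart (C := cov (christoffel (bilinChart p g)))
    (isOpen_extChartAt_target p) hp subset_rfl
    (fun X Y v hv hX hY ↦ vfieldChart_leviCivita hg hv hX hY) (fun W W' v _ h x ↦ cov_congr h x)
    (fun W v _ ↦ cov_zero_right)
    (fun z x v hv ↦ (contDiffAt_cov (hΓ v hv) contDiffAt_const x).differentiableAt (by simp))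
    x y z u).trans ?_
  exact congrArg (fun w ↦ bilinChart p g (extChartAt 𝓘(ℝ, E) p p) w u)
    (ricci_identity (F := E) (W := fun _ ↦ z) (hΓ _ hp) contDiffAt_const x y)

end ChartSmoothness

/-! ### A hypersurface in a pair of charts -/

section Transfer

open Filter Topology Bundle

variable {E E' : Type*} [NormedAddCommGroup E] [NormedSpace ℝ E] [FiniteDimensional ℝ E]
  [NormedAddCommGroup E'] [NormedSpace ℝ E'] [FiniteDimensional ℝ E']
  {M M' : Type*} [TopologicalSpace M] [ChartedSpace E M] [IsManifold 𝓘(ℝ, E) ∞ M]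
  [TopologicalSpace M'] [ChartedSpace E' M'] [IsManifold 𝓘(ℝ, E') ∞ M']
  {J : EndField E' M'} {g' : BilinField E' M'} {f : M → M'}
  {N : Π p : M, TangentSpace 𝓘(ℝ, E') (f p)}

omit [FiniteDimensional ℝ E] [FiniteDimensional ℝ E'] in
lemma toChart_injective {p₀ q : M} (hq : q ∈ (extChartAt 𝓘(ℝ, E) p₀).source) :
    Function.Injective (toChart (E := E) p₀ q) :=
  Function.LeftInverse.injective (g := ofChart p₀ q) (ofChart_toChart hq)

omit [FiniteDimensional ℝ E] in
lemma bilinChart_symm {p₀ : M} {g : BilinField E M} (hg : IsPseudoRiemannianMetric g) (v x y : E) :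
    bilinChart p₀ g v x y = bilinChart p₀ g v y x :=
  hg.symm ((extChartAt 𝓘(ℝ, E) p₀).symm v) (ofChart p₀ _ x) (ofChart p₀ _ y)

/-- The points of the chart domain at `p` that `f` maps to the chart domain at `f p`. -/
def chartDomain (E E' : Type*) [NormedAddCommGroup E] [NormedSpace ℝ E]
    [NormedAddCommGroup E'] [NormedSpace ℝ E'] {M M' : Type*}
    [TopologicalSpace M] [ChartedSpace E M] [TopologicalSpace M'] [ChartedSpace E' M']
    (f : M → M') (p : M) : Set E :=
  (extChartAt 𝓘(ℝ, E) p).target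
    ∩ (extChartAt 𝓘(ℝ, E) p).symm ⁻¹' (f ⁻¹' (extChartAt 𝓘(ℝ, E') (f p)).source)

/-- The map `f` in the charts at `p` and `f p`. -/
def mapChart (E E' : Type*) [NormedAddCommGroup E] [NormedSpace ℝ E]
    [NormedAddCommGroup E'] [NormedSpace ℝ E'] {M M' : Type*}
    [TopologicalSpace M] [ChartedSpace E M] [TopologicalSpace M'] [ChartedSpace E' M']
    (f : M → M') (p : M) (v : E) : E' :=
  extChartAt 𝓘(ℝ, E') (f p) (f ((extChartAt 𝓘(ℝ, E) p).symm v))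

omit [FiniteDimensional ℝ E] [FiniteDimensional ℝ E'] in
lemma contDiffAt_mapChart (hf : ContMDiff 𝓘(ℝ, E) 𝓘(ℝ, E') ∞ f) {p : M} {v : E}
    (hv : v ∈ chartDomain E E' f p) : ContDiffAt ℝ ∞ (mapChart E E' f p) v := by
  have h1 : f ((extChartAt 𝓘(ℝ, E) p).symm v) ∈ (extChartAt 𝓘(ℝ, E') (f p)).source := hv.2
  rw [extChartAt_source] at h1
  exact contDiffAt_of_contMDiffAt hv.1 ((contMDiffAt_extChartAt' (n := ∞) h1).comp _ (hf _))

omit [FiniteDimensional ℝ E] [FiniteDimensional ℝ E'] in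
lemma fderiv_mapChart (hf : ContMDiff 𝓘(ℝ, E) 𝓘(ℝ, E') ∞ f) {p : M} {v : E}
    (hv : v ∈ chartDomain E E' f p) (x : E) :
    fderiv ℝ (mapChart E E' f p) v x = toChart (f p) (f ((extChartAt 𝓘(ℝ, E) p).symm v))
      (df f ((extChartAt 𝓘(ℝ, E) p).symm v) (ofChart p ((extChartAt 𝓘(ℝ, E) p).symm v) x)) := by
  have h1 : f ((extChartAt 𝓘(ℝ, E) p).symm v) ∈ (extChartAt 𝓘(ℝ, E') (f p)).source := hv.2
  have h1' := h1
  rw [extChartAt_source] at h1'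
  have hs : MDifferentiableAt 𝓘(ℝ, E) 𝓘(ℝ, E) (extChartAt 𝓘(ℝ, E) p).symm v :=
    (mdifferentiableOn_extChartAt_symm v hv.1).mdifferentiableAt (target_mem_nhds p hv.1)
  have hf' : MDifferentiableAt 𝓘(ℝ, E) 𝓘(ℝ, E') f ((extChartAt 𝓘(ℝ, E) p).symm v) :=
    (hf _).mdifferentiableAt (by simp)
  have hc : MDifferentiableAt 𝓘(ℝ, E') 𝓘(ℝ, E') (extChartAt 𝓘(ℝ, E') (f p))
      (f ((extChartAt 𝓘(ℝ, E) p).symm v)) := mdifferentiableAt_extChartAt h1'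
  have h2 := mfderiv_comp v hf' hs
  have h3 := mfderiv_comp v hc (hf'.comp v hs)
  rw [h2, ← ofChart_eq_mfderiv hv.1] at h3
  have h4 : fderiv ℝ (mapChart E E' f p) v = mfderiv 𝓘(ℝ, E) 𝓘(ℝ, E')
      (extChartAt 𝓘(ℝ, E') (f p) ∘ f ∘ (extChartAt 𝓘(ℝ, E) p).symm) v := by
    rw [mfderiv_eq_fderiv]; rfl
  rw [h4, h3, toChart_eq_mfderiv h1]
  rfl

omit [FiniteDimensional ℝ E] [FiniteDimensional ℝ E'] [IsManifold 𝓘(ℝ, E) ∞ M]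
  [IsManifold 𝓘(ℝ, E') ∞ M'] in
lemma isOpen_chartDomain (hf : Continuous f) (p : M) : IsOpen (chartDomain E E' f p) :=
  (continuousOn_extChartAt_symm p).isOpen_inter_preimage (isOpen_extChartAt_target p)
    ((isOpen_extChartAt_source (f p)).preimage hf)

omit [FiniteDimensional ℝ E] [FiniteDimensional ℝ E'] in
/-- A smooth vector field along `f` is smooth in charts. -/
lemma contDiffAt_alongChart (hf : Continuous f)
    (hN : ContMDiff 𝓘(ℝ, E) (𝓘(ℝ, E').prod 𝓘(ℝ, E')) ∞ (fun p ↦ Bundle.TotalSpace.mk' E'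
      (E := fun q : M' ↦ TangentSpace 𝓘(ℝ, E') q) (f p) (N p))) {p : M} {v : E}
    (hv : v ∈ chartDomain E E' f p) :
    ContDiffAt ℝ ∞ (fun v ↦ (toChart (f p) (f ((extChartAt 𝓘(ℝ, E) p).symm v))
      (N ((extChartAt 𝓘(ℝ, E) p).symm v)) : E')) v := by
  have hs : Bundle.TotalSpace.mk' E' (E := fun q : M' ↦ TangentSpace 𝓘(ℝ, E') q)
      (f ((extChartAt 𝓘(ℝ, E) p).symm v)) (N ((extChartAt 𝓘(ℝ, E) p).symm v))
      ∈ (trivializationAt E' (TangentSpace 𝓘(ℝ, E')) (f p)).source :=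
    (trivializationAt E' (TangentSpace 𝓘(ℝ, E')) (f p)).mem_source.2 (mem_baseSet hv.2)
  have h1 := ((trivializationAt E' (TangentSpace 𝓘(ℝ, E')) (f p)).contMDiffAt_iff
    (f := fun p ↦ Bundle.TotalSpace.mk' E' (E := fun q : M' ↦ TangentSpace 𝓘(ℝ, E') q) (f p) (N p))
    hs).1 (hN ((extChartAt 𝓘(ℝ, E) p).symm v))
  have h2 := contDiffAt_of_contMDiffAt hv.1 h1.2
  refine h2.congr_of_eventuallyEq ?_
  filter_upwards [(isOpen_chartDomain hf p).mem_nhds hv] with w hw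
  rw [toChart, Bundle.Trivialization.continuousLinearMapAt_apply,
    Bundle.Trivialization.linearMapAt_apply, if_pos (mem_baseSet hw.2)]

/-- A time-like hypersurface in the charts at `p` and `f p`. -/
def IsTimelikeHypersurface.toLocal (hf : IsTimelikeHypersurface (E := E) g' f N)
    (hK : IsKaehlerNorden J g') (hdim : Module.finrank ℝ E' = Module.finrank ℝ E + 1) (p : M) :
    LocalHypersurface E E' where
  U := chartDomain E E' f p
  f := mapChart E E' f p
  N v := toChart (f p) (f ((extChartAt 𝓘(ℝ, E) p).symm v)) (N ((extChartAt 𝓘(ℝ, E) p).symm v))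
  G := bilinChart (f p) g'
  J := endChart (f p) J
  isOpen := isOpen_chartDomain hf.smooth.continuous p
  smooth_f v hv := contDiffAt_mapChart hf.smooth hv
  smooth_N v hv := contDiffAt_alongChart hf.smooth.continuous hf.smooth_normal hv
  smooth_G v hv := contDiffAt_bilinChart hK.metric ((extChartAt 𝓘(ℝ, E') (f p)).map_source hv.2)
  smooth_J v hv := contDiffAt_endChart hK.smooth ((extChartAt 𝓘(ℝ, E') (f p)).map_source hv.2)
  symm := bilinChart_symm hK.metric
  nondegenerate v hv := nondegenerate_of_isInvertible
    (bilinChart_isInvertible hK.metric ((extChartAt 𝓘(ℝ, E') (f p)).map_source hv.2))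
  sq v hv x := by
    rw [mapChart, ← toChart_ofChart hv.2 x, endChart_extChartAt hv.2, endChart_extChartAt hv.2,
      hK.sq, map_neg]
  norden v hv x y := by
    rw [mapChart, ← toChart_ofChart hv.2 x, ← toChart_ofChart hv.2 y, endChart_extChartAt hv.2,
      endChart_extChartAt hv.2, bilinChart_extChartAt hv.2, bilinChart_extChartAt hv.2, hK.norden]
  parallel v hv := endChart_parallel hK ((extChartAt 𝓘(ℝ, E') (f p)).map_source hv.2)
  immersion v hv x hx := by
    rw [fderiv_mapChart hf.smooth hv] at hx
    have h1 := toChart_injective hv.2 (hx.trans (map_zero _).symm)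
    have h2 := hf.immersion _ (h1.trans (map_zero _).symm)
    rw [← toChart_ofChart ((extChartAt 𝓘(ℝ, E) p).map_target hv.1) x, h2, map_zero]
  normal v hv x := by
    rw [fderiv_mapChart hf.smooth hv, mapChart, bilinChart_extChartAt hv.2, hf.normal]
  timelike v hv := by
    rw [mapChart, bilinChart_extChartAt hv.2, hf.timelike]
  finrank_eq := hdim

end Transfer

/-! ### The induced structure in a chart -/

section InducedStructure

open Filter Topology Bundle

variable {E E' : Type*} [NormedAddCommGroup E] [NormedSpace ℝ E] [FiniteDimensional ℝ E]
  [NormedAddCommGroup E'] [NormedSpace ℝ E'] [FiniteDimensional ℝ E']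
  {M M' : Type*} [TopologicalSpace M] [ChartedSpace E M] [IsManifold 𝓘(ℝ, E) ∞ M]
  [TopologicalSpace M'] [ChartedSpace E' M'] [IsManifold 𝓘(ℝ, E') ∞ M']
  {J : EndField E' M'} {g' : BilinField E' M'} {f : M → M'}
  {N : Π p : M, TangentSpace 𝓘(ℝ, E') (f p)}

omit [FiniteDimensional ℝ E] [FiniteDimensional ℝ E'] [IsManifold 𝓘(ℝ, E) ∞ M]
  [IsManifold 𝓘(ℝ, E') ∞ M'] in
/-- An immersion determines the tangent vector with given image. -/
lemma tangentOf_eq {q : M} (hf : Function.Injective (df (E := E) (E' := E') f q))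
    {w : TangentSpace 𝓘(ℝ, E') (f q)} {x : TangentSpace 𝓘(ℝ, E) q} (h : df f q x = w) :
    tangentOf f q w = x :=
  hf ((Classical.epsilon_spec (p := fun x ↦ df f q x = w) ⟨x, h⟩).trans h.symm)

namespace IsTimelikeHypersurface

variable (hf : IsTimelikeHypersurface (E := E) g' f N) (hK : IsKaehlerNorden J g')
  (hdim : Module.finrank ℝ E' = Module.finrank ℝ E + 1) {p : M} {v : E}
  (hv : v ∈ chartDomain E E' f p)

local notation "H" => IsTimelikeHypersurface.toLocal hf hK hdim p
local notation "c⁻" => PartialEquiv.symm (extChartAt 𝓘(ℝ, E) p)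

include hv

omit [FiniteDimensional ℝ E] in
lemma B_toChart (x y : TangentSpace 𝓘(ℝ, E') (f (c⁻ v))) :
    (H).B v (toChart (f p) _ x) (toChart (f p) _ y) = g' (f (c⁻ v)) x y :=
  bilinChart_extChartAt hv.2 g' x y

omit [FiniteDimensional ℝ E] in
lemma I_toChart (x : TangentSpace 𝓘(ℝ, E') (f (c⁻ v))) :
    (H).I v (toChart (f p) _ x) = toChart (f p) _ (J (f (c⁻ v)) x) :=
  endChart_extChartAt hv.2 J x

omit [FiniteDimensional ℝ E] in
lemma D_eq (x : E) : (H).D v x = toChart (f p) _ (df f (c⁻ v) (ofChart p (c⁻ v) x)) :=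
  fderiv_mapChart hf.smooth hv x

omit [FiniteDimensional ℝ E] in
lemma D_toChart (x : TangentSpace 𝓘(ℝ, E) (c⁻ v)) :
    (H).D v (toChart p _ x) = toChart (f p) _ (df f (c⁻ v) x) := by
  rw [D_eq hf hK hdim hv, ofChart_toChart ((extChartAt 𝓘(ℝ, E) p).map_target hv.1)]

omit [FiniteDimensional ℝ E] in
lemma t_eq : (H).t v = angle J g' f N (c⁻ v) := by
  have h : (H).N v = toChart (f p) _ (N (c⁻ v)) := rfl
  rw [LocalHypersurface.t, h, I_toChart hf hK hdim hv, B_toChart hf hK hdim hv, angle]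

omit [FiniteDimensional ℝ E] in
lemma η_toChart (x : TangentSpace 𝓘(ℝ, E) (c⁻ v)) :
    (H).η v (toChart p _ x) = (hypersurfaceStructure J g' f N).η (c⁻ v) x := by
  have h : (H).N v = toChart (f p) _ (N (c⁻ v)) := rfl
  rw [LocalHypersurface.η_apply, t_eq hf hK hdim hv, h, I_toChart hf hK hdim hv,
    D_toChart hf hK hdim hv, B_toChart hf hK hdim hv, hK.metric.symm]
  rfl

omit [FiniteDimensional ℝ E] in
lemma g_toChart (x y : TangentSpace 𝓘(ℝ, E) (c⁻ v)) :
    (H).g v (toChart p _ x) (toChart p _ y) = (hypersurfaceStructure J g' f N).g (c⁻ v) x y := by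
  rw [LocalHypersurface.g_apply, D_toChart hf hK hdim hv, D_toChart hf hK hdim hv,
    B_toChart hf hK hdim hv]
  rfl

omit [FiniteDimensional ℝ E] in
lemma bilinChart_g : bilinChart p (hypersurfaceStructure J g' f N).g v = (H).g v := by
  have hq := (extChartAt 𝓘(ℝ, E) p).map_target hv.1
  ext x y
  rw [← toChart_ofChart hq x, ← toChart_ofChart hq y, bilinChart_toChart hv.1,
    g_toChart hf hK hdim hv]

lemma ξ_eq : toChart p _ ((hypersurfaceStructure (E := E) J g' f N).ξ (c⁻ v)) = (H).ξ v := by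
  have hq := (extChartAt 𝓘(ℝ, E) p).map_target hv.1
  have h : (H).N v = toChart (f p) _ (N (c⁻ v)) := rfl
  have h1 : (hypersurfaceStructure (E := E) J g' f N).ξ (c⁻ v) = ofChart p (c⁻ v) ((H).ξ v) := by
    apply tangentOf_eq (hf.immersion _)
    apply toChart_injective hv.2
    rw [← D_eq hf hK hdim hv, LocalHypersurface.D_ξ hv, h, I_toChart hf hK hdim hv,
      t_eq hf hK hdim hv, map_add, map_smul, map_smul]
  rw [h1, toChart_ofChart hq]

lemma φ_toChart (x : TangentSpace 𝓘(ℝ, E) (c⁻ v)) :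
    toChart p _ ((hypersurfaceStructure J g' f N).φ (c⁻ v) x) = (H).φ v (toChart p _ x) := by
  have hq := (extChartAt 𝓘(ℝ, E) p).map_target hv.1
  have h : (H).N v = toChart (f p) _ (N (c⁻ v)) := rfl
  have h1 : (hypersurfaceStructure J g' f N).φ (c⁻ v) x
      = ofChart p (c⁻ v) ((H).φ v (toChart p _ x)) := by
    apply tangentOf_eq (hf.immersion _)
    apply toChart_injective hv.2
    rw [← D_eq hf hK hdim hv, LocalHypersurface.D_φ hv, h, I_toChart hf hK hdim hv,
      t_eq hf hK hdim hv, D_toChart hf hK hdim hv, I_toChart hf hK hdim hv,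
      η_toChart hf hK hdim hv, map_add, map_smul, map_sub, map_smul, map_smul]
    rfl
  rw [h1, toChart_ofChart hq]

lemma toChart_leviCivita_g {X Y : VField E M} (hX : DifferentiableAt ℝ (vfieldChart p X) v)
    (hY : DifferentiableAt ℝ (vfieldChart p Y) v) :
    vfieldChart p (leviCivita (hypersurfaceStructure J g' f N).g X Y) v
      = cov (H).Γ (vfieldChart p Y) v (vfieldChart p X v) := by
  have h1 : bilinChart p (hypersurfaceStructure J g' f N).g =ᶠ[𝓝 v] (H).g := by
    filter_upwards [(isOpen_chartDomain hf.smooth.continuous p).mem_nhds hv] with w hw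
      using bilinChart_g hf hK hdim hw
  have h2 : christoffel (bilinChart p (hypersurfaceStructure J g' f N).g) v = (H).Γ v := by
    simp only [christoffel, christoffelLower, LocalHypersurface.Γ]
    rw [h1.fderiv_eq, h1.eq_of_nhds]
  rw [vfieldChart_leviCivita_of_isInvertible hv.1 (h1.differentiableAt_iff.2
    ((LocalHypersurface.contDiffAt_g hv).differentiableAt (by simp)))
    (by rw [h1.eq_of_nhds]; exact LocalHypersurface.g_isInvertible hv)
    (fun q x y ↦ hK.metric.symm _ _ _) hX hY, cov, cov, h2]

omit [FiniteDimensional ℝ E] [FiniteDimensional ℝ E'] [IsManifold 𝓘(ℝ, E) ∞ M] in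
include hf in
lemma eventually_mem : ∀ᶠ w in 𝓝 v, w ∈ chartDomain E E' f p :=
  (isOpen_chartDomain hf.smooth.continuous p).mem_nhds hv

lemma differentiableAt_φ_field {Y : VField E M} (hY : DifferentiableAt ℝ (vfieldChart p Y) v) :
    vfieldChart p (fun q ↦ (hypersurfaceStructure J g' f N).φ q (Y q))
        =ᶠ[𝓝 v] (fun w ↦ (H).φ w (vfieldChart p Y w)) ∧
    DifferentiableAt ℝ
      (vfieldChart p (fun q ↦ (hypersurfaceStructure J g' f N).φ q (Y q))) v := by
  have h1 : vfieldChart p (fun q ↦ (hypersurfaceStructure J g' f N).φ q (Y q))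
      =ᶠ[𝓝 v] fun w ↦ (H).φ w (vfieldChart p Y w) := by
    filter_upwards [eventually_mem hf hv] with w hw using φ_toChart hf hK hdim hw _
  exact ⟨h1, h1.differentiableAt_iff.2
    (((LocalHypersurface.contDiffAt_φ hv).differentiableAt (by simp)).clm_apply hY)⟩

lemma toChart_nablaEnd {X Y : VField E M} (hX : DifferentiableAt ℝ (vfieldChart p X) v)
    (hY : DifferentiableAt ℝ (vfieldChart p Y) v) :
    vfieldChart p (nablaEnd (hypersurfaceStructure J g' f N).g
      (hypersurfaceStructure J g' f N).φ X Y) v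
      = (H).nablaφ v (vfieldChart p X v) (vfieldChart p Y v) := by
  obtain ⟨h1, h2⟩ := differentiableAt_φ_field hf hK hdim hv hY
  have h3 := toChart_leviCivita_g hf hK hdim hv hX h2
  have h4 := toChart_leviCivita_g hf hK hdim hv hX hY
  have h5 := φ_toChart hf hK hdim hv
    (leviCivita (hypersurfaceStructure J g' f N).g X Y (c⁻ v))
  rw [cov_congr h1] at h3
  rw [← LocalHypersurface.nablaφ_apply hv hY, ← h3, ← h4]
  exact (map_sub (toChart p (c⁻ v)) _ _).trans (congrArg (_ - ·) h5)

lemma nablaForm_eq {X Y : VField E M} (hX : DifferentiableAt ℝ (vfieldChart p X) v)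
    (hY : DifferentiableAt ℝ (vfieldChart p Y) v) :
    nablaForm (hypersurfaceStructure J g' f N).g (hypersurfaceStructure J g' f N).η X Y (c⁻ v)
      = (H).g v (cov (H).Γ (H).ξ v (vfieldChart p X v)) (vfieldChart p Y v) := by
  have h1 : (fun w ↦ (hypersurfaceStructure J g' f N).η (c⁻ w) (Y (c⁻ w)))
      =ᶠ[𝓝 v] fun w ↦ (H).η w (vfieldChart p Y w) := by
    filter_upwards [eventually_mem hf hv] with w hw using (η_toChart hf hK hdim hw _).symm
  have h2 : DifferentiableAt ℝ (fun w ↦ (H).η w (vfieldChart p Y w)) v :=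
    ((LocalHypersurface.contDiffAt_η hv).differentiableAt (by simp)).clm_apply hY
  have h3 := toChart_leviCivita_g hf hK hdim hv hX hY
  have h4 := η_toChart hf hK hdim hv
    (leviCivita (hypersurfaceStructure J g' f N).g X Y (c⁻ v))
  rw [nablaForm, lieD_eq_fderiv hv.1 X (h1.differentiableAt_iff.2 h2), h1.fderiv_eq,
    LocalHypersurface.fderiv_η_apply hv hY, ← h3, ← h4]
  exact add_sub_cancel_right _ _

omit hv in
/-- The class `𝓕₄ ⊕ 𝓕₅` in charts. -/
lemma isF4F5 {n : ℕ} (hF : (hypersurfaceStructure (E := E) J g' f N).IsF4F5 n) :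
    (H).IsF4F5 (fun w ↦ (hypersurfaceStructure (E := E) J g' f N).θξ (c⁻ w) / (2 * n))
      (fun w ↦ (hypersurfaceStructure (E := E) J g' f N).θsξ (c⁻ w) / (2 * n)) := by
  intro w hw x y z
  have hq := (extChartAt 𝓘(ℝ, E) p).map_target hw.1
  have h1 := hF (c⁻ w) (ofChart p _ x) (ofChart p _ y) (ofChart p _ z)
  have hX := differentiableAt_vfieldChart_ext hw.1 (ofChart p (c⁻ w) x)
  have hY := differentiableAt_vfieldChart_ext hw.1 (ofChart p (c⁻ w) y)
  have hval : ∀ x, vfieldChart p (NordenGeometry.ext (ofChart p (c⁻ w) x)) w = x := fun x ↦ by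
    rw [vfieldChart, NordenGeometry.ext, FiberBundle.extend_apply_self, toChart_ofChart hq]
  have h2 := toChart_nablaEnd hf hK hdim hw hX hY
  rw [hval, hval] at h2
  rw [ContactNordenData.F, tensorF, ← g_toChart hf hK hdim hw, ← g_toChart hf hK hdim hw,
    ← g_toChart hf hK hdim hw, ← g_toChart hf hK hdim hw, ← g_toChart hf hK hdim hw,
    φ_toChart hf hK hdim hw, φ_toChart hf hK hdim hw, φ_toChart hf hK hdim hw,
    ← η_toChart hf hK hdim hw, ← η_toChart hf hK hdim hw, toChart_ofChart hq, toChart_ofChart hq,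
    toChart_ofChart hq] at h1
  rw [← h2]
  exact h1.trans (by ring)

/-- The canonical connection in charts. -/
lemma toChart_canonicalConnection {a b : E → ℝ} (hF : (H).IsF4F5 a b) {X Y : VField E M}
    (hX : DifferentiableAt ℝ (vfieldChart p X) v) (hY : DifferentiableAt ℝ (vfieldChart p Y) v) :
    vfieldChart p ((hypersurfaceStructure J g' f N).canonicalConnection X Y) v
      = (H).can (vfieldChart p Y) v (vfieldChart p X v) := by
  obtain ⟨h1, h2⟩ := differentiableAt_φ_field hf hK hdim hv hY
  have h3 := toChart_nablaEnd hf hK hdim hv hX h2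
  rw [h1.eq_of_nhds, LocalHypersurface.nablaφ_φ hv hF] at h3
  have h4 : vfieldChart p (hypersurfaceStructure (E := E) J g' f N).ξ =ᶠ[𝓝 v] (H).ξ := by
    filter_upwards [eventually_mem hf hv] with w hw using ξ_eq hf hK hdim hw
  have h5 := toChart_leviCivita_g hf hK hdim hv hX (h4.differentiableAt_iff.2
    ((LocalHypersurface.contDiffAt_ξ hv).differentiableAt (by simp)))
  rw [cov_congr h4] at h5
  have h6 := toChart_leviCivita_g hf hK hdim hv hX hY
  have h7 := nablaForm_eq hf hK hdim hv hX hY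
  have h8 := η_toChart hf hK hdim hv (Y (c⁻ v))
  have h9 := ξ_eq hf hK hdim hv
  rw [LocalHypersurface.can, ← h6, ← h5]
  rw [vfieldChart] at h3 h6 ⊢
  rw [ContactNordenData.canonicalConnection, map_sub, map_add, map_smul, map_add, map_smul,
    map_smul, h3, h7, h9, ← h8]
  change _ = _ - (H).η v (toChart p (c⁻ v) (Y (c⁻ v))) • _
  congr 1
  change _ + (1 / 2 : ℝ) • (_ • (H).ξ v + _ • (H).ξ v) = _ + _ • (H).ξ v
  rw [← add_smul, smul_smul]
  congr 2
  rw [h5]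
  ring

end IsTimelikeHypersurface

end InducedStructure

/-! ### Evaluation at the base point -/

section ChartsAtBasePoint

open Filter Topology Bundle

variable {E E' : Type*} [NormedAddCommGroup E] [NormedSpace ℝ E]
  [NormedAddCommGroup E'] [NormedSpace ℝ E']
  {M M' : Type*} [TopologicalSpace M] [ChartedSpace E M] [IsManifold 𝓘(ℝ, E) ∞ M]
  [TopologicalSpace M'] [ChartedSpace E' M'] [IsManifold 𝓘(ℝ, E') ∞ M']

lemma bilinChart_self (p : M) (g : BilinField E M) (x y : TangentSpace 𝓘(ℝ, E) p) :
    bilinChart p g (extChartAt 𝓘(ℝ, E) p p) x y = g p x y := by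
  have h := bilinChart_extChartAt (mem_extChartAt_source (I := 𝓘(ℝ, E)) p) g x y
  rwa [toChart_self, toChart_self] at h

lemma endChart_self (p : M) (J : EndField E M) (x : TangentSpace 𝓘(ℝ, E) p) :
    endChart p J (extChartAt 𝓘(ℝ, E) p p) x = J p x := by
  have h := endChart_extChartAt (mem_extChartAt_source (I := 𝓘(ℝ, E)) p) J x
  rwa [toChart_self, toChart_self] at h

lemma lieD_eq_fderiv_self (p : M) (X : VField E M) {h : M → ℝ}
    (hh : DifferentiableAt ℝ (fun w ↦ h ((extChartAt 𝓘(ℝ, E) p).symm w))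
      (extChartAt 𝓘(ℝ, E) p p)) :
    lieD X h p = fderiv ℝ (fun w ↦ h ((extChartAt 𝓘(ℝ, E) p).symm w)) (extChartAt 𝓘(ℝ, E) p p)
      (vfieldChart p X (extChartAt 𝓘(ℝ, E) p p)) := by
  have h1 := lieD_eq_fderiv (mem_extChartAt_target p) X hh
  rwa [extChartAt_to_inv] at h1

omit [IsManifold 𝓘(ℝ, E) ∞ M] [IsManifold 𝓘(ℝ, E') ∞ M'] in
lemma mem_chartDomain (f : M → M') (p : M) : extChartAt 𝓘(ℝ, E) p p ∈ chartDomain E E' f p := by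
  refine ⟨mem_extChartAt_target p, ?_⟩
  change f ((extChartAt 𝓘(ℝ, E) p).symm (extChartAt 𝓘(ℝ, E) p p))
    ∈ (extChartAt 𝓘(ℝ, E') (f p)).source
  rw [extChartAt_to_inv]
  exact mem_extChartAt_source _

/-- On an orthonormal totally real pair the curvature in a chart is given by the totally real
sectional curvatures. -/
lemma curv_of_orthonormal [FiniteDimensional ℝ E] {J : EndField E M} {g : BilinField E M}
    (hK : IsKaehlerNorden J g) {ν ν' : M → ℝ} (hν : HasConstTotallyRealCurvatures J g ν ν') {p : M}
    (x y : TangentSpace 𝓘(ℝ, E) p) (hx : g p x x = 1) (hy : g p y y = 1) (hxy : g p x y = 0)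
    (hx' : g p x (J p x) = 0) (hy' : g p y (J p y) = 0) (hxy' : g p x (J p y) = 0) :
    bilinChart p g (extChartAt 𝓘(ℝ, E) p p)
        (curv (christoffel (bilinChart p g)) (extChartAt 𝓘(ℝ, E) p p) x y y) x = ν p ∧
    bilinChart p g (extChartAt 𝓘(ℝ, E) p p)
        (curv (christoffel (bilinChart p g)) (extChartAt 𝓘(ℝ, E) p p) x y y) (J p x) = ν' p := by
  have hyx' : g p y (J p x) = 0 := by
    have h1 := hK.norden p x (J p y)
    rw [hK.sq, map_neg, hxy', neg_zero, neg_eq_zero] at h1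
    rw [hK.metric.symm]
    exact h1
  have hpi : pi1 g p x y y x = 1 := by
    rw [pi1, hx, hy, hxy]
    ring
  have htr : IsTotallyReal J g p x y := by
    intro a ha b hb
    obtain ⟨a₁, a₂, rfl⟩ := Submodule.mem_span_pair.1 ha
    obtain ⟨b₁, b₂, rfl⟩ := Submodule.mem_span_pair.1 hb
    have h1 (w : TangentSpace 𝓘(ℝ, E) p) (h : g p w (J p x) = 0) (h' : g p w (J p y) = 0) :
        g p w (J p (a₁ • x + a₂ • y)) = 0 := by
      rw [map_add, map_smul, map_smul, map_add, map_smul, map_smul, h, h', smul_zero, smul_zero,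
        add_zero]
    rw [map_add, map_smul, map_smul, hK.metric.symm p _ x, hK.metric.symm p _ y, h1 x hx' hxy',
      h1 y hyx' hy', smul_zero, smul_zero, add_zero]
  have h := hν p x y (by rw [hpi]; exact one_ne_zero) htr
  rw [hpi, div_one, div_one, curvature_leviCivita_eq hK.metric,
    curvature_leviCivita_eq hK.metric] at h
  exact h

/-- The curvature tensor in a chart of a Kähler manifold with Norden metric of constant totally real
sectional curvatures. -/
lemma curv_bilinChart_eq [FiniteDimensional ℝ E] (hdim : 3 ≤ Module.finrank ℝ E)
    {J : EndField E M} {g : BilinField E M} (hK : IsKaehlerNorden J g) {ν ν' : M → ℝ}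
    (hν : HasConstTotallyRealCurvatures J g ν ν') {p : M} {v : E}
    (hv : v = extChartAt 𝓘(ℝ, E) p p) (x y z u : E) :
    bilinChart p g v (curv (christoffel (bilinChart p g)) v x y z) u
      = ν p * (bilinChart p g v y z * bilinChart p g v x u
          - bilinChart p g v x z * bilinChart p g v y u
          - (bilinChart p g v y (endChart p J v z) * bilinChart p g v x (endChart p J v u)
            - bilinChart p g v x (endChart p J v z) * bilinChart p g v y (endChart p J v u)))
        + ν' p * (-(bilinChart p g v y z * bilinChart p g v x (endChart p J v u))
          + bilinChart p g v x z * bilinChart p g v y (endChart p J v u)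
          - bilinChart p g v y (endChart p J v z) * bilinChart p g v x u
          + bilinChart p g v x (endChart p J v z) * bilinChart p g v y u) := by
  subst hv
  have ht := mem_extChartAt_target (I := 𝓘(ℝ, E)) p
  have hB : ∀ x y : E, bilinChart p g (extChartAt 𝓘(ℝ, E) p p) x y = g p x y := bilinChart_self p g
  have hJ : ∀ x : E, endChart p J (extChartAt 𝓘(ℝ, E) p p) x = J p x := endChart_self p J
  refine curv_eq_of_const_totallyReal (bilinChart_symm hK.metric)
    (contDiffAt_bilinChart hK.metric ht) (bilinChart_isInvertible hK.metric ht)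
    (contDiffAt_endChart hK.smooth ht) ?_ hdim
    (fun x ↦ ?_) (fun x y ↦ ?_) ?_ x y z u
  · filter_upwards [target_mem_nhds p ht] with w hw using endChart_parallel hK hw
  · exact (hJ _).trans ((congrArg (J p) (hJ x)).trans (hK.sq p x))
  · rw [hJ, hJ]
    exact (hB _ _).trans ((hK.norden p x y).trans (congrArg Neg.neg (hB x y).symm))
  · intro x y hx hy hxy hx' hy' hxy'
    have hx₁ : g p x x = 1 := (hB x x).symm.trans hx
    have hy₁ : g p y y = 1 := (hB y y).symm.trans hy
    have hxy₁ : g p x y = 0 := (hB x y).symm.trans hxy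
    rw [hJ] at hx' hy' hxy'
    have hx₂ : g p x (J p x) = 0 := (hB x (J p x)).symm.trans hx'
    have hy₂ : g p y (J p y) = 0 := (hB y (J p y)).symm.trans hy'
    have hxy₂ : g p x (J p y) = 0 := (hB x (J p y)).symm.trans hxy'
    rw [hJ]
    exact curv_of_orthonormal hK hν x y hx₁ hy₁ hxy₁ hx₂ hy₂ hxy₂

end ChartsAtBasePoint

namespace IsTimelikeHypersurface

open Filter Topology

variable {E E' : Type*} [NormedAddCommGroup E] [NormedSpace ℝ E] [FiniteDimensional ℝ E]
  [NormedAddCommGroup E'] [NormedSpace ℝ E'] [FiniteDimensional ℝ E']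
  {M M' : Type*} [TopologicalSpace M] [ChartedSpace E M] [IsManifold 𝓘(ℝ, E) ∞ M]
  [TopologicalSpace M'] [ChartedSpace E' M'] [IsManifold 𝓘(ℝ, E') ∞ M']
  {J : EndField E' M'} {g' : BilinField E' M'} {f : M → M'}
  {N : Π p : M, TangentSpace 𝓘(ℝ, E') (f p)}
  (hf : IsTimelikeHypersurface (E := E) g' f N) (hK : IsKaehlerNorden J g')
  (hdim : Module.finrank ℝ E' = Module.finrank ℝ E + 1) (p : M)

local notation "H" => IsTimelikeHypersurface.toLocal hf hK hdim p
local notation "v₀" => extChartAt 𝓘(ℝ, E) p p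

omit [FiniteDimensional ℝ E] in
lemma g_self (x y : TangentSpace 𝓘(ℝ, E) p) :
    (H).g v₀ x y = (hypersurfaceStructure J g' f N).g p x y := by
  rw [← bilinChart_g hf hK hdim (mem_chartDomain f p)]
  exact bilinChart_self p _ x y

omit [FiniteDimensional ℝ E] in
lemma η_self (x : TangentSpace 𝓘(ℝ, E) p) :
    (H).η v₀ x = (hypersurfaceStructure J g' f N).η p x := by
  have h : ∀ q, q = (extChartAt 𝓘(ℝ, E) p).symm v₀ → ∀ x : TangentSpace 𝓘(ℝ, E) q,
      (H).η v₀ (toChart p q x) = (hypersurfaceStructure J g' f N).η q x := by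
    rintro _ rfl x
    exact η_toChart hf hK hdim (mem_chartDomain f p) x
  have h1 := h p (extChartAt_to_inv p).symm x
  rwa [toChart_self] at h1

lemma φ_self (x : TangentSpace 𝓘(ℝ, E) p) :
    (H).φ v₀ x = (hypersurfaceStructure J g' f N).φ p x := by
  have h : ∀ q, q = (extChartAt 𝓘(ℝ, E) p).symm v₀ → ∀ x : TangentSpace 𝓘(ℝ, E) q,
      toChart p q ((hypersurfaceStructure J g' f N).φ q x) = (H).φ v₀ (toChart p q x) := by
    rintro _ rfl x
    exact φ_toChart hf hK hdim (mem_chartDomain f p) x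
  have h1 := h p (extChartAt_to_inv p).symm x
  rw [toChart_self, toChart_self] at h1
  exact h1.symm

lemma g_φ_self (x y : TangentSpace 𝓘(ℝ, E) p) : (H).g v₀ x ((H).φ v₀ y)
    = (hypersurfaceStructure J g' f N).g p x ((hypersurfaceStructure J g' f N).φ p y) :=
  (g_self hf hK hdim p x _).trans
    (congrArg ((hypersurfaceStructure J g' f N).g p x) (φ_self hf hK hdim p y))

/-- The canonical curvature tensor in charts. -/
lemma K_eq {a b : E → ℝ} (hF : (H).IsF4F5 a b) (x y z u : TangentSpace 𝓘(ℝ, E) p) :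
    (hypersurfaceStructure J g' f N).K p x y z u
      = (H).g v₀ ((H).can (fun w ↦ (H).can (fun _ ↦ z) w y) v₀ x
          - (H).can (fun w ↦ (H).can (fun _ ↦ z) w x) v₀ y) u := by
  rw [← bilinChart_g hf hK hdim (mem_chartDomain f p)]
  refine curvature_eq_of_chart (C := (H).can) (isOpen_chartDomain hf.smooth.continuous p)
    (mem_chartDomain f p) (fun v hv ↦ hv.1)
    (fun X Y v hv hX hY ↦ toChart_canonicalConnection hf hK hdim hv hF hX hY)
    (fun W W' v _ h x ↦ ?_) (fun W v _ ↦ ?_)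
    (fun z x v hv ↦
      (LocalHypersurface.contDiffAt_can hv contDiffAt_const x).differentiableAt (by simp)) x y z u
  · rw [LocalHypersurface.can, LocalHypersurface.can, cov_congr h, h.eq_of_nhds]
  · simp [LocalHypersurface.can, cov_zero_right]

end IsTimelikeHypersurface

end NordenGeometry

end

theorem corollary3p2 (n : ℕ) (hn : 1 ≤ n)
    {E : Type*} [NormedAddCommGroup E] [NormedSpace ℝ E] [FiniteDimensional ℝ E]
    {E' : Type*} [NormedAddCommGroup E'] [NormedSpace ℝ E'] [FiniteDimensional ℝ E']
    (hE : Module.finrank ℝ E = 2 * n + 1) (hE' : Module.finrank ℝ E' = 2 * n + 2)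
    {M : Type*} [TopologicalSpace M] [ChartedSpace E M] [IsManifold 𝓘(ℝ, E) ∞ M]
    {M' : Type*} [TopologicalSpace M'] [ChartedSpace E' M'] [IsManifold 𝓘(ℝ, E') ∞ M']
    (J : EndField E' M') (g' : BilinField E' M') (hK : IsKaehlerNorden J g')
    (ν ν' : M' → ℝ) (hν : HasConstTotallyRealCurvatures J g' ν ν')
    (f : M → M') (N : Π p : M, TangentSpace 𝓘(ℝ, E') (f p))
    (hf : IsTimelikeHypersurface (E := E) g' f N)
    (S : ContactNordenData E M) (hS : S = hypersurfaceStructure J g' f N)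
    (hF : S.IsF4F5Closed n)
    (t : M → ℝ) (ht : t = angle J g' f N)
    (p : M) (x y z u : TangentSpace 𝓘(ℝ, E) p) :
    S.K p x y z u =
      (ν (f p) + S.θsξ p ^ 2 / (4 * n ^ 2)) * (S.π₁ p x y z u - S.π₂ p x y z u)
      + (ν' (f p) - S.θξ p * S.θsξ p / (4 * n ^ 2)) * S.π₃ p x y z u
      - (ν' (f p) * Real.tan (t p) + lieD S.ξ t p * S.θξ p / (4 * n)
          + lieD S.ξ t p * S.θsξ p / (4 * n) * Real.tan (t p)
          - lieD S.ξ S.θsξ p / (2 * n) + S.θξ p ^ 2 / (4 * n ^ 2)) * S.π₄ p x y z u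
      - (ν (f p) * Real.tan (t p) + lieD S.ξ t p * S.θξ p / (4 * n) * Real.tan (t p)
          - lieD S.ξ t p * S.θsξ p / (4 * n)
          - lieD S.ξ S.θξ p / (2 * n) - S.θξ p * S.θsξ p / (4 * n ^ 2)) * S.π₅ p x y z u
      - (S.θξ p * Real.cos (t p) + S.θsξ p * Real.sin (t p)) ^ 2 / (4 * n ^ 2)
          * (S.π₁ p x y z u - S.π₂ p x y z u - S.π₄ p x y z u)
      + (S.θξ p * Real.sin (t p) - S.θsξ p * Real.cos (t p))
          * (S.θξ p * Real.cos (t p) + S.θsξ p * Real.sin (t p)) / (4 * n ^ 2)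
          * (S.π₃ p x y z u + S.π₅ p x y z u) := by
  subst hS ht
  have hdim : Module.finrank ℝ E' = Module.finrank ℝ E + 1 := by omega
  have hv := mem_chartDomain (E := E) (E' := E') f p
  set S := hypersurfaceStructure (E := E) J g' f N with hS
  set H := hf.toLocal hK hdim p with hH
  set v₀ := extChartAt 𝓘(ℝ, E) p p with hv₀
  set a : E → ℝ := fun w ↦ S.θξ ((extChartAt 𝓘(ℝ, E) p).symm w) / (2 * n) with ha
  set b : E → ℝ := fun w ↦ S.θsξ ((extChartAt 𝓘(ℝ, E) p).symm w) / (2 * n) with hb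
  have hp : (extChartAt 𝓘(ℝ, E) p).symm v₀ = p := extChartAt_to_inv p
  have hF' : H.IsF4F5 a b := hf.isF4F5 hK hdim hF.mem
  have hn' : (n : ℝ) ≠ 0 := by positivity
  have hH2 : 2 ≤ Module.finrank ℝ E := by omega
  obtain ⟨ha', hb'⟩ := LocalHypersurface.contDiffAt_coeff hv hF' hH2
  have hξ : vfieldChart p S.ξ v₀ = H.ξ v₀ := IsTimelikeHypersurface.ξ_eq hf hK hdim hv
  have ht : H.t =ᶠ[nhds v₀] fun w ↦ angle J g' f N ((extChartAt 𝓘(ℝ, E) p).symm w) := by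
    filter_upwards [IsTimelikeHypersurface.eventually_mem hf hv] with w hw
      using IsTimelikeHypersurface.t_eq hf hK hdim hw
  have hdt : lieD S.ξ (angle J g' f N) p = fderiv ℝ H.t v₀ (H.ξ v₀) := by
    rw [lieD_eq_fderiv_self p S.ξ (ht.differentiableAt_iff.1
      ((LocalHypersurface.contDiffAt_t hv).differentiableAt (by simp))), ← ht.fderiv_eq, hξ]
  have hscale : ∀ h : M → ℝ, ContDiffAt ℝ ∞
      (fun w ↦ h ((extChartAt 𝓘(ℝ, E) p).symm w) / (2 * n)) v₀ →
      fderiv ℝ (fun w ↦ h ((extChartAt 𝓘(ℝ, E) p).symm w) / (2 * n)) v₀ (H.ξ v₀)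
        = lieD S.ξ h p / (2 * n) := by
    intro h hd
    have hd' := hd.differentiableAt (by simp)
    have h1 : (fun w ↦ h ((extChartAt 𝓘(ℝ, E) p).symm w))
        = fun w ↦ (2 * n : ℝ) * (h ((extChartAt 𝓘(ℝ, E) p).symm w) / (2 * n)) := by
      funext w
      field_simp
    have h2 : DifferentiableAt ℝ (fun w ↦ h ((extChartAt 𝓘(ℝ, E) p).symm w)) v₀ := by
      rw [h1]
      exact hd'.const_mul _
    have h3 := lieD_eq_fderiv_self p S.ξ h2
    rw [h1, fderiv_const_mul hd', ← hv₀, hξ, smul_apply, smul_eq_mul] at h3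
    rw [h3]
    field_simp
  have h := LocalHypersurface.canonical_curvature hv hF' hH2
    (curv_bilinChart_eq (by omega) hK hν (congrArg (extChartAt 𝓘(ℝ, E') (f p)) (congrArg f hp)))
    x y z u
  rw [← IsTimelikeHypersurface.K_eq hf hK hdim p hF'] at h
  have hg : ∀ x y : TangentSpace 𝓘(ℝ, E) p, H.g v₀ x y = S.g p x y :=
    IsTimelikeHypersurface.g_self hf hK hdim p
  have hgφ : ∀ x y : TangentSpace 𝓘(ℝ, E) p, H.g v₀ x (H.φ v₀ y) = S.g p x (S.φ p y) :=
    IsTimelikeHypersurface.g_φ_self hf hK hdim p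
  have hη : ∀ x : TangentSpace 𝓘(ℝ, E) p, H.η v₀ x = S.η p x :=
    IsTimelikeHypersurface.η_self hf hK hdim p
  have ha₀ : a v₀ = S.θξ p / (2 * n) := congrArg (fun q ↦ S.θξ q / (2 * n)) hp
  have hb₀ : b v₀ = S.θsξ p / (2 * n) := congrArg (fun q ↦ S.θsξ q / (2 * n)) hp
  have ht₀ : H.t v₀ = angle J g' f N p := ht.eq_of_nhds.trans (congrArg (angle J g' f N) hp)
  have ha₁ : fderiv ℝ a v₀ (H.ξ v₀) = lieD S.ξ S.θξ p / (2 * n) := hscale _ ha'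
  have hb₁ : fderiv ℝ b v₀ (H.ξ v₀) = lieD S.ξ S.θsξ p / (2 * n) := hscale _ hb'
  rw [← hdt, ha₀, hb₀, ht₀, ha₁, hb₁] at h
  rw [ContactNordenData.π₁, ContactNordenData.π₂, ContactNordenData.π₃, ContactNordenData.π₄,
    ContactNordenData.π₅, pi1, ← hgφ y z, ← hgφ y u, ← hgφ x z, ← hgφ x u, ← hg y z, ← hg y u,
    ← hg x z, ← hg x u, ← hη x, ← hη y, ← hη z, ← hη u]
  refine h.trans ?_
  ring
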